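/- Let $s\in(0,1)$, $N\in\mathbb N$ with $N>2s$, and $2^*_s=\frac{2N}{N-2s}$. Let $V,W:\mathbb R^N\to\mathbb R$ be Hölder continuous, $\Lambda\subset\mathbb R^N$ open and bounded, $x_0\in\mathbb R^N$ and $\rho_0>0$ such that $V,W\ge\rho_0$ on $\partial\Lambda$; $V(x_0),W(x_0)<\rho_0$; and $V(x)\ge V(x_0)>0$, $W(x)\ge W(x_0)>0$ for all $x\in\mathbb R^N$. Write $\mathbb R^2_+=[0,\infty)^2$ and let $2<p<2^*_s$. Let $Q,K\in C^2(\mathbb R^2_+,\mathbb R)$ be such that, for $(F,q)=(Q,p)$ and for $(F,q)=(K,2^*_s)$: * $F(tu,tv)=t^{q}F(u,v)$ for all $t>0$, $(u,v)\in\mathbb R^2_+$; * $|F_u(u,v)|+|F_v(u,v)|\le C_F(u^{q-1}+v^{q-1})$ on $\mathbb R^2_+$ for some constant $C_F>0$; * $F_u(0,1)=F_v(1,0)=0$ and $F_u(1,0)=F_v(0,1)=0$; * $F(u,v)>0$ for $u,v>0$, and $F_u,F_v\ge0$ on $\mathbb R^2_+$; and such that the function $G$ on $\mathbb R^2_+$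 with $G(u^{2^*_s},v^{2^*_s})=K(u,v)$ is concave. Extend $Q$ and $K$ by $0$ to the points of $\mathbb R^2$ with $u\le0$ or $v\le 0$. For $u\in L^2(\mathbb R^N)$ put $$\int_{\mathbb R^N}|(-\Delta)^{s/2}u|^2dx=\frac{C(N,s)}2\iint_{\mathbb R^{2N}}\frac{|u(x)-u(y)|^2}{|x-y|^{N+2s}}\,dx\,dy,\qquad C(N,s)=\Big(\int_{\mathbb R^N}\frac{1-\cos x_1}{|x|^{N+2s}}dx\Big)^{-1},$$ let $H^s(\mathbb R^N)$ be the set of $u\in L^2(\mathbb R^N)$ for which this is finite, and $$\widetilde S_K=\inf\Big\{\int_{\mathbb R^N}|(-\Delta)^{s/2}u|^2+|(-\Delta)^{s/2}v|^2dx:\ u,v\in H^s(\mathbb R^N),\ \int_{\mathbb R^N}K(u^+,v^+)dx=1\Big\}.$$ For $a>0$ and a constant $C$ let $\eta\in C^2(\mathbb R)$ be non-increasing with $\eta=1$ on $(-\infty,a]$, $\eta=0$ on $[5a,\infty)$, $|\eta'|\le C/a$, $|\eta''|\le C/a^2$. Put $$A=\max_{a\le|(u,v)|\le5a}\frac{Q(u,v)+\frac1{2^*_s}K(u,v)}{u^2+v^2},\qquad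 \hat Q(u,v)=\eta(|(u,v)|)\Big[Q+\tfrac1{2^*_s}K\Big](u,v)+(1-\eta(|(u,v)|))A(u^2+v^2),$$ $$H(x,u,v)=\chi_\Lambda(x)\Big[Q+\tfrac1{2^*_s}K\Big](u,v)+(1-\chi_\Lambda(x))\hat Q(u,v).$$ For $\varepsilon>0$ let $X_\varepsilon$ be the space of all $(u,v)\in H^s(\mathbb R^N)\times H^s(\mathbb R^N)$ for which $$\|(u,v)\|_\varepsilon^2=\int_{\mathbb R^N}|(-\Delta)^{s/2}u|^2+|(-\Delta)^{s/2}v|^2dx+\int_{\mathbb R^N}V(\varepsilon x)u^2+W(\varepsilon x)v^2\,dx$$ is finite, with this norm, and put $$J_\varepsilon(u,v)=\tfrac12\|(u,v)\|_\varepsilon^2-\int_{\mathbb R^N}H(\varepsilon x,u,v)\,dx,\qquad \phi_\varepsilon(z)=\langle J_\varepsilon'(z),z\rangle,\qquad \mathcal N_\varepsilon=\{z\in X_\varepsilon\setminus\{0\}:\phi_\varepsilon(z)=0\}.$$ Then for every $C$ there is $a_0>0$ such that for all $a\in(0,a_0)$, all $\eta$ as above and all $\varepsilon>0$, the functionals $J_\varepsilon$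 and $\phi_\varepsilon$ are of class $C^1$ on $X_\varepsilon$, and for every $c<\frac sN\widetilde S_K^{\,N/(2s)}$: 1. every sequence $(z_n)$ in $X_\varepsilon$ with $J_\varepsilon(z_n)\to c$ and $J_\varepsilon'(z_n)\to0$ in the dual of $X_\varepsilon$ has a subsequence converging in $X_\varepsilon$; 2. $J_\varepsilon$ restricted to $\mathcal N_\varepsilon$ satisfies the Palais–Smale condition at level $c$: every sequence $(z_n)$ in $\mathcal N_\varepsilon$ with $J_\varepsilon(z_n)\to c$ and $\big\|J_\varepsilon'(z_n)|_{\ker\phi_\varepsilon'(z_n)}\big\|\to0$ has a subsequence converging in $X_\varepsilon$ to a point of $\mathcal N_\varepsilon$. -/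

import Mathlib

open MeasureTheory Filter Topology

noncomputable section

namespace FracSystem

/-- The Euclidean space `ℝ^N`. -/
abbrev E (N : ℕ) : Type := EuclideanSpace ℝ (Fin N)

/-- The fractional critical Sobolev exponent `2*_s = 2N / (N - 2s)`. -/
def critExp (N : ℕ) (s : ℝ) : ℝ := 2 * N / (N - 2 * s)

/-! ### The fractional Sobolev energy -/

/-- The normalisation constant `C(N,s) = (∫ (1 - cos x₁) / |x|^(N+2s) dx)⁻¹` of `(-Δ)^s`. -/
def fracConst (N : ℕ) [NeZero N] (s : ℝ) : ℝ :=
  (∫ x : E N, (1 - Real.cos (x 0)) / ‖x‖ ^ ((N : ℝ) + 2 * s))⁻¹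

/-- The integrand `(u(x) - u(y)) (φ(x) - φ(y)) / |x - y|^(N+2s)` on `ℝ^N × ℝ^N`. -/
def gagliardoKernel {N : ℕ} (s : ℝ) (u φ : E N → ℝ) (q : E N × E N) : ℝ :=
  (u q.1 - u q.2) * (φ q.1 - φ q.2) / ‖q.1 - q.2‖ ^ ((N : ℝ) + 2 * s)

/-- For `u ∈ L²(ℝ^N)`: membership in `H^s(ℝ^N)`, i.e. `∫ |(-Δ)^(s/2) u|² dx < ∞`. -/
def MemHs {N : ℕ} (s : ℝ) (u : E N → ℝ) : Prop :=
  Integrable (gagliardoKernel s u u) ((volume : Measure (E N)).prod volume)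

/-- `∫ (-Δ)^(s/2) u (-Δ)^(s/2) φ dx
  = C(N,s)/2 ∬ (u(x) - u(y)) (φ(x) - φ(y)) / |x - y|^(N+2s) dx dy`,
the bilinear form of the fractional Laplacian on `H^s(ℝ^N)`. -/
def fracForm {N : ℕ} [NeZero N] (s : ℝ) (u φ : E N → ℝ) : ℝ :=
  fracConst N s / 2 * ∫ q, gagliardoKernel s u φ q ∂((volume : Measure (E N)).prod volume)

/-! ### The hypotheses on the potentials and on the nonlinearities -/

/-- Two Hölder continuous potentials `V`, `W` on `ℝ^N`, a bounded open set `Λ`, a point `x₀` and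
a number `ρ₀ > 0` subject to the conditions (H1)-(H3). -/
structure Potentials (N : ℕ) where
  V : E N → ℝ
  W : E N → ℝ
  Lam : Set (E N)
  x₀ : E N
  ρ₀ : ℝ
  holder_V : ∃ C r : NNReal, 0 < r ∧ r ≤ 1 ∧ HolderWith C r V
  holder_W : ∃ C r : NNReal, 0 < r ∧ r ≤ 1 ∧ HolderWith C r W
  isOpen_Lam : IsOpen Lam
  isBounded_Lam : Bornology.IsBounded Lam
  ρ₀_pos : 0 < ρ₀
  h1 : ∀ x ∈ frontier Lam, ρ₀ ≤ V x ∧ ρ₀ ≤ W x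
  h2 : V x₀ < ρ₀ ∧ W x₀ < ρ₀
  h3_pos : 0 < V x₀ ∧ 0 < W x₀
  h3_min : ∀ x, V x₀ ≤ V x ∧ W x₀ ≤ W x

/-- The closed quadrant `[0,∞) × [0,∞)`. -/
def quadrant : Set (ℝ × ℝ) := Set.Ici 0 ×ˢ Set.Ici 0

/-- The partial derivative `F_u` on the closed quadrant (one-sided on its boundary). -/
def partialU (F : ℝ × ℝ → ℝ) (z : ℝ × ℝ) : ℝ := fderivWithin ℝ F quadrant z (1, 0)

/-- The partial derivative `F_v` on the closed quadrant (one-sided on its boundary). -/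
def partialV (F : ℝ × ℝ → ℝ) (z : ℝ × ℝ) : ℝ := fderivWithin ℝ F quadrant z (0, 1)

/-- The conditions shared by `Q` (with `q = p`) and `K` (with `q = 2*_s`): `F` is of class `C²` on
the closed quadrant and `q`-homogeneous, its gradient has `(q-1)`-growth, is componentwise
nonnegative and vanishes on the axes, and `F > 0` in the open quadrant. -/
structure HomogeneousNonlinearity (q : ℝ) (F : ℝ × ℝ → ℝ) : Prop where
  contDiffOn : ContDiffOn ℝ 2 F quadrant
  homogeneous : ∀ t > 0, ∀ z ∈ quadrant, F (t * z.1, t * z.2) = t ^ q * F z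
  growth : ∃ C > 0, ∀ z ∈ quadrant,
    |partialU F z| + |partialV F z| ≤ C * (z.1 ^ (q - 1) + z.2 ^ (q - 1))
  partial_cross : partialU F (0, 1) = 0 ∧ partialV F (1, 0) = 0
  partial_axis : partialU F (1, 0) = 0 ∧ partialV F (0, 1) = 0
  pos : ∀ u v : ℝ, 0 < u → 0 < v → 0 < F (u, v)
  partial_nonneg : ∀ z ∈ quadrant, 0 ≤ partialU F z ∧ 0 ≤ partialV F z

/-- The function `G` on the quadrant with `G(u^q, v^q) = F(u, v)`. -/
def powerTransform (q : ℝ) (F : ℝ × ℝ → ℝ) (z : ℝ × ℝ) : ℝ := F (z.1 ^ (1 / q), z.2 ^ (1 / q))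

/-- The extension of `F` from the quadrant to `ℝ²` by `0` where `u ≤ 0` or `v ≤ 0`. -/
def extendZero (F : ℝ × ℝ → ℝ) (z : ℝ × ℝ) : ℝ :=
  {z : ℝ × ℝ | 0 < z.1 ∧ 0 < z.2}.indicator F z

/-- `S̃_K = inf { ∫ |(-Δ)^(s/2) u|² + |(-Δ)^(s/2) v|² : u, v ∈ H^s, ∫ K(u⁺, v⁺) = 1 }`. -/
def SK (N : ℕ) [NeZero N] (s : ℝ) (K : ℝ × ℝ → ℝ) : ℝ :=
  sInf {r : ℝ | ∃ u v : Lp ℝ 2 (volume : Measure (E N)), MemHs s u ∧ MemHs s v ∧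
    ∫ x, K (max (u x) 0, max (v x) 0) = 1 ∧ r = fracForm s u u + fracForm s v v}

/-! ### The penalised nonlinearity -/

/-- `η` is a non-increasing `C²` cut-off function with `η = 1` on `(-∞, a]`, `η = 0` on
`[5a, ∞)`, `|η'| ≤ C/a` and `|η''| ≤ C/a²`. -/
structure IsCutoff (C a : ℝ) (η : ℝ → ℝ) : Prop where
  contDiff : ContDiff ℝ 2 η
  antitone : Antitone η
  eq_one : ∀ t ≤ a, η t = 1
  eq_zero : ∀ t, 5 * a ≤ t → η t = 0
  deriv_le : ∀ t, |deriv η t| ≤ C / a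
  deriv2_le : ∀ t, |deriv (deriv η) t| ≤ C / a ^ 2

/-- The Euclidean length `|(u, v)|`. -/
def len (z : ℝ × ℝ) : ℝ := √(z.1 ^ 2 + z.2 ^ 2)

/-- `Q + K / 2*_s`, with `Q` and `K` extended by zero to `ℝ²`. -/
def totalNonlin (r : ℝ) (Q K : ℝ × ℝ → ℝ) (z : ℝ × ℝ) : ℝ :=
  extendZero Q z + 1 / r * extendZero K z

/-- `A = max { (Q + K/2*_s)(u, v) / (u² + v²) : a ≤ |(u, v)| ≤ 5a }`. -/
def penalConst (r : ℝ) (Q K : ℝ × ℝ → ℝ) (a : ℝ) : ℝ :=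
  sSup ((fun z : ℝ × ℝ => totalNonlin r Q K z / (z.1 ^ 2 + z.2 ^ 2)) ''
    {z | a ≤ len z ∧ len z ≤ 5 * a})

/-- `Q̂ = η(|(u,v)|) (Q + K/2*_s) + (1 - η(|(u,v)|)) A (u² + v²)`. -/
def Qhat (r : ℝ) (Q K : ℝ × ℝ → ℝ) (a : ℝ) (η : ℝ → ℝ) (z : ℝ × ℝ) : ℝ :=
  η (len z) * totalNonlin r Q K z +
    (1 - η (len z)) * (penalConst r Q K a * (z.1 ^ 2 + z.2 ^ 2))

/-- `H(x, u, v) = χ_Λ(x) (Q + K/2*_s)(u, v) + (1 - χ_Λ(x)) Q̂(u, v)`. -/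
def penalized {N : ℕ} (r : ℝ) (Lam : Set (E N)) (Q K : ℝ × ℝ → ℝ) (a : ℝ) (η : ℝ → ℝ)
    (x : E N) (z : ℝ × ℝ) : ℝ :=
  Lam.indicator (fun _ => (1 : ℝ)) x * totalNonlin r Q K z +
    (1 - Lam.indicator (fun _ => (1 : ℝ)) x) * Qhat r Q K a η z

/-! ### The space `X_ε` -/

section Auxiliary

variable {α : Type*} [MeasurableSpace α] {μ : Measure α}

lemma integrable_weight_mul {w f g : α → ℝ} (hw : AEStronglyMeasurable w μ)
    (hw0 : ∀ x, 0 ≤ w x) (hf : AEStronglyMeasurable f μ) (hg : AEStronglyMeasurable g μ)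
    (hf2 : Integrable (fun x => w x * f x ^ 2) μ) (hg2 : Integrable (fun x => w x * g x ^ 2) μ) :
    Integrable (fun x => w x * (f x * g x)) μ := by
  refine (hf2.add hg2).mono' (hw.mul (hf.mul hg)) (Eventually.of_forall fun x => ?_)
  have h : |f x * g x| ≤ f x ^ 2 + g x ^ 2 := by
    rw [abs_le]
    constructor <;> nlinarith [sq_nonneg (f x + g x), sq_nonneg (f x - g x)]
  calc ‖w x * (f x * g x)‖ = w x * |f x * g x| := by
        rw [Real.norm_eq_abs, abs_mul, abs_of_nonneg (hw0 x)]
    _ ≤ w x * (f x ^ 2 + g x ^ 2) := mul_le_mul_of_nonneg_left h (hw0 x)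
    _ = _ := by simp only [Pi.add_apply]; ring

end Auxiliary

section Space

variable {N : ℕ}

/-- `∫ U u φ dx` for a weight `U`. -/
def weightForm (U u φ : E N → ℝ) : ℝ := ∫ x, U x * (u x * φ x)

lemma holder_continuous {U : E N → ℝ} (h : ∃ C r : NNReal, 0 < r ∧ r ≤ 1 ∧ HolderWith C r U) :
    Continuous U := by
  obtain ⟨C, r, hr, -, h⟩ := h
  exact h.continuous hr

lemma Potentials.V_pos (P : Potentials N) (x : E N) : 0 < P.V x :=
  P.h3_pos.1.trans_le (P.h3_min x).1

lemma Potentials.W_pos (P : Potentials N) (x : E N) : 0 < P.W x :=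
  P.h3_pos.2.trans_le (P.h3_min x).2

lemma Potentials.continuous_V (P : Potentials N) (ε : ℝ) :
    Continuous (fun x : E N => P.V (ε • x)) :=
  (holder_continuous P.holder_V).comp (continuous_const_smul ε)

lemma Potentials.continuous_W (P : Potentials N) (ε : ℝ) :
    Continuous (fun x : E N => P.W (ε • x)) :=
  (holder_continuous P.holder_W).comp (continuous_const_smul ε)

/-- `L²(ℝ^N)`. -/
abbrev L2 (N : ℕ) : Type := Lp ℝ 2 (volume : Measure (E N))

/-- Elements of `L²` which lie in `H^s` and have `∫ U u² dx < ∞`. -/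
def MemWeighted (s : ℝ) (U : E N → ℝ) (u : E N → ℝ) : Prop :=
  MemHs s u ∧ Integrable (fun x => U x * u x ^ 2)

lemma kernel_eq (s : ℝ) (u φ : E N → ℝ) (q : E N × E N) :
    gagliardoKernel s u φ q =
      (‖q.1 - q.2‖ ^ ((N : ℝ) + 2 * s))⁻¹ * ((u q.1 - u q.2) * (φ q.1 - φ q.2)) := by
  rw [gagliardoKernel, div_eq_inv_mul]

lemma aesm_diff (u : L2 N) : AEStronglyMeasurable (fun q : E N × E N => u q.1 - u q.2)
    ((volume : Measure (E N)).prod volume) :=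
  (Lp.aestronglyMeasurable u).comp_fst.sub (Lp.aestronglyMeasurable u).comp_snd

lemma aesm_weight (s : ℝ) : AEStronglyMeasurable
    (fun q : E N × E N => (‖q.1 - q.2‖ ^ ((N : ℝ) + 2 * s))⁻¹)
    ((volume : Measure (E N)).prod volume) := by
  have : Measurable (fun q : E N × E N => (‖q.1 - q.2‖ ^ ((N : ℝ) + 2 * s))⁻¹) := by fun_prop
  exact this.aestronglyMeasurable

lemma integrable_kernel {s : ℝ} {u φ : L2 N} (hu : MemHs s u) (hφ : MemHs s φ) :
    Integrable (gagliardoKernel s u φ) ((volume : Measure (E N)).prod volume) := by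
  have h := integrable_weight_mul (aesm_weight s) (fun q => by positivity) (aesm_diff u)
    (aesm_diff φ) (hu.congr (Eventually.of_forall fun q => by simp only [kernel_eq, sq]))
    (hφ.congr (Eventually.of_forall fun q => by simp only [kernel_eq, sq]))
  exact h.congr (Eventually.of_forall fun q => by simp only [kernel_eq])

lemma ae_fst_snd {p : E N → Prop} (h : ∀ᵐ x, p x) :
    ∀ᵐ q ∂((volume : Measure (E N)).prod volume), p q.1 ∧ p q.2 :=
  (Measure.quasiMeasurePreserving_fst.ae h).and (Measure.quasiMeasurePreserving_snd.ae h)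

lemma kernel_add (s : ℝ) (u v φ : L2 N) :
    gagliardoKernel s (u + v : L2 N) φ =ᵐ[(volume : Measure (E N)).prod volume]
      fun q => gagliardoKernel s u φ q + gagliardoKernel s v φ q := by
  filter_upwards [ae_fst_snd (Lp.coeFn_add u v)] with q hq
  simp only [gagliardoKernel, hq.1, hq.2, Pi.add_apply]
  ring

lemma kernel_smul (s c : ℝ) (u φ : L2 N) :
    gagliardoKernel s (c • u : L2 N) φ =ᵐ[(volume : Measure (E N)).prod volume]
      fun q => c * gagliardoKernel s u φ q := by
  filter_upwards [ae_fst_snd (Lp.coeFn_smul c u)] with q hq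
  simp only [gagliardoKernel, hq.1, hq.2, Pi.smul_apply, smul_eq_mul]
  ring

lemma kernel_comm (s : ℝ) (u φ : E N → ℝ) : gagliardoKernel s u φ = gagliardoKernel s φ u := by
  funext q
  simp only [gagliardoKernel, mul_comm]

lemma memHs_add {s : ℝ} {u v : L2 N} (hu : MemHs s u) (hv : MemHs s v) :
    MemHs s (u + v : L2 N) := by
  have h1 : Integrable (gagliardoKernel s u (u + v : L2 N))
      ((volume : Measure (E N)).prod volume) := by
    rw [kernel_comm]
    exact (hu.add (integrable_kernel hv hu)).congr (kernel_add s u v u).symm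
  have h2 : Integrable (gagliardoKernel s v (u + v : L2 N))
      ((volume : Measure (E N)).prod volume) := by
    rw [kernel_comm]
    exact ((integrable_kernel hu hv).add hv).congr (kernel_add s u v v).symm
  exact (h1.add h2).congr (kernel_add s u v _).symm

lemma memHs_smul {s : ℝ} (c : ℝ) {u : L2 N} (hu : MemHs s u) : MemHs s (c • u : L2 N) := by
  have h1 : Integrable (gagliardoKernel s u (c • u : L2 N))
      ((volume : Measure (E N)).prod volume) := by
    rw [kernel_comm]
    exact (hu.const_mul c).congr (kernel_smul s c u u).symm
  exact (h1.const_mul c).congr (kernel_smul s c u _).symm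

lemma memWeighted_zero (s : ℝ) (U : E N → ℝ) : MemWeighted s U (0 : L2 N) := by
  have h0 : ∀ᵐ x, (0 : L2 N) x = 0 := by
    filter_upwards [Lp.coeFn_zero ℝ 2 (volume : Measure (E N))] with x hx using hx
  constructor
  · refine (integrable_zero _ ℝ _).congr ?_
    filter_upwards [ae_fst_snd h0] with q hq
    simp only [gagliardoKernel, hq.1, hq.2, Pi.zero_apply, sub_self, mul_zero, zero_div]
  · refine (integrable_zero _ ℝ _).congr ?_
    filter_upwards [h0] with x hx
    simp only [hx, Pi.zero_apply]
    ring

lemma integrable_weightForm {s : ℝ} {U : E N → ℝ} (hU : Continuous U) (hU0 : ∀ x, 0 < U x)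
    {u φ : L2 N} (hu : MemWeighted s U u) (hφ : MemWeighted s U φ) :
    Integrable (fun x => U x * (u x * φ x)) :=
  integrable_weight_mul hU.aestronglyMeasurable (fun x => (hU0 x).le)
    (Lp.aestronglyMeasurable u) (Lp.aestronglyMeasurable φ) hu.2 hφ.2

lemma memWeighted_add {s : ℝ} {U : E N → ℝ} (hU : Continuous U) (hU0 : ∀ x, 0 < U x)
    {u v : L2 N} (hu : MemWeighted s U u) (hv : MemWeighted s U v) :
    MemWeighted s U (u + v : L2 N) := by
  refine ⟨memHs_add hu.1 hv.1, ?_⟩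
  refine ((hu.2.add hv.2).add ((integrable_weightForm hU hU0 hu hv).const_mul 2)).congr ?_
  filter_upwards [Lp.coeFn_add u v] with x hx
  simp only [hx, Pi.add_apply]
  ring

lemma memWeighted_smul {s : ℝ} {U : E N → ℝ} (c : ℝ) {u : L2 N} (hu : MemWeighted s U u) :
    MemWeighted s U (c • u : L2 N) := by
  refine ⟨memHs_smul c hu.1, (hu.2.const_mul (c ^ 2)).congr ?_⟩
  filter_upwards [Lp.coeFn_smul c u] with x hx
  simp only [hx, Pi.smul_apply, smul_eq_mul]
  ring

lemma weightForm_add {s : ℝ} {U : E N → ℝ} (hU : Continuous U) (hU0 : ∀ x, 0 < U x)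
    {u v φ : L2 N} (hu : MemWeighted s U u) (hv : MemWeighted s U v) (hφ : MemWeighted s U φ) :
    weightForm U (u + v : L2 N) φ = weightForm U u φ + weightForm U v φ := by
  rw [weightForm, weightForm, weightForm, ← integral_add (integrable_weightForm hU hU0 hu hφ)
    (integrable_weightForm hU hU0 hv hφ)]
  refine integral_congr_ae ?_
  filter_upwards [Lp.coeFn_add u v] with x hx
  simp only [hx, Pi.add_apply]
  ring

lemma weightForm_smul (c : ℝ) (U : E N → ℝ) (u φ : L2 N) :
    weightForm U (c • u : L2 N) φ = c * weightForm U u φ := by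
  rw [weightForm, weightForm, ← integral_const_mul]
  refine integral_congr_ae ?_
  filter_upwards [Lp.coeFn_smul c u] with x hx
  simp only [hx, Pi.smul_apply, smul_eq_mul]
  ring

lemma weightForm_comm (U u φ : E N → ℝ) : weightForm U u φ = weightForm U φ u := by
  simp only [weightForm, mul_comm (u _)]

lemma weightForm_self_nonneg {U : E N → ℝ} (hU0 : ∀ x, 0 < U x) (u : E N → ℝ) :
    0 ≤ weightForm U u u :=
  integral_nonneg fun x => mul_nonneg (hU0 x).le (mul_self_nonneg _)

lemma weightForm_definite {s : ℝ} {U : E N → ℝ} (hU : Continuous U) (hU0 : ∀ x, 0 < U x)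
    {u : L2 N} (hu : MemWeighted s U u) (h : weightForm U u u = 0) : u = 0 := by
  rw [weightForm, integral_eq_zero_iff_of_nonneg
    (fun x => mul_nonneg (hU0 x).le (mul_self_nonneg _)) (integrable_weightForm hU hU0 hu hu)] at h
  refine Lp.ext ?_
  filter_upwards [h, Lp.coeFn_zero ℝ 2 (volume : Measure (E N))] with x hx h0
  rw [h0]
  simpa [(hU0 x).ne'] using hx

/-- The set of pairs `(u, v) ∈ H^s × H^s` with `∫ V(εx) u² + W(εx) v² dx < ∞`. -/
def Xsubmodule (P : Potentials N) (s ε : ℝ) : Submodule ℝ (L2 N × L2 N) where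
  carrier := {z | MemWeighted s (fun x => P.V (ε • x)) z.1 ∧
    MemWeighted s (fun x => P.W (ε • x)) z.2}
  zero_mem' := ⟨memWeighted_zero s _, memWeighted_zero s _⟩
  add_mem' := fun hz hw =>
    ⟨memWeighted_add (P.continuous_V ε) (fun _ => P.V_pos _) hz.1 hw.1,
      memWeighted_add (P.continuous_W ε) (fun _ => P.W_pos _) hz.2 hw.2⟩
  smul_mem' := fun c _ hz => ⟨memWeighted_smul c hz.1, memWeighted_smul c hz.2⟩

/-- The space `X_ε`; its norm is not the one inherited from `L² × L²`, hence a new type. -/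
def X (P : Potentials N) (s ε : ℝ) : Type := ↥(Xsubmodule P s ε)

instance (P : Potentials N) (s ε : ℝ) : AddCommGroup (X P s ε) :=
  inferInstanceAs (AddCommGroup ↥(Xsubmodule P s ε))

instance (P : Potentials N) (s ε : ℝ) : Module ℝ (X P s ε) :=
  inferInstanceAs (Module ℝ ↥(Xsubmodule P s ε))

/-- The first component `u` of an element of `X_ε`. -/
def X.u {P : Potentials N} {s ε : ℝ} (z : X P s ε) : L2 N := z.1.1

/-- The second component `v` of an element of `X_ε`. -/
def X.v {P : Potentials N} {s ε : ℝ} (z : X P s ε) : L2 N := z.1.2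

lemma fracConst_nonneg [NeZero N] (s : ℝ) : 0 ≤ fracConst N s := by
  refine inv_nonneg.2 (integral_nonneg fun x => ?_)
  exact div_nonneg (sub_nonneg.2 (Real.cos_le_one _)) (by positivity)

variable [NeZero N]

lemma fracForm_add {s : ℝ} {u v φ : L2 N} (hu : MemHs s u) (hv : MemHs s v) (hφ : MemHs s φ) :
    fracForm s (u + v : L2 N) φ = fracForm s u φ + fracForm s v φ := by
  rw [fracForm, integral_congr_ae (kernel_add s u v φ),
    integral_add (integrable_kernel hu hφ) (integrable_kernel hv hφ), mul_add]
  rfl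

lemma fracForm_smul (s c : ℝ) (u φ : L2 N) :
    fracForm s (c • u : L2 N) φ = c * fracForm s u φ := by
  rw [fracForm, integral_congr_ae (kernel_smul s c u φ), integral_const_mul, fracForm]
  ring

lemma fracForm_comm (s : ℝ) (u φ : E N → ℝ) : fracForm s u φ = fracForm s φ u := by
  rw [fracForm, kernel_comm, fracForm]

lemma fracForm_self_nonneg (s : ℝ) (u : E N → ℝ) : 0 ≤ fracForm s u u := by
  refine mul_nonneg (div_nonneg (fracConst_nonneg s) (by norm_num)) (integral_nonneg fun q => ?_)
  exact div_nonneg (mul_self_nonneg _) (by positivity)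

/-- The inner product of `X_ε`, whose norm is
`‖(u,v)‖_ε² = ∫ |(-Δ)^(s/2) u|² + |(-Δ)^(s/2) v|² dx + ∫ V(εx) u² + W(εx) v² dx`. -/
def Xinner {P : Potentials N} {s ε : ℝ} (z w : X P s ε) : ℝ :=
  fracForm s z.u w.u + fracForm s z.v w.v +
    (weightForm (fun x => P.V (ε • x)) z.u w.u + weightForm (fun x => P.W (ε • x)) z.v w.v)

/-- `Xinner` is an inner product. -/
@[reducible]
def Xcore (P : Potentials N) (s ε : ℝ) : InnerProductSpace.Core ℝ (X P s ε) where
  inner := Xinner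
  conj_inner_symm z w := by
    simp only [Xinner, conj_trivial]
    rw [fracForm_comm s w.u, fracForm_comm s w.v, weightForm_comm _ w.u, weightForm_comm _ w.v]
  re_inner_nonneg z := by
    simp only [Xinner, RCLike.re_to_real]
    exact add_nonneg (add_nonneg (fracForm_self_nonneg _ _) (fracForm_self_nonneg _ _))
      (add_nonneg (weightForm_self_nonneg (fun _ => P.V_pos _) _)
        (weightForm_self_nonneg (fun _ => P.W_pos _) _))
  add_left z₁ z₂ w := by
    have hu : (z₁ + z₂).u = z₁.u + z₂.u := rfl
    have hv : (z₁ + z₂).v = z₁.v + z₂.v := rfl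
    simp only [Xinner, hu, hv]
    rw [fracForm_add (u := z₁.u) (v := z₂.u) (φ := w.u) z₁.2.1.1 z₂.2.1.1 w.2.1.1,
      fracForm_add (u := z₁.v) (v := z₂.v) (φ := w.v) z₁.2.2.1 z₂.2.2.1 w.2.2.1,
      weightForm_add (u := z₁.u) (v := z₂.u) (φ := w.u) (P.continuous_V ε)
        (fun _ => P.V_pos _) z₁.2.1 z₂.2.1 w.2.1,
      weightForm_add (u := z₁.v) (v := z₂.v) (φ := w.v) (P.continuous_W ε)
        (fun _ => P.W_pos _) z₁.2.2 z₂.2.2 w.2.2]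
    ring
  smul_left z w c := by
    have hu : (c • z).u = c • z.u := rfl
    have hv : (c • z).v = c • z.v := rfl
    simp only [Xinner, hu, hv, fracForm_smul, weightForm_smul, conj_trivial]
    ring
  definite z hz := by
    have h1 := fracForm_self_nonneg s z.u
    have h2 := fracForm_self_nonneg s z.v
    have h3 := weightForm_self_nonneg (U := fun x => P.V (ε • x)) (fun _ => P.V_pos _) z.u
    have h4 := weightForm_self_nonneg (U := fun x => P.W (ε • x)) (fun _ => P.W_pos _) z.v
    simp only [Xinner] at hz
    have hu : z.u = 0 := weightForm_definite (P.continuous_V ε) (fun _ => P.V_pos _) z.2.1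
      (by linarith)
    have hv : z.v = 0 := weightForm_definite (P.continuous_W ε) (fun _ => P.W_pos _) z.2.2
      (by linarith)
    exact Subtype.ext (Prod.ext hu hv)

instance (P : Potentials N) (s ε : ℝ) : NormedAddCommGroup (X P s ε) :=
  (Xcore P s ε).toNormedAddCommGroup

instance (P : Potentials N) (s ε : ℝ) : InnerProductSpace ℝ (X P s ε) :=
  InnerProductSpace.ofCore (Xcore P s ε).toCore

/-- The modified functional `J_ε(u, v) = ½ ‖(u, v)‖_ε² - ∫ H(εx, u, v) dx` on `X_ε`. -/
def J (P : Potentials N) (s : ℝ) (Q K : ℝ × ℝ → ℝ) (a : ℝ) (η : ℝ → ℝ) (ε : ℝ)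
    (z : X P s ε) : ℝ :=
  1 / 2 * ‖z‖ ^ 2 - ∫ x, penalized (critExp N s) P.Lam Q K a η (ε • x) (z.u x, z.v x)

end Space

/-! ### The Nehari manifold and the Palais-Smale condition -/

section PalaisSmale

variable {Y : Type*} [NormedAddCommGroup Y] [NormedSpace ℝ Y]

/-- `φ(z) = ⟨I'(z), z⟩`. -/
def nehariFun (I : Y → ℝ) (z : Y) : ℝ := fderiv ℝ I z z

/-- The Nehari manifold `{z ≠ 0 : ⟨I'(z), z⟩ = 0}`. -/
def nehari (I : Y → ℝ) : Set Y := {z | z ≠ 0 ∧ nehariFun I z = 0}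

/-- The tangent space `ker φ'(z)` of the Nehari manifold at `z`. -/
def nehariTangent (I : Y → ℝ) (z : Y) : Submodule ℝ Y :=
  LinearMap.ker (fderiv ℝ (nehariFun I) z).toLinearMap

/-- The derivative at `z` of the restriction of `I` to the Nehari manifold, a continuous linear
functional on the tangent space. -/
def nehariDeriv (I : Y → ℝ) (z : Y) : nehariTangent I z →L[ℝ] ℝ :=
  (fderiv ℝ I z).comp (nehariTangent I z).subtypeL

/-- The Palais-Smale condition at level `c` for `I : Y → ℝ`. -/
def PalaisSmale (I : Y → ℝ) (c : ℝ) : Prop :=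
  ∀ z : ℕ → Y, Tendsto (fun n => I (z n)) atTop (𝓝 c) →
    Tendsto (fun n => ‖fderiv ℝ I (z n)‖) atTop (𝓝 0) →
    ∃ (z' : Y) (k : ℕ → ℕ), StrictMono k ∧ Tendsto (fun n => z (k n)) atTop (𝓝 z')

/-- The Palais-Smale condition at level `c` for the restriction of `I` to its Nehari manifold. -/
def NehariPalaisSmale (I : Y → ℝ) (c : ℝ) : Prop :=
  ∀ z : ℕ → Y, (∀ n, z n ∈ nehari I) → Tendsto (fun n => I (z n)) atTop (𝓝 c) →
    Tendsto (fun n => ‖nehariDeriv I (z n)‖) atTop (𝓝 0) →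
    ∃ z' ∈ nehari I, ∃ k : ℕ → ℕ, StrictMono k ∧ Tendsto (fun n => z (k n)) atTop (𝓝 z')

end PalaisSmale

end FracSystem

end

/-! ### Homogeneous nonlinearities and their extension by zero -/

noncomputable section
namespace FracSystem

/-! Near the origin the gradient of `Q + K/2*_s` is superlinear: for `|z| ≤ 5a` it is at most a
constant times `a^(p-2) |z|`. The bounds on the cut-off are scale invariant, so the gradients of
`Q̂` and of `z ↦ Q̂'(z)z` are at most `δ|z|` on the whole plane, with `δ` as small as desired once
`a` is small (`exists_penalization`). Compared with the positive infimum of the potentials, the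
nonlinearity outside `Λ` is then a small quadratic perturbation, and compactness can be lost only
through the critical term on the bounded set `{x : εx ∈ Λ}`.

Let `z_n` be a Palais-Smale sequence at level `c`. The combination `J - (1/p) J'(z)z` controls
`‖z‖²` (`norm_sq_le_sub`), so the sequence is bounded, and a subsequence converges almost everywhere
to some `z₀` in the space (`X.exists_seq_tendsto_ae`). Put `w_n = z_n - z₀` and test `J'(z_n)` with
`w_n`. The inner product yields `‖w_n‖² + o(1)`; the subcritical term vanishes because the set has
finite measure (`tendsto_integral_Q`); the Brezis-Lieb splitting and Euler's identity turn the
critical term into `m_n + o(1)`, where `m_n` is the integral of `K(w_n)` over that set; the outer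
term is at most half of the potential energy of `w_n`, up to `o(1)`. Hence the fractional energy of
`w_n` plus half of its potential energy is at most `m_n + o(1)` (`exists_tendsto_frac_add_pot_le`).
That `z₀` is a critical point is not needed for this.

Let `m_n → κ` along a subsequence. The definition of `S̃_K` gives `S̃_K κ^(2/2*_s) ≤ κ`, so `κ = 0`
or `κ ≥ S̃_K^(N/2s)`. On the other hand `J - ½ J'(z)z` has no quadratic part and dominates `s/N`
times the critical integral (`integral_K_le_sub`); the outer term has the right sign there because
`A` is a maximum over the annulus and `η` decreases. This forces `(s/N) κ ≤ c`, so below the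
threshold `κ = 0`, and then `w_n → 0` in norm.

On the Nehari manifold, subtracting `p φ(z) = 0` from `φ'(z)z` removes `Q` and leaves at most
`-((p-2)/2) ‖z‖²`. Evaluating at `z` itself therefore bounds the Lagrange multiplier, and a
constrained Palais-Smale sequence is a free one (`nehariPalaisSmale_of_palaisSmale`); the limit
stays on the manifold because the manifold keeps away from the origin. The function `φ` is `C¹`
because Euler's identity writes it through `Q`, `K` and the radial derivative of `Q̂`, and in the
latter the only second derivative is that of the cut-off.

The analytic background is proved by elementary means: differentiability of integral functionals on
`L^q` (`LpRepresentation.contDiff_integral`), and the Sobolev inequality (`sobolev`) and local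
compactness (`exists_seq_tendsto_ae_of_bounded`), both by comparing a function with its averages
over balls. -/

lemma isClosed_quadrant : IsClosed quadrant := isClosed_Ici.prod isClosed_Ici

lemma interior_quadrant : interior quadrant = {z : ℝ × ℝ | 0 < z.1 ∧ 0 < z.2} := by
  rw [quadrant, interior_prod_eq, interior_Ici]
  rfl

lemma convex_quadrant : Convex ℝ quadrant := (convex_Ici 0).prod (convex_Ici 0)

lemma uniqueDiffOn_quadrant : UniqueDiffOn ℝ quadrant :=
  uniqueDiffOn_convex convex_quadrant (by rw [interior_quadrant]; exact ⟨(1, 1), by simp⟩)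

lemma mem_quadrant {z : ℝ × ℝ} : z ∈ quadrant ↔ 0 ≤ z.1 ∧ 0 ≤ z.2 := Iff.rfl

lemma smul_mem_quadrant {t : ℝ} (ht : 0 < t) {z : ℝ × ℝ} (hz : z ∈ quadrant) :
    t • z ∈ quadrant :=
  ⟨mul_nonneg ht.le hz.1, mul_nonneg ht.le hz.2⟩

lemma norm_le_abs_add_abs (L : ℝ × ℝ →L[ℝ] ℝ) : ‖L‖ ≤ |L (1, 0)| + |L (0, 1)| := by
  refine L.opNorm_le_bound (by positivity) fun w => ?_
  have hw : w = w.1 • ((1, 0) : ℝ × ℝ) + w.2 • ((0, 1) : ℝ × ℝ) := by ext <;> simp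
  have h1 : |w.1| ≤ ‖w‖ := norm_fst_le w
  have h2 : |w.2| ≤ ‖w‖ := norm_snd_le w
  calc ‖L w‖ = |w.1 * L (1, 0) + w.2 * L (0, 1)| := by
        conv_lhs => rw [hw]
        rw [map_add, map_smul, map_smul, Real.norm_eq_abs, smul_eq_mul, smul_eq_mul]
    _ ≤ |w.1| * |L (1, 0)| + |w.2| * |L (0, 1)| := by
        rw [← abs_mul, ← abs_mul]; exact abs_add_le _ _
    _ ≤ ‖w‖ * |L (1, 0)| + ‖w‖ * |L (0, 1)| := by gcongr
    _ = _ := by ring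

namespace HomogeneousNonlinearity

variable {q : ℝ} {F : ℝ × ℝ → ℝ}

lemma hasFDerivWithinAt (h : HomogeneousNonlinearity q F) {z : ℝ × ℝ} (hz : z ∈ quadrant) :
    HasFDerivWithinAt F (fderivWithin ℝ F quadrant z) quadrant z :=
  (h.contDiffOn.differentiableOn (by norm_num) z hz).hasFDerivWithinAt

lemma fderivWithin_smul (h : HomogeneousNonlinearity q F) {t : ℝ} (ht : 0 < t) {z : ℝ × ℝ}
    (hz : z ∈ quadrant) (w : ℝ × ℝ) :
    t * fderivWithin ℝ F quadrant (t • z) w = t ^ q * fderivWithin ℝ F quadrant z w := by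
  have h1 : HasFDerivWithinAt (fun y : ℝ × ℝ => F (t • y))
      ((fderivWithin ℝ F quadrant (t • z)).comp (t • ContinuousLinearMap.id ℝ (ℝ × ℝ)))
      quadrant z :=
    HasFDerivWithinAt.comp z (h.hasFDerivWithinAt (smul_mem_quadrant ht hz))
      ((hasFDerivWithinAt_id z quadrant).const_smul t) fun y hy => smul_mem_quadrant ht hy
  have h2 : HasFDerivWithinAt (fun y : ℝ × ℝ => F (t • y))
      (t ^ q • fderivWithin ℝ F quadrant z) quadrant z :=
    ((h.hasFDerivWithinAt hz).const_smul (t ^ q)).congr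
      (fun y hy => h.homogeneous t ht y hy) (h.homogeneous t ht z hz)
  have h3 := congrArg (fun L : ℝ × ℝ →L[ℝ] ℝ => L w)
    ((uniqueDiffOn_quadrant z hz).eq h1 h2)
  simpa using h3

/-- Euler's identity: differentiate `t ↦ F(tz)` at `t = 1`. The ray `t > 0` stays in the quadrant,
so this works at boundary points too. -/
lemma euler_within (h : HomogeneousNonlinearity q F) {z : ℝ × ℝ} (hz : z ∈ quadrant) :
    fderivWithin ℝ F quadrant z z = q * F z := by
  have hγ : HasDerivWithinAt (fun t : ℝ => t • z) z (Set.Ioi 0) 1 := by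
    simpa using ((hasDerivAt_id (1 : ℝ)).smul_const z).hasDerivWithinAt
  have h0 : HasFDerivWithinAt F (fderivWithin ℝ F quadrant z) quadrant ((1 : ℝ) • z) := by
    rw [one_smul]; exact h.hasFDerivWithinAt hz
  have h1 : HasDerivWithinAt (fun t : ℝ => F (t • z)) (fderivWithin ℝ F quadrant z z)
      (Set.Ioi 0) 1 :=
    h0.comp_hasDerivWithinAt (1 : ℝ) hγ fun t ht => smul_mem_quadrant ht hz
  have h2 : HasDerivWithinAt (fun t : ℝ => F (t • z)) (q * F z) (Set.Ioi 0) 1 := by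
    have := ((Real.hasDerivAt_rpow_const (x := 1) (p := q) (Or.inl one_ne_zero)).mul_const
      (F z)).hasDerivWithinAt (s := Set.Ioi 0)
    simp only [Real.one_rpow, mul_one] at this
    exact this.congr (fun t ht => h.homogeneous t ht z hz) (h.homogeneous 1 one_pos z hz)
  exact (uniqueDiffOn_Ioi (0 : ℝ) 1 (by simp)).eq_deriv _ h1 h2

lemma norm_fderivWithin_le (h : HomogeneousNonlinearity q F) (hq : 1 < q) :
    ∃ C > 0, ∀ z ∈ quadrant, ‖fderivWithin ℝ F quadrant z‖ ≤ C * ‖z‖ ^ (q - 1) := by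
  obtain ⟨C, hC, hF⟩ := h.growth
  refine ⟨2 * C, by positivity, fun z hz => (norm_le_abs_add_abs _).trans ((hF z hz).trans ?_)⟩
  have hz' := mem_quadrant.1 hz
  have h1 : z.1 ^ (q - 1) ≤ ‖z‖ ^ (q - 1) :=
    Real.rpow_le_rpow hz'.1 ((le_abs_self _).trans (norm_fst_le z)) (by linarith)
  have h2 : z.2 ^ (q - 1) ≤ ‖z‖ ^ (q - 1) :=
    Real.rpow_le_rpow hz'.2 ((le_abs_self _).trans (norm_snd_le z)) (by linarith)
  nlinarith

/-- Both partial derivatives vanish at `(1,0)` and `(0,1)`, and homogeneity of the gradient carries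
this along the half-axes. At the origin the `(q-1)`-growth does it. -/
lemma fderivWithin_eq_zero (h : HomogeneousNonlinearity q F) (hq : 1 < q) {z : ℝ × ℝ}
    (hz : z ∈ quadrant) (hz' : z ∉ interior quadrant) : fderivWithin ℝ F quadrant z = 0 := by
  have key : ∀ w : ℝ × ℝ, w ∈ quadrant → partialU F w = 0 → partialV F w = 0 →
      ∀ t : ℝ, 0 < t → fderivWithin ℝ F quadrant (t • w) = 0 := by
    intro w hw hU hV t ht
    have h1 := h.fderivWithin_smul ht hw (1, 0)
    have h2 := h.fderivWithin_smul ht hw (0, 1)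
    rw [partialU] at hU
    rw [partialV] at hV
    rw [hU, mul_zero] at h1
    rw [hV, mul_zero] at h2
    rw [← norm_le_zero_iff]
    refine (norm_le_abs_add_abs _).trans ?_
    rw [(mul_eq_zero.1 h1).resolve_left ht.ne', (mul_eq_zero.1 h2).resolve_left ht.ne']
    simp
  obtain ⟨x, y⟩ := z
  obtain ⟨hx, hy⟩ : 0 ≤ x ∧ 0 ≤ y := hz
  rw [interior_quadrant] at hz'
  rcases hx.eq_or_lt with rfl | hx
  · rcases hy.eq_or_lt with rfl | hy
    · obtain ⟨C, -, hC⟩ := h.norm_fderivWithin_le hq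
      have := hC (0, 0) (mem_quadrant.2 ⟨le_rfl, le_rfl⟩)
      rw [Prod.mk_zero_zero, norm_zero, Real.zero_rpow (by linarith), mul_zero] at this
      exact norm_le_zero_iff.1 this
    · simpa using key (0, 1) (by simp [quadrant]) h.partial_cross.1 h.partial_axis.2 y hy
  · rcases hy.eq_or_lt with rfl | hy
    · simpa using key (1, 0) (by simp [quadrant]) h.partial_axis.1 h.partial_cross.2 x hx
    · exact absurd ⟨hx, hy⟩ hz'

lemma eq_zero (h : HomogeneousNonlinearity q F) (hq : 1 < q) {z : ℝ × ℝ}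
    (hz : z ∈ quadrant) (hz' : z ∉ interior quadrant) : F z = 0 := by
  have := h.euler_within hz
  rw [h.fderivWithin_eq_zero hq hz hz'] at this
  have h0 : q * F z = 0 := by simpa using this.symm
  exact (mul_eq_zero.1 h0).resolve_left (by linarith)

lemma extendZero_eq_indicator (h : HomogeneousNonlinearity q F) (hq : 1 < q) :
    extendZero F = quadrant.indicator F := by
  funext z
  rw [extendZero, ← interior_quadrant]
  by_cases hz : z ∈ interior quadrant
  · rw [Set.indicator_of_mem hz, Set.indicator_of_mem (interior_subset hz)]
  · rw [Set.indicator_of_notMem hz]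
    by_cases hz' : z ∈ quadrant
    · rw [Set.indicator_of_mem hz', h.eq_zero hq hz' hz]
    · rw [Set.indicator_of_notMem hz']

/-- On the boundary `F` and its gradient both vanish, so the derivatives within the quadrant and
within its complement are both zero and glue. This is what makes the extension by zero `C¹` across
the axes. -/
lemma hasFDerivAt_extendZero (h : HomogeneousNonlinearity q F) (hq : 1 < q) (z : ℝ × ℝ) :
    HasFDerivAt (extendZero F) (quadrant.indicator (fderivWithin ℝ F quadrant) z) z := by
  have hex := h.extendZero_eq_indicator hq
  by_cases hz : z ∈ quadrant
  · rw [Set.indicator_of_mem hz]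
    have h1 : HasFDerivWithinAt (extendZero F) (fderivWithin ℝ F quadrant z) quadrant z :=
      (h.hasFDerivWithinAt hz).congr (fun y hy => by rw [hex, Set.indicator_of_mem hy])
        (by rw [hex, Set.indicator_of_mem hz])
    by_cases hz' : z ∈ interior quadrant
    · exact h1.hasFDerivAt (mem_interior_iff_mem_nhds.1 hz')
    · rw [h.fderivWithin_eq_zero hq hz hz'] at h1 ⊢
      have h2 : HasFDerivWithinAt (extendZero F) (0 : ℝ × ℝ →L[ℝ] ℝ) quadrantᶜ z :=
        (hasFDerivWithinAt_const (0 : ℝ) z quadrantᶜ).congr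
          (fun y hy => by rw [hex, Set.indicator_of_notMem hy])
          (by rw [hex, Set.indicator_of_mem hz, h.eq_zero hq hz hz'])
      have h3 := h1.union h2
      rwa [Set.union_compl_self, hasFDerivWithinAt_univ] at h3
  · rw [Set.indicator_of_notMem hz]
    refine (hasFDerivAt_const (0 : ℝ) z).congr_of_eventuallyEq ?_
    filter_upwards [isClosed_quadrant.isOpen_compl.mem_nhds hz] with y hy
    rw [hex, Set.indicator_of_notMem hy]

lemma fderiv_extendZero (h : HomogeneousNonlinearity q F) (hq : 1 < q) :
    fderiv ℝ (extendZero F) = quadrant.indicator (fderivWithin ℝ F quadrant) :=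
  funext fun z => (h.hasFDerivAt_extendZero hq z).fderiv

lemma contDiff_extendZero (h : HomogeneousNonlinearity q F) (hq : 1 < q) :
    ContDiff ℝ 1 (extendZero F) := by
  rw [contDiff_one_iff_fderiv]
  refine ⟨fun z => (h.hasFDerivAt_extendZero hq z).differentiableAt, ?_⟩
  rw [h.fderiv_extendZero hq]
  refine continuous_indicator (fun z hz => ?_) ?_
  · rw [isClosed_quadrant.frontier_eq] at hz
    exact h.fderivWithin_eq_zero hq hz.1 hz.2
  · rw [isClosed_quadrant.closure_eq]
    exact h.contDiffOn.continuousOn_fderivWithin uniqueDiffOn_quadrant (by norm_num)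

lemma norm_fderiv_extendZero_le (h : HomogeneousNonlinearity q F) (hq : 1 < q) :
    ∃ C > 0, ∀ z, ‖fderiv ℝ (extendZero F) z‖ ≤ C * ‖z‖ ^ (q - 1) := by
  obtain ⟨C, hC, hF⟩ := h.norm_fderivWithin_le hq
  refine ⟨C, hC, fun z => ?_⟩
  rw [h.fderiv_extendZero hq]
  by_cases hz : z ∈ quadrant
  · rw [Set.indicator_of_mem hz]; exact hF z hz
  · rw [Set.indicator_of_notMem hz, norm_zero]; positivity

lemma euler (h : HomogeneousNonlinearity q F) (hq : 1 < q) (z : ℝ × ℝ) :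
    fderiv ℝ (extendZero F) z z = q * extendZero F z := by
  rw [h.fderiv_extendZero hq, h.extendZero_eq_indicator hq]
  by_cases hz : z ∈ quadrant
  · rw [Set.indicator_of_mem hz, Set.indicator_of_mem hz]; exact h.euler_within hz
  · rw [Set.indicator_of_notMem hz, Set.indicator_of_notMem hz]; simp

lemma extendZero_nonneg (h : HomogeneousNonlinearity q F) (z : ℝ × ℝ) : 0 ≤ extendZero F z :=
  Set.indicator_nonneg (fun z hz => (h.pos z.1 z.2 hz.1 hz.2).le) z

lemma extendZero_smul (h : HomogeneousNonlinearity q F) {t : ℝ} (ht : 0 < t)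
    (z : ℝ × ℝ) : extendZero F (t • z) = t ^ q * extendZero F z := by
  by_cases hz : 0 < z.1 ∧ 0 < z.2
  · rw [extendZero, extendZero, Set.indicator_of_mem, Set.indicator_of_mem]
    · exact h.homogeneous t ht z ⟨hz.1.le, hz.2.le⟩
    · exact hz
    · exact ⟨mul_pos ht hz.1, mul_pos ht hz.2⟩
  · rw [extendZero, extendZero, Set.indicator_of_notMem, Set.indicator_of_notMem, mul_zero]
    · exact hz
    · exact fun h' => hz ⟨(mul_pos_iff_of_pos_left ht).1 h'.1, (mul_pos_iff_of_pos_left ht).1 h'.2⟩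

/-- The extension by zero is `F(u⁺, v⁺)`. -/
lemma extendZero_eq_max (h : HomogeneousNonlinearity q F) (hq : 1 < q) (x y : ℝ) :
    extendZero F (x, y) = F (max x 0, max y 0) := by
  by_cases hz : 0 < x ∧ 0 < y
  · rw [extendZero, Set.indicator_of_mem (by exact hz), max_eq_left hz.1.le, max_eq_left hz.2.le]
  · rw [extendZero, Set.indicator_of_notMem (by exact hz)]
    refine (h.eq_zero hq (mem_quadrant.2 ⟨le_max_right _ _, le_max_right _ _⟩) ?_).symm
    rw [interior_quadrant]
    simpa using hz

end HomogeneousNonlinearity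

/-- A `C¹` function vanishing at the origin whose gradient has `(q-1)`-growth has `q`-growth. -/
lemma abs_le_of_norm_fderiv_le {f : ℝ × ℝ → ℝ} {q C : ℝ} (hq : 1 < q) (hf : ContDiff ℝ 1 f)
    (h0 : f 0 = 0) (hC : 0 ≤ C) (hf' : ∀ z, ‖fderiv ℝ f z‖ ≤ C * ‖z‖ ^ (q - 1)) (z : ℝ × ℝ) :
    |f z| ≤ C * ‖z‖ ^ q := by
  have h1 : ∀ y ∈ Metric.closedBall (0 : ℝ × ℝ) ‖z‖, ‖fderiv ℝ f y‖ ≤ C * ‖z‖ ^ (q - 1) := by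
    intro y hy
    rw [mem_closedBall_zero_iff] at hy
    refine (hf' y).trans ?_
    gcongr
  have h2 := (convex_closedBall (0 : ℝ × ℝ) ‖z‖).norm_image_sub_le_of_norm_fderiv_le
    (fun y _ => hf.differentiable (by norm_num) y) h1
    (x := 0) (y := z) (by simp) (by simp)
  rw [h0, sub_zero, sub_zero, Real.norm_eq_abs, mul_assoc] at h2
  refine h2.trans_eq ?_
  congr 1
  rcases eq_or_ne z 0 with rfl | hz
  · rw [norm_zero, mul_zero, Real.zero_rpow (by linarith)]
  · rw [← Real.rpow_add_one (norm_ne_zero_iff.2 hz)]; congr 1; ring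


/-! ### Euclidean length and radial cut-offs -/

lemma sq_len (z : ℝ × ℝ) : len z ^ 2 = z.1 ^ 2 + z.2 ^ 2 := Real.sq_sqrt (by positivity)

lemma len_nonneg (z : ℝ × ℝ) : 0 ≤ len z := Real.sqrt_nonneg _

/-- `‖z‖` is the maximum norm of `ℝ × ℝ`, whereas the cut-off and the penalisation use the Euclidean
`len`; this bound and `sum_sq_le` translate between the two. -/
lemma norm_sq_le (z : ℝ × ℝ) : ‖z‖ ^ 2 ≤ z.1 ^ 2 + z.2 ^ 2 := by
  rw [Prod.norm_def, Real.norm_eq_abs, Real.norm_eq_abs]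
  rcases max_choice |z.1| |z.2| with h | h <;> rw [h, sq_abs] <;> nlinarith [sq_nonneg z.1, sq_nonneg z.2]

lemma sum_sq_le (z : ℝ × ℝ) : z.1 ^ 2 + z.2 ^ 2 ≤ 2 * ‖z‖ ^ 2 := by
  have h1 : z.1 ^ 2 ≤ ‖z‖ ^ 2 := by
    rw [← sq_abs z.1]; exact pow_le_pow_left₀ (abs_nonneg _) (norm_fst_le z) 2
  have h2 : z.2 ^ 2 ≤ ‖z‖ ^ 2 := by
    rw [← sq_abs z.2]; exact pow_le_pow_left₀ (abs_nonneg _) (norm_snd_le z) 2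
  linarith

lemma norm_le_len (z : ℝ × ℝ) : ‖z‖ ≤ len z :=
  Real.le_sqrt_of_sq_le (norm_sq_le z)

lemma len_pos {z : ℝ × ℝ} (hz : z ≠ 0) : 0 < len z := (norm_pos_iff.2 hz).trans_le (norm_le_len z)

lemma continuous_len : Continuous len := by unfold len; fun_prop

lemma contDiff_sumSq {n : WithTop ℕ∞} : ContDiff ℝ n (fun z : ℝ × ℝ => z.1 ^ 2 + z.2 ^ 2) := by
  fun_prop

lemma hasFDerivAt_sumSq (z : ℝ × ℝ) : HasFDerivAt (fun z : ℝ × ℝ => z.1 ^ 2 + z.2 ^ 2)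
    ((2 * z.1) • ContinuousLinearMap.fst ℝ ℝ ℝ + (2 * z.2) • ContinuousLinearMap.snd ℝ ℝ ℝ) z := by
  have h1 := ((hasFDerivAt_fst (𝕜 := ℝ) (p := z)).pow 2).add ((hasFDerivAt_snd (𝕜 := ℝ) (p := z)).pow 2)
  refine h1.congr_fderiv ?_
  ext <;> simp

lemma fderiv_sumSq_apply (z w : ℝ × ℝ) :
    fderiv ℝ (fun z : ℝ × ℝ => z.1 ^ 2 + z.2 ^ 2) z w = 2 * (z.1 * w.1 + z.2 * w.2) := by
  rw [(hasFDerivAt_sumSq z).fderiv]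
  simp
  ring

lemma norm_fderiv_sumSq_le (z : ℝ × ℝ) :
    ‖fderiv ℝ (fun z : ℝ × ℝ => z.1 ^ 2 + z.2 ^ 2) z‖ ≤ 4 * ‖z‖ := by
  refine (norm_le_abs_add_abs _).trans ?_
  simp only [fderiv_sumSq_apply]
  have h1 : |z.1| ≤ ‖z‖ := norm_fst_le z
  have h2 : |z.2| ≤ ‖z‖ := norm_snd_le z
  simp only [mul_one, mul_zero, add_zero, zero_add, abs_mul, abs_two]
  linarith

lemma contDiffAt_len {z : ℝ × ℝ} (hz : z ≠ 0) {n : WithTop ℕ∞} : ContDiffAt ℝ n len z := by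
  refine contDiff_sumSq.contDiffAt.sqrt ?_
  rw [← sq_len]
  exact (pow_pos (len_pos hz) 2).ne'

lemma fderiv_len_apply {z : ℝ × ℝ} (hz : z ≠ 0) (w : ℝ × ℝ) :
    fderiv ℝ len z w = (z.1 * w.1 + z.2 * w.2) / len z := by
  have h := ((contDiffAt_len (n := 1) hz).differentiableAt (by norm_num)).hasFDerivAt.pow 2
  have h2 : (fun z => len z ^ 2) = fun z : ℝ × ℝ => z.1 ^ 2 + z.2 ^ 2 := funext sq_len
  have h3 := congrArg (fun L : ℝ × ℝ →L[ℝ] ℝ => L w) h.fderiv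
  rw [h2] at h3
  simp only [fderiv_sumSq_apply] at h3
  have := len_pos hz
  rw [eq_div_iff this.ne']
  simp at h3
  linarith

lemma fderiv_len_self {z : ℝ × ℝ} (hz : z ≠ 0) : fderiv ℝ len z z = len z := by
  rw [fderiv_len_apply hz, div_eq_iff (len_pos hz).ne']
  linarith [sq_len z]

lemma norm_fderiv_len_le {z : ℝ × ℝ} (hz : z ≠ 0) : ‖fderiv ℝ len z‖ ≤ 2 := by
  refine (norm_le_abs_add_abs _).trans ?_
  have h1 : |z.1| ≤ len z := (norm_fst_le z).trans (norm_le_len z)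
  have h2 : |z.2| ≤ len z := (norm_snd_le z).trans (norm_le_len z)
  have h0 := len_pos hz
  simp only [fderiv_len_apply hz, mul_one, mul_zero, add_zero, zero_add, abs_div, abs_of_pos h0]
  rw [← add_div, div_le_iff₀ h0]
  linarith

section Radial

variable {ψ : ℝ → ℝ} {a k : ℝ}

lemma radial_eventuallyEq (ha : 0 < a) (hk : ∀ t < a, ψ t = k) :
    (fun z => ψ (len z)) =ᶠ[𝓝 0] fun _ => k := by
  have : len 0 < a := by simpa [len] using ha
  filter_upwards [continuous_len.continuousAt.eventually_lt_const this] with z hz using hk _ hz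

/-- `len` is singular only at the origin, and there the composite is locally constant. -/
lemma contDiff_radial (ha : 0 < a) (hk : ∀ t < a, ψ t = k) {n : WithTop ℕ∞}
    (hψ : ContDiff ℝ n ψ) : ContDiff ℝ n (fun z => ψ (len z)) := by
  rw [contDiff_iff_contDiffAt]
  intro z
  rcases eq_or_ne z 0 with rfl | hz
  · exact contDiffAt_const.congr_of_eventuallyEq (radial_eventuallyEq ha hk)
  · exact hψ.contDiffAt.comp z (contDiffAt_len hz)

lemma fderiv_radial {z : ℝ × ℝ} (hz : z ≠ 0) (hψ : Differentiable ℝ ψ) :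
    fderiv ℝ (fun z => ψ (len z)) z = deriv ψ (len z) • fderiv ℝ len z :=
  ((hψ (len z)).hasDerivAt.comp_hasFDerivAt z
    ((contDiffAt_len (n := 1) hz).differentiableAt (by norm_num)).hasFDerivAt).fderiv

lemma fderiv_radial_self (hψ : Differentiable ℝ ψ) (z : ℝ × ℝ) :
    fderiv ℝ (fun z => ψ (len z)) z z = deriv ψ (len z) * len z := by
  rcases eq_or_ne z 0 with rfl | hz
  · simp [len]
  · simp [fderiv_radial hz hψ, fderiv_len_self hz]

lemma norm_fderiv_radial_le (ha : 0 < a) (hk : ∀ t < a, ψ t = k) (hψ : Differentiable ℝ ψ)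
    (z : ℝ × ℝ) : ‖fderiv ℝ (fun z => ψ (len z)) z‖ ≤ 2 * |deriv ψ (len z)| := by
  rcases eq_or_ne z 0 with rfl | hz
  · rw [(radial_eventuallyEq ha hk).fderiv_eq]
    simp
  · rw [fderiv_radial hz hψ, norm_smul, mul_comm, Real.norm_eq_abs]
    gcongr
    exact norm_fderiv_len_le hz

/-- The gradient of the product of a radial cut-off and a function of quadratic growth. -/
lemma norm_fderiv_radial_mul_le {b B δ : ℝ} {R : ℝ × ℝ → ℝ} (ha : 0 < a)
    (hk : ∀ t < a, ψ t = k) (hψ : Differentiable ℝ ψ) (hR : Differentiable ℝ R)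
    (hB : ∀ t, |ψ t| ≤ B) (hB' : ∀ t, 0 ≤ t → |deriv ψ t| * t ≤ B) (hb : ∀ t, b ≤ t → ψ t = 0)
    (hR0 : ∀ z, len z ≤ b → |R z| ≤ δ * ‖z‖ ^ 2)
    (hR1 : ∀ z, len z ≤ b → ‖fderiv ℝ R z‖ ≤ δ * ‖z‖) (hδ : 0 ≤ δ) (z : ℝ × ℝ) :
    ‖fderiv ℝ (fun z => ψ (len z) * R z) z‖ ≤ 3 * B * δ * ‖z‖ := by
  have hB0 : 0 ≤ B := (abs_nonneg _).trans (hB 0)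
  rcases le_or_gt (len z) b with hz | hz
  · have hd : DifferentiableAt ℝ (fun z => ψ (len z)) z := by
      rcases eq_or_ne z 0 with rfl | hz0
      · exact (radial_eventuallyEq ha hk).differentiableAt_iff.2 (differentiableAt_const _)
      · exact (hψ _).comp z ((contDiffAt_len (n := 1) hz0).differentiableAt (by norm_num))
    have h1 : fderiv ℝ (fun z => ψ (len z) * R z) z =
        ψ (len z) • fderiv ℝ R z + R z • fderiv ℝ (fun z => ψ (len z)) z :=
      fderiv_fun_mul hd (hR z)
    rw [h1]
    refine (norm_add_le _ _).trans ?_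
    rw [norm_smul, norm_smul, Real.norm_eq_abs, Real.norm_eq_abs]
    have h2 : |ψ (len z)| * ‖fderiv ℝ R z‖ ≤ B * (δ * ‖z‖) :=
      mul_le_mul (hB _) (hR1 z hz) (norm_nonneg _) hB0
    -- Only the scale-invariant quantity `t |ψ'(t)|` enters, so the final constant does not depend
    -- on the width of the cut-off.
    have h3 : |deriv ψ (len z)| * ‖z‖ ≤ B :=
      (mul_le_mul_of_nonneg_left (norm_le_len z) (abs_nonneg _)).trans (hB' _ (len_nonneg z))
    have h4 : |R z| * ‖fderiv ℝ (fun z => ψ (len z)) z‖ ≤ δ * ‖z‖ ^ 2 * (2 * |deriv ψ (len z)|) :=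
      mul_le_mul (hR0 z hz) (norm_fderiv_radial_le ha hk hψ z) (norm_nonneg _) (by positivity)
    have h5 : δ * ‖z‖ * (|deriv ψ (len z)| * ‖z‖) ≤ δ * ‖z‖ * B := by gcongr
    nlinarith
  · have h0 : (fun z => ψ (len z) * R z) =ᶠ[𝓝 z] fun _ => 0 := by
      filter_upwards [continuous_len.continuousAt.eventually_const_lt hz] with y hy
      rw [hb _ hy.le, zero_mul]
    rw [h0.fderiv_eq]
    simp only [fderiv_fun_const, Pi.zero_apply, norm_zero]
    positivity

end Radial

namespace IsCutoff

variable {C a : ℝ} {η : ℝ → ℝ}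

lemma differentiable (h : IsCutoff C a η) : Differentiable ℝ η :=
  h.contDiff.differentiable (by norm_num)

lemma contDiff_deriv (h : IsCutoff C a η) : ContDiff ℝ 1 (deriv η) :=
  ((contDiff_succ_iff_deriv (n := 1)).1 h.contDiff).2.2

lemma nonneg (h : IsCutoff C a η) (t : ℝ) : 0 ≤ η t := by
  rw [← h.eq_zero (max t (5 * a)) (le_max_right _ _)]
  exact h.antitone (le_max_left _ _)

lemma le_one (h : IsCutoff C a η) (t : ℝ) : η t ≤ 1 := by
  rw [← h.eq_one (min t a) (min_le_right _ _)]
  exact h.antitone (min_le_left _ _)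

lemma deriv_nonpos (h : IsCutoff C a η) (t : ℝ) : deriv η t ≤ 0 := h.antitone.deriv_nonpos

lemma deriv_eq_zero_of_lt (h : IsCutoff C a η) {t : ℝ} (ht : t < a) : deriv η t = 0 := by
  have : η =ᶠ[𝓝 t] fun _ => 1 := by
    filter_upwards [Iio_mem_nhds ht] with x hx using h.eq_one x (le_of_lt hx)
  rw [this.deriv_eq, deriv_const]

/-- The derivative is computed from the right, which covers the endpoint `t = 5a` as well. -/
lemma deriv_eq_zero (h : IsCutoff C a η) (t : ℝ) (ht : 5 * a ≤ t) : deriv η t = 0 := by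
  have h1 : HasDerivWithinAt η (deriv η t) (Set.Ici t) t :=
    (h.differentiable t).hasDerivAt.hasDerivWithinAt
  have h2 : HasDerivWithinAt η 0 (Set.Ici t) t :=
    (hasDerivWithinAt_const t (Set.Ici t) (0 : ℝ)).congr
      (fun x hx => h.eq_zero x (ht.trans hx)) (h.eq_zero t ht)
  exact (uniqueDiffOn_Ici t t Set.self_mem_Ici).eq_deriv _ h1 h2

lemma deriv2_eq_zero (h : IsCutoff C a η) (t : ℝ) (ht : 5 * a ≤ t) : deriv (deriv η) t = 0 := by
  have h1 : HasDerivWithinAt (deriv η) (deriv (deriv η) t) (Set.Ici t) t :=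
    (h.contDiff_deriv.differentiable (by norm_num) t).hasDerivAt.hasDerivWithinAt
  have h2 : HasDerivWithinAt (deriv η) 0 (Set.Ici t) t :=
    (hasDerivWithinAt_const t (Set.Ici t) (0 : ℝ)).congr
      (fun x hx => h.deriv_eq_zero x (ht.trans hx)) (h.deriv_eq_zero t ht)
  exact (uniqueDiffOn_Ici t t Set.self_mem_Ici).eq_deriv _ h1 h2

/-- The derivative lives on `t < 5a` and is at most `C/a` there, so the product does not see `a`.
This is why smallness can later be obtained by shrinking `a` with `C` fixed. -/
lemma abs_deriv_mul_le (h : IsCutoff C a η) (ha : 0 < a) {t : ℝ} (ht : 0 ≤ t) :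
    |deriv η t| * t ≤ 5 * |C| := by
  rcases le_or_gt (5 * a) t with h5 | h5
  · rw [h.deriv_eq_zero t h5]; simp
  · calc |deriv η t| * t ≤ |C| / a * (5 * a) := by
          refine mul_le_mul ((h.deriv_le t).trans ?_) h5.le ht (by positivity)
          gcongr; exact le_abs_self C
      _ = 5 * |C| := by field_simp

lemma abs_deriv2_mul_le (h : IsCutoff C a η) (ha : 0 < a) {t : ℝ} (ht : 0 ≤ t) :
    |deriv (deriv η) t| * t ^ 2 ≤ 25 * |C| := by
  rcases le_or_gt (5 * a) t with h5 | h5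
  · rw [h.deriv2_eq_zero t h5]; simp
  · calc |deriv (deriv η) t| * t ^ 2 ≤ |C| / a ^ 2 * (5 * a) ^ 2 := by
          refine mul_le_mul ((h.deriv2_le t).trans ?_) (by gcongr) (by positivity) (by positivity)
          gcongr; exact le_abs_self C
      _ = 25 * |C| := by field_simp; norm_num

/-- The radial derivative `t η'(t)` of the cut-off. -/
lemma contDiff_radialDeriv (h : IsCutoff C a η) : ContDiff ℝ 1 (fun t => deriv η t * t) :=
  h.contDiff_deriv.mul contDiff_id

lemma radialDeriv_eq_zero_of_lt (h : IsCutoff C a η) : ∀ t < a, deriv η t * t = 0 :=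
  fun t ht => by rw [h.deriv_eq_zero_of_lt ht, zero_mul]

/-- The constant `1 + 30|C|` is a common bound for `|η|`, `t|η'|`, `|tη'|` and `t|(tη')'|`, the last
one being at most `25|C| + 5|C|`. -/
lemma abs_radialDeriv_le (h : IsCutoff C a η) (ha : 0 < a) (t : ℝ) :
    |deriv η t * t| ≤ 1 + 30 * |C| := by
  rcases le_or_gt 0 t with ht | ht
  · rw [abs_mul, abs_of_nonneg ht]
    linarith [h.abs_deriv_mul_le ha ht, abs_nonneg C]
  · rw [h.deriv_eq_zero_of_lt (ht.trans ha)]; simp; positivity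

lemma abs_deriv_radialDeriv_le (h : IsCutoff C a η) (ha : 0 < a) (t : ℝ) (ht : 0 ≤ t) :
    |deriv (fun t => deriv η t * t) t| * t ≤ 1 + 30 * |C| := by
  have h1 : deriv (fun t => deriv η t * t) t = deriv (deriv η) t * t + deriv η t := by
    have := ((h.contDiff_deriv.differentiable (by norm_num) t).hasDerivAt.mul (hasDerivAt_id t)).deriv
    simpa [Pi.mul_def] using this
  rw [h1]
  calc |deriv (deriv η) t * t + deriv η t| * t
      ≤ (|deriv (deriv η) t| * t + |deriv η t|) * t := by
        gcongr
        refine (abs_add_le _ _).trans ?_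
        rw [abs_mul, abs_of_nonneg ht]
    _ = |deriv (deriv η) t| * t ^ 2 + |deriv η t| * t := by ring
    _ ≤ _ := by linarith [h.abs_deriv_mul_le ha ht, h.abs_deriv2_mul_le ha ht]

end IsCutoff

/-- The function `η F + (1 - η) A |z|²`, interpolating between `F` and a multiple of `|z|²`. -/
def blend (η : ℝ → ℝ) (A : ℝ) (F : ℝ × ℝ → ℝ) (z : ℝ × ℝ) : ℝ :=
  η (len z) * F z + (1 - η (len z)) * (A * (z.1 ^ 2 + z.2 ^ 2))

/-! ### Interpolation between a nonlinearity and a quadratic -/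

section Blend

variable {C a A δ : ℝ} {η : ℝ → ℝ} {F G : ℝ × ℝ → ℝ}

lemma blend_eq (η : ℝ → ℝ) (A : ℝ) (F : ℝ × ℝ → ℝ) : blend η A F = fun z =>
    η (len z) * (F z - A * (z.1 ^ 2 + z.2 ^ 2)) + A * (z.1 ^ 2 + z.2 ^ 2) := by
  funext z
  rw [blend]
  ring

lemma contDiff_sub_sumSq (hF : ContDiff ℝ 1 F) (A : ℝ) :
    ContDiff ℝ 1 (fun z : ℝ × ℝ => F z - A * (z.1 ^ 2 + z.2 ^ 2)) :=
  hF.sub (contDiff_const.mul contDiff_sumSq)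

lemma contDiff_blend (ha : 0 < a) (hη : IsCutoff C a η) (hF : ContDiff ℝ 1 F) :
    ContDiff ℝ 1 (blend η A F) := by
  rw [blend_eq]
  exact ((contDiff_radial ha (fun t ht => hη.eq_one t ht.le) (hη.contDiff.of_le (by norm_num))).mul
    (contDiff_sub_sumSq hF A)).add (contDiff_const.mul contDiff_sumSq)

/-- The radial derivative is again a blend, with `G` and `2A` in place of `F` and `A`, up to a term
carrying the cut-off `tη'(t)`. If `F` satisfies Euler-type identities, no derivative of `F` is left
on the right, so the expression can be differentiated once more. -/
lemma fderiv_blend_self (ha : 0 < a) (hη : IsCutoff C a η) (hF : ContDiff ℝ 1 F)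
    (hG : ∀ z, fderiv ℝ F z z = G z) (z : ℝ × ℝ) :
    fderiv ℝ (blend η A F) z z =
      deriv η (len z) * len z * (F z - A * (z.1 ^ 2 + z.2 ^ 2)) + blend η (2 * A) G z := by
  have h1 : DifferentiableAt ℝ (fun z => η (len z)) z :=
    (contDiff_radial ha (fun t ht => hη.eq_one t ht.le) hη.contDiff).differentiable (by norm_num) z
  have h2 : DifferentiableAt ℝ F z := hF.differentiable (by norm_num) z
  have h3 := hasFDerivAt_sumSq z
  have h4 := (h1.hasFDerivAt.mul (h2.hasFDerivAt.sub (h3.const_mul A))).add (h3.const_mul A)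
  rw [blend_eq]
  have h5 : (fun z : ℝ × ℝ => η (len z) * (F z - A * (z.1 ^ 2 + z.2 ^ 2)) + A * (z.1 ^ 2 + z.2 ^ 2))
    = ((fun z => η (len z)) * (F - fun z => A * (z.1 ^ 2 + z.2 ^ 2)) +
      fun z => A * (z.1 ^ 2 + z.2 ^ 2)) := rfl
  rw [h5, h4.fderiv]
  simp [hG, fderiv_radial_self hη.differentiable, blend]
  ring

lemma abs_sub_sumSq_le (hA : |A| ≤ δ) {D : ℝ} {z : ℝ × ℝ} (h : |F z| ≤ D * ‖z‖ ^ 2) :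
    |F z - A * (z.1 ^ 2 + z.2 ^ 2)| ≤ (D + 4 * δ) * ‖z‖ ^ 2 := by
  have h1 := sum_sq_le z
  have h2 : 0 ≤ z.1 ^ 2 + z.2 ^ 2 := by positivity
  have h3 : |A| * (z.1 ^ 2 + z.2 ^ 2) ≤ δ * (2 * ‖z‖ ^ 2) :=
    mul_le_mul hA h1 h2 ((abs_nonneg A).trans hA)
  have h4 : 0 ≤ δ * ‖z‖ ^ 2 := mul_nonneg ((abs_nonneg A).trans hA) (by positivity)
  refine (abs_sub _ _).trans ?_
  rw [abs_mul, abs_of_nonneg h2]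
  nlinarith

lemma norm_fderiv_sub_sumSq_le (hA : |A| ≤ δ) {D : ℝ} (hF : ContDiff ℝ 1 F) {z : ℝ × ℝ}
    (h : ‖fderiv ℝ F z‖ ≤ D * ‖z‖) :
    ‖fderiv ℝ (fun z : ℝ × ℝ => F z - A * (z.1 ^ 2 + z.2 ^ 2)) z‖ ≤ (D + 4 * δ) * ‖z‖ := by
  have h1 := norm_fderiv_sumSq_le z
  have h2 : |A| * ‖fderiv ℝ (fun z : ℝ × ℝ => z.1 ^ 2 + z.2 ^ 2) z‖ ≤ δ * (4 * ‖z‖) :=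
    mul_le_mul hA h1 (norm_nonneg _) ((abs_nonneg A).trans hA)
  have hs := (hasFDerivAt_sumSq z).differentiableAt
  rw [fderiv_fun_sub (hF.differentiable (by norm_num) z) (hs.const_mul A), fderiv_const_mul hs]
  refine (norm_sub_le _ _).trans ?_
  rw [norm_smul, Real.norm_eq_abs]
  linarith

lemma norm_fderiv_add_sumSq_le {R : ℝ × ℝ → ℝ} (hA : |A| ≤ δ) {D : ℝ} (hR : ContDiff ℝ 1 R)
    {z : ℝ × ℝ} (h : ‖fderiv ℝ R z‖ ≤ D * ‖z‖) :
    ‖fderiv ℝ (fun z : ℝ × ℝ => R z + A * (z.1 ^ 2 + z.2 ^ 2)) z‖ ≤ (D + 4 * δ) * ‖z‖ := by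
  have h1 := norm_fderiv_sub_sumSq_le (A := -A) (δ := δ) (by rwa [abs_neg]) hR h
  simpa only [neg_mul, sub_neg_eq_add] using h1

/-- The bound `D` on `A` is kept apart from `δ` because the blend occurring in the radial derivative
has coefficient `2A`. -/
lemma norm_fderiv_blend_le (ha : 0 < a) (hη : IsCutoff C a η) (hF : ContDiff ℝ 1 F)
    (hF0 : ∀ z, len z ≤ 5 * a → |F z| ≤ δ * ‖z‖ ^ 2)
    (hF1 : ∀ z, len z ≤ 5 * a → ‖fderiv ℝ F z‖ ≤ δ * ‖z‖) {D : ℝ} (hA : |A| ≤ D) (hδ : 0 ≤ δ)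
    (z : ℝ × ℝ) :
    ‖fderiv ℝ (blend η A F) z‖ ≤ (3 * (1 + 30 * |C|) * (δ + 4 * D) + 4 * D) * ‖z‖ := by
  rw [blend_eq]
  have hD : 0 ≤ D := (abs_nonneg A).trans hA
  have hθ : ContDiff ℝ 1 (fun z => η (len z)) :=
    contDiff_radial ha (fun t ht => hη.eq_one t ht.le) (hη.contDiff.of_le (by norm_num))
  refine norm_fderiv_add_sumSq_le hA (hθ.mul (contDiff_sub_sumSq hF A)) ?_
  refine norm_fderiv_radial_mul_le ha (fun t ht => hη.eq_one t ht.le) hη.differentiable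
    ((contDiff_sub_sumSq hF A).differentiable (by norm_num)) (fun t => ?_) (fun t ht => ?_)
    hη.eq_zero (fun z hz => abs_sub_sumSq_le hA (hF0 z hz))
    (fun z hz => norm_fderiv_sub_sumSq_le hA hF (hF1 z hz)) (by positivity) z
  · rw [abs_of_nonneg (hη.nonneg t)]
    linarith [hη.le_one t, abs_nonneg C]
  · linarith [hη.abs_deriv_mul_le ha ht, abs_nonneg C]

lemma contDiff_fderiv_blend_self (ha : 0 < a) (hη : IsCutoff C a η) (hF : ContDiff ℝ 1 F)
    (hG : ContDiff ℝ 1 G) (hFG : ∀ z, fderiv ℝ F z z = G z) :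
    ContDiff ℝ 1 (fun z => fderiv ℝ (blend η A F) z z) := by
  simp only [fderiv_blend_self ha hη hF hFG]
  exact ((contDiff_radial ha hη.radialDeriv_eq_zero_of_lt hη.contDiff_radialDeriv).mul
    (contDiff_sub_sumSq hF A)).add (contDiff_blend ha hη hG)

lemma norm_fderiv_fderiv_blend_self_le (ha : 0 < a) (hη : IsCutoff C a η) (hF : ContDiff ℝ 1 F)
    (hG : ContDiff ℝ 1 G) (hFG : ∀ z, fderiv ℝ F z z = G z)
    (hF0 : ∀ z, len z ≤ 5 * a → |F z| ≤ δ * ‖z‖ ^ 2)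
    (hF1 : ∀ z, len z ≤ 5 * a → ‖fderiv ℝ F z‖ ≤ δ * ‖z‖)
    (hG0 : ∀ z, len z ≤ 5 * a → |G z| ≤ δ * ‖z‖ ^ 2)
    (hG1 : ∀ z, len z ≤ 5 * a → ‖fderiv ℝ G z‖ ≤ δ * ‖z‖) (hA : |A| ≤ δ) (z : ℝ × ℝ) :
    ‖fderiv ℝ (fun z => fderiv ℝ (blend η A F) z z) z‖ ≤ 50 * (1 + 30 * |C|) * δ * ‖z‖ := by
  have hδ : 0 ≤ δ := (abs_nonneg A).trans hA
  simp only [fderiv_blend_self ha hη hF hFG]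
  have hτ := contDiff_radial ha hη.radialDeriv_eq_zero_of_lt hη.contDiff_radialDeriv
  have h1 : ‖fderiv ℝ (fun z => deriv η (len z) * len z * (F z - A * (z.1 ^ 2 + z.2 ^ 2))) z‖
      ≤ 3 * (1 + 30 * |C|) * (δ + 4 * δ) * ‖z‖ :=
    norm_fderiv_radial_mul_le (b := 5 * a) ha hη.radialDeriv_eq_zero_of_lt
      (hη.contDiff_radialDeriv.differentiable (by norm_num))
      ((contDiff_sub_sumSq hF A).differentiable (by norm_num)) (hη.abs_radialDeriv_le ha)
      (hη.abs_deriv_radialDeriv_le ha) (fun t ht => by rw [hη.deriv_eq_zero t ht, zero_mul])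
      (fun z hz => abs_sub_sumSq_le hA (hF0 z hz))
      (fun z hz => norm_fderiv_sub_sumSq_le hA hF (hF1 z hz)) (by positivity) z
  have h2 := norm_fderiv_blend_le ha hη hG hG0 hG1 (A := 2 * A) (D := 2 * δ)
    (by rw [abs_mul, abs_two]; linarith) hδ z
  rw [fderiv_fun_add ((hτ.mul (contDiff_sub_sumSq hF A)).differentiable (by norm_num) z)
    ((contDiff_blend ha hη hG).differentiable (by norm_num) z)]
  -- The factor `50` is `15 + 27 + 8`: `15` from `h1`, `27` and `8` from the two terms of `h2`.
  refine (norm_add_le _ _).trans ((add_le_add h1 h2).trans ?_)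
  have h3 : 0 ≤ δ * ‖z‖ := by positivity
  have h4 : 0 ≤ |C| * (δ * ‖z‖) := by positivity
  nlinarith

/-- The term with `η'` is a product of two nonpositive factors on the annulus, since `η` decreases
and `A` dominates the quotient there, and it vanishes elsewhere. What remains is `η (G - 2F) ≥ 0`;
the quadratic parts cancel. -/
lemma blend_le_half_fderiv_self (ha : 0 < a) (hη : IsCutoff C a η) (hF : ContDiff ℝ 1 F)
    (hFG : ∀ z, fderiv ℝ F z z = G z) (hle : ∀ z, 2 * F z ≤ G z)
    (hA : ∀ z, a ≤ len z → len z ≤ 5 * a → F z ≤ A * (z.1 ^ 2 + z.2 ^ 2)) (z : ℝ × ℝ) :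
    blend η A F z ≤ 1 / 2 * fderiv ℝ (blend η A F) z z := by
  rw [fderiv_blend_self ha hη hF hFG]
  have h1 : 0 ≤ deriv η (len z) * len z * (F z - A * (z.1 ^ 2 + z.2 ^ 2)) := by
    rcases lt_or_ge (len z) a with h | h
    · rw [hη.deriv_eq_zero_of_lt h]; simp
    rcases le_or_gt (len z) (5 * a) with h' | h'
    · exact mul_nonneg_of_nonpos_of_nonpos
        (mul_nonpos_of_nonpos_of_nonneg (hη.deriv_nonpos _) (len_nonneg z))
        (sub_nonpos.2 (hA z h h'))
    · rw [hη.deriv_eq_zero _ h'.le]; simp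
  have h2 : 0 ≤ η (len z) * (G z - 2 * F z) :=
    mul_nonneg (hη.nonneg _) (sub_nonneg.2 (hle z))
  rw [blend, blend]
  linarith

end Blend

/-- Since `b ≤ 1`, the factor `b^(p-k)` serves all exponents `q ≥ p` at once, hence both `Q` and
`K`. -/
lemma rpow_le_mul_rpow {t b p q k : ℝ} (ht : 0 ≤ t) (htb : t ≤ b) (hb : b ≤ 1) (hkp : k < p)
    (hpq : p ≤ q) (hk : 0 < k) : t ^ q ≤ b ^ (p - k) * t ^ k := by
  rcases ht.eq_or_lt with rfl | ht
  · rw [Real.zero_rpow (by linarith), Real.zero_rpow hk.ne', mul_zero]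
  · have h1 : t ^ q = t ^ (q - k) * t ^ k := by rw [← Real.rpow_add ht]; congr 1; ring
    rw [h1]
    gcongr
    calc t ^ (q - k) ≤ t ^ (p - k) :=
          Real.rpow_le_rpow_of_exponent_ge ht (htb.trans hb) (by linarith)
      _ ≤ b ^ (p - k) := Real.rpow_le_rpow ht.le htb (by linarith)

lemma norm_fderiv_comb_le {f g : ℝ × ℝ → ℝ} (hf : ContDiff ℝ 1 f) (hg : ContDiff ℝ 1 g)
    (c d : ℝ) (z : ℝ × ℝ) :
    ‖fderiv ℝ (fun z => c * f z + d * g z) z‖ ≤ |c| * ‖fderiv ℝ f z‖ + |d| * ‖fderiv ℝ g z‖ := by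
  have hf' : DifferentiableAt ℝ f z := hf.differentiable (by norm_num) z
  have hg' : DifferentiableAt ℝ g z := hg.differentiable (by norm_num) z
  rw [fderiv_fun_add (hf'.const_mul c) (hg'.const_mul d), fderiv_const_mul hf',
    fderiv_const_mul hg']
  refine (norm_add_le _ _).trans ?_
  rw [norm_smul, norm_smul, Real.norm_eq_abs, Real.norm_eq_abs]

lemma extendZero_zero (F : ℝ × ℝ → ℝ) : extendZero F 0 = 0 :=
  Set.indicator_of_notMem (by simp) F

lemma fderiv_comb_self {p q : ℝ} {Q K : ℝ × ℝ → ℝ} (hp : 1 < p) (hq : 1 < q)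
    (hQ : HomogeneousNonlinearity p Q) (hK : HomogeneousNonlinearity q K) (c d : ℝ) (z : ℝ × ℝ) :
    fderiv ℝ (fun z => c * extendZero Q z + d * extendZero K z) z z =
      c * p * extendZero Q z + d * q * extendZero K z := by
  have hf' : DifferentiableAt ℝ (extendZero Q) z :=
    (hQ.contDiff_extendZero hp).differentiable (by norm_num) z
  have hg' : DifferentiableAt ℝ (extendZero K) z :=
    (hK.contDiff_extendZero hq).differentiable (by norm_num) z
  rw [fderiv_fun_add (hf'.const_mul c) (hg'.const_mul d), fderiv_const_mul hf',
    fderiv_const_mul hg']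
  simp [hQ.euler hp, hK.euler hq]
  ring

/-- For small `a` the penalised nonlinearity `Q̂` has a gradient of small linear growth. -/
theorem exists_penalization {p r : ℝ} {Q K : ℝ × ℝ → ℝ} (hp : 2 < p) (hpr : p < r)
    (hQ : HomogeneousNonlinearity p Q) (hK : HomogeneousNonlinearity r K) (C : ℝ) {δ : ℝ}
    (hδ : 0 < δ) :
    ∃ a₀ > 0, ∀ a : ℝ, 0 < a → a < a₀ → ∀ η : ℝ → ℝ, IsCutoff C a η →
      ContDiff ℝ 1 (Qhat r Q K a η) ∧
      ContDiff ℝ 1 (fun z => fderiv ℝ (Qhat r Q K a η) z z) ∧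
      (∀ z, ‖fderiv ℝ (Qhat r Q K a η) z‖ ≤ δ * ‖z‖) ∧
      (∀ z, ‖fderiv ℝ (fun z => fderiv ℝ (Qhat r Q K a η) z z) z‖ ≤ δ * ‖z‖) ∧
      (∀ z, Qhat r Q K a η z ≤ 1 / 2 * fderiv ℝ (Qhat r Q K a η) z z) ∧
      Qhat r Q K a η 0 = 0 := by
  have hp1 : 1 < p := by linarith
  have hr1 : 1 < r := by linarith
  have hQ1 := hQ.contDiff_extendZero hp1
  have hK1 := hK.contDiff_extendZero hr1
  obtain ⟨CQ, hCQ, hQ2⟩ := hQ.norm_fderiv_extendZero_le hp1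
  obtain ⟨CK, hCK, hK2⟩ := hK.norm_fderiv_extendZero_le hr1
  have hQ0 := abs_le_of_norm_fderiv_le hp1 hQ1 (extendZero_zero Q) hCQ.le hQ2
  have hK0 := abs_le_of_norm_fderiv_le hr1 hK1 (extendZero_zero K) hCK.le hK2
  set F : ℝ × ℝ → ℝ := totalNonlin r Q K with hFdef
  have hFeq : F = fun z => 1 * extendZero Q z + 1 / r * extendZero K z := by
    funext z; rw [hFdef, totalNonlin, one_mul]
  -- By Euler's identity `G` is the radial derivative of `F`; the factor `2*_s` cancels the
  -- coefficient of `K`.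
  set G : ℝ × ℝ → ℝ := fun z => p * extendZero Q z + 1 * extendZero K z with hGdef
  have hF : ContDiff ℝ 1 F := by
    rw [hFeq]; exact (contDiff_const.mul hQ1).add (contDiff_const.mul hK1)
  have hG : ContDiff ℝ 1 G := (contDiff_const.mul hQ1).add (contDiff_const.mul hK1)
  have hFG : ∀ z, fderiv ℝ F z z = G z := by
    intro z
    rw [hFeq, fderiv_comb_self hp1 hr1 hQ hK, hGdef]
    field_simp
  set D : ℝ := p * CQ + CK with hD
  have hDpos : 0 < D := by positivity
  set B : ℝ := 50 * (1 + 30 * |C|) with hB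
  have hBpos : 0 < B := by positivity
  have hir : 1 / r ≤ 1 := by rw [div_le_one (by linarith)]; linarith
  -- The first entry gives `5a ≤ 1`, the second `B D (5a)^(p-2) ≤ δ`, which is all the smallness
  -- that is used.
  refine ⟨min (1 / 5) ((δ / (B * D)) ^ (1 / (p - 2)) / 5), by positivity, fun a ha haa η hη => ?_⟩
  obtain ⟨ha1, ha2⟩ := lt_min_iff.1 haa
  have ha5 : 5 * a ≤ 1 := by linarith
  set e : ℝ := (5 * a) ^ (p - 2) with he
  have he0 : 0 < e := by positivity
  have heδ : B * (D * e) ≤ δ := by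
    have h1 : e ≤ δ / (B * D) := by
      calc e ≤ ((δ / (B * D)) ^ (1 / (p - 2))) ^ (p - 2) :=
            Real.rpow_le_rpow (by positivity) (by linarith) (by linarith)
        _ = δ / (B * D) := by
            rw [← Real.rpow_mul (by positivity), one_div_mul_cancel (by linarith), Real.rpow_one]
    rw [le_div_iff₀ (by positivity)] at h1
    linarith
  have hgrow : ∀ z : ℝ × ℝ, len z ≤ 5 * a → ∀ q, p ≤ q →
      ‖z‖ ^ q ≤ e * ‖z‖ ^ 2 ∧ ‖z‖ ^ (q - 1) ≤ e * ‖z‖ := by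
    intro z hz q hq
    have hz' := (norm_le_len z).trans hz
    constructor
    · have := rpow_le_mul_rpow (norm_nonneg z) hz' ha5 hp hq two_pos
      rwa [Real.rpow_two] at this
    · have := rpow_le_mul_rpow (k := 1) (p := p - 1) (q := q - 1) (norm_nonneg z) hz' ha5
        (by linarith) (by linarith) one_pos
      rwa [Real.rpow_one, show p - 1 - 1 = p - 2 by ring] at this
  have hcomb0 : ∀ c d : ℝ, 0 ≤ c → c ≤ p → 0 ≤ d → d ≤ 1 → ∀ z, len z ≤ 5 * a →
      |c * extendZero Q z + d * extendZero K z| ≤ D * e * ‖z‖ ^ 2 := by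
    intro c d hc hc' hd hd' z hz
    refine (abs_add_le _ _).trans ?_
    rw [abs_mul, abs_mul, abs_of_nonneg hc, abs_of_nonneg hd]
    have h1 : c * |extendZero Q z| ≤ p * (CQ * (e * ‖z‖ ^ 2)) := by
      refine mul_le_mul hc' ((hQ0 z).trans ?_) (abs_nonneg _) (by linarith)
      gcongr; exact (hgrow z hz p le_rfl).1
    have h2 : d * |extendZero K z| ≤ 1 * (CK * (e * ‖z‖ ^ 2)) := by
      refine mul_le_mul hd' ((hK0 z).trans ?_) (abs_nonneg _) zero_le_one
      gcongr; exact (hgrow z hz r hpr.le).1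
    linarith
  have hcomb1 : ∀ c d : ℝ, 0 ≤ c → c ≤ p → 0 ≤ d → d ≤ 1 → ∀ z, len z ≤ 5 * a →
      ‖fderiv ℝ (fun z => c * extendZero Q z + d * extendZero K z) z‖ ≤ D * e * ‖z‖ := by
    intro c d hc hc' hd hd' z hz
    refine (norm_fderiv_comb_le hQ1 hK1 c d z).trans ?_
    rw [abs_of_nonneg hc, abs_of_nonneg hd]
    have h1 : c * ‖fderiv ℝ (extendZero Q) z‖ ≤ p * (CQ * (e * ‖z‖)) := by
      refine mul_le_mul hc' ((hQ2 z).trans ?_) (norm_nonneg _) (by linarith)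
      gcongr; exact (hgrow z hz p le_rfl).2
    have h2 : d * ‖fderiv ℝ (extendZero K) z‖ ≤ 1 * (CK * (e * ‖z‖)) := by
      refine mul_le_mul hd' ((hK2 z).trans ?_) (norm_nonneg _) zero_le_one
      gcongr; exact (hgrow z hz r hpr.le).2
    linarith
  have hF0 : ∀ z, len z ≤ 5 * a → |F z| ≤ D * e * ‖z‖ ^ 2 := by
    rw [hFeq]; exact hcomb0 1 (1 / r) zero_le_one hp1.le (by positivity) hir
  have hF1 : ∀ z, len z ≤ 5 * a → ‖fderiv ℝ F z‖ ≤ D * e * ‖z‖ := by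
    rw [hFeq]; exact hcomb1 1 (1 / r) zero_le_one hp1.le (by positivity) hir
  have hG0 := hcomb0 p 1 (by linarith) le_rfl zero_le_one le_rfl
  have hG1 := hcomb1 p 1 (by linarith) le_rfl zero_le_one le_rfl
  set A : ℝ := penalConst r Q K a with hA
  have hFnn : ∀ z, 0 ≤ F z := fun z => by
    rw [hFeq]
    have := hQ.extendZero_nonneg z
    have := hK.extendZero_nonneg z
    positivity
  -- This makes the set behind the supremum `A` bounded above, so that `A` dominates each quotient,
  -- and it also bounds `A` itself.
  have hratio : ∀ z : ℝ × ℝ, len z ≤ 5 * a → F z / (z.1 ^ 2 + z.2 ^ 2) ≤ D * e := by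
    intro z hz
    refine div_le_of_le_mul₀ (by positivity) (by positivity) ((le_abs_self _).trans ((hF0 z hz).trans ?_))
    gcongr
    exact norm_sq_le z
  have hAle : ∀ z, a ≤ len z → len z ≤ 5 * a → F z ≤ A * (z.1 ^ 2 + z.2 ^ 2) := by
    intro z hz hz'
    have hpos : 0 < z.1 ^ 2 + z.2 ^ 2 := by
      rw [← sq_len]; exact pow_pos (ha.trans_le hz) 2
    rw [← div_le_iff₀ hpos]
    refine le_csSup ⟨D * e, ?_⟩ ⟨z, ⟨hz, hz'⟩, rfl⟩
    rintro _ ⟨y, hy, rfl⟩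
    exact hratio y hy.2
  have hA1 : |A| ≤ D * e := by
    rw [abs_of_nonneg]
    · refine Real.sSup_le ?_ (by positivity)
      rintro _ ⟨y, hy, rfl⟩
      exact hratio y hy.2
    · refine Real.sSup_nonneg ?_
      rintro _ ⟨y, hy, rfl⟩
      exact div_nonneg (hFnn y) (by positivity)
  have hQhat : Qhat r Q K a η = blend η A F := rfl
  rw [hQhat]
  refine ⟨contDiff_blend ha hη hF, contDiff_fderiv_blend_self ha hη hF hG hFG, fun z => ?_,
    fun z => ?_, blend_le_half_fderiv_self ha hη hF hFG (fun z => ?_) hAle, ?_⟩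
  · refine (norm_fderiv_blend_le ha hη hF hF0 hF1 hA1 (by positivity) z).trans ?_
    refine mul_le_mul_of_nonneg_right (le_trans ?_ heδ) (norm_nonneg z)
    have : 0 ≤ D * e := by positivity
    have : 0 ≤ |C| * (D * e) := by positivity
    rw [hB]
    nlinarith
  · refine (norm_fderiv_fderiv_blend_self_le ha hη hF hG hFG hF0 hF1 hG0 hG1 hA1 z).trans ?_
    refine mul_le_mul_of_nonneg_right (le_of_eq_of_le ?_ heδ) (norm_nonneg z)
    ring
  · have h1 := hQ.extendZero_nonneg z
    have h2 := hK.extendZero_nonneg z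
    have h3 : 2 * (1 / r) ≤ 1 := by
      rw [mul_one_div, div_le_one (by linarith)]; linarith
    rw [hFeq, hGdef]
    nlinarith
  · have : F 0 = 0 := by rw [hFeq]; simp [extendZero_zero]
    simp [blend, this]


/-! ### Dominated convergence up to a small error -/

section Convergence

variable {α : Type*} [MeasurableSpace α] {μ : Measure α}

/-- A dominated convergence theorem with a dominating function that is integrable up to a term
with small integral. -/
lemma tendsto_integral_abs_of_le_add {h : ℕ → α → ℝ} (hm : ∀ n, AEStronglyMeasurable (h n) μ)
    (h0 : ∀ᵐ x ∂μ, Tendsto (fun n => h n x) atTop (𝓝 0))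
    (hbd : ∀ δ > 0, ∃ (G : α → ℝ) (k : ℕ → α → ℝ), Integrable G μ ∧
      (∀ n, Integrable (k n) μ) ∧ (∀ n x, 0 ≤ k n x) ∧ (∀ᶠ n in atTop, ∫ x, k n x ∂μ ≤ δ) ∧
      ∀ n, ∀ᵐ x ∂μ, |h n x| ≤ k n x + G x) :
    Tendsto (fun n => ∫ x, |h n x| ∂μ) atTop (𝓝 0) := by
  rw [Metric.tendsto_nhds]
  intro ε hε
  obtain ⟨G, k, hG, hk, hk0, hkδ, hle⟩ := hbd (ε / 2) (by positivity)
  -- The excess of `|h n|` over `k n` is dominated by `|G|`, so the classical theorem applies to it.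
  have h1 : Tendsto (fun n => ∫ x, max (|h n x| - k n x) 0 ∂μ) atTop (𝓝 (∫ _, (0 : ℝ) ∂μ)) := by
    refine tendsto_integral_of_dominated_convergence (fun x => |G x|)
      (fun n => ((hm n).norm.sub (hk n).1).sup aestronglyMeasurable_const) hG.abs (fun n => ?_) ?_
    · filter_upwards [hle n] with x hx
      rw [Real.norm_eq_abs, abs_of_nonneg (le_max_right _ _)]
      exact max_le ((by linarith : _ ≤ G x).trans (le_abs_self _)) (abs_nonneg _)
    · filter_upwards [h0] with x hx
      refine squeeze_zero (fun n => le_max_right _ _) (fun n => ?_) (by simpa using hx.abs)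
      exact max_le (by linarith [hk0 n x]) (abs_nonneg _)
  rw [integral_zero, Metric.tendsto_nhds] at h1
  filter_upwards [h1 (ε / 2) (by positivity), hkδ] with n hn hn'
  have hi : Integrable (h n) μ :=
    ((hk n).add hG).mono' (hm n) (by simpa using hle n)
  rw [Real.dist_eq, sub_zero, abs_of_nonneg (integral_nonneg fun x => le_max_right _ _)] at hn
  rw [Real.dist_eq, sub_zero, abs_of_nonneg (integral_nonneg fun x => abs_nonneg _)]
  have h2 : Integrable (fun x => max (|h n x| - k n x) 0) μ := (hi.abs.sub (hk n)).pos_part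
  calc ∫ x, |h n x| ∂μ ≤ ∫ x, (max (|h n x| - k n x) 0 + k n x) ∂μ := by
        refine integral_mono hi.abs (h2.add (hk n)) fun x => ?_
        have := le_max_left (|h n x| - k n x) 0
        simp only
        linarith
    _ = (∫ x, max (|h n x| - k n x) 0 ∂μ) + ∫ x, k n x ∂μ := integral_add h2 (hk n)
    _ < ε := by linarith

/-- This is the form behind the Brezis-Lieb lemma: `κ n` is merely bounded in `L¹` but enters with
an arbitrarily small factor. Dividing by `M + 1` avoids a separate case `M = 0`. -/
lemma tendsto_integral_abs_of_le_mul_add {h κ : ℕ → α → ℝ} {M : ℝ}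
    (hm : ∀ n, AEStronglyMeasurable (h n) μ)
    (h0 : ∀ᵐ x ∂μ, Tendsto (fun n => h n x) atTop (𝓝 0))
    (hκ : ∀ n, Integrable (κ n) μ) (hκ0 : ∀ n x, 0 ≤ κ n x) (hM : ∀ n, ∫ x, κ n x ∂μ ≤ M)
    (hbd : ∀ δ > 0, ∃ G : α → ℝ, Integrable G μ ∧ ∀ n, ∀ᵐ x ∂μ, |h n x| ≤ δ * κ n x + G x) :
    Tendsto (fun n => ∫ x, |h n x| ∂μ) atTop (𝓝 0) := by
  have hM0 : 0 ≤ M := (integral_nonneg (hκ0 0)).trans (hM 0)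
  refine tendsto_integral_abs_of_le_add hm h0 fun δ hδ => ?_
  have hδ' : 0 < δ / (M + 1) := by positivity
  obtain ⟨G, hG, hle⟩ := hbd _ hδ'
  refine ⟨G, fun n x => δ / (M + 1) * κ n x, hG, fun n => (hκ n).const_mul _,
    fun n x => mul_nonneg hδ'.le (hκ0 n x), Eventually.of_forall fun n => ?_, hle⟩
  rw [integral_const_mul]
  calc δ / (M + 1) * ∫ x, κ n x ∂μ ≤ δ / (M + 1) * (M + 1) := by
        gcongr; linarith [hM n]
    _ = δ := by field_simp

lemma tendsto_integral_of_abs {h : ℕ → α → ℝ}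
    (hh : Tendsto (fun n => ∫ x, |h n x| ∂μ) atTop (𝓝 0)) :
    Tendsto (fun n => ∫ x, h n x ∂μ) atTop (𝓝 0) :=
  squeeze_zero_norm (fun n => by simpa using norm_integral_le_integral_norm (h n)) hh

/-- Convergence to zero in `L¹` yields a subsequence converging almost everywhere. -/
lemma exists_seq_tendsto_ae_of_integral {h : ℕ → α → ℝ} (hi : ∀ n, Integrable (h n) μ)
    (hh : Tendsto (fun n => ∫ x, |h n x| ∂μ) atTop (𝓝 0)) :
    ∃ k : ℕ → ℕ, StrictMono k ∧ ∀ᵐ x ∂μ, Tendsto (fun n => h (k n) x) atTop (𝓝 0) := by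
  have h1 : Tendsto (fun n => eLpNorm (h n - 0) 1 μ) atTop (𝓝 0) := by
    have h2 : ∀ n, eLpNorm (h n - 0) 1 μ = ENNReal.ofReal (∫ x, |h n x| ∂μ) := by
      intro n
      rw [sub_zero, eLpNorm_one_eq_lintegral_enorm,
        ← ofReal_integral_norm_eq_lintegral_enorm (hi n)]
      rfl
    simp only [h2]
    simpa [Function.comp_def] using (ENNReal.continuous_ofReal.tendsto 0).comp hh
  obtain ⟨k, hk, hk'⟩ := (tendstoInMeasure_of_tendsto_eLpNorm one_ne_zero
    (fun n => (hi n).1) aestronglyMeasurable_zero h1).exists_seq_tendsto_ae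
  exact ⟨k, hk, hk'⟩

end Convergence

/-- Replacing the smaller of the two numbers by the larger gives Young's inequality with constant
one. -/
lemma rpow_mul_le_add {q x y : ℝ} (hq : 1 < q) (hx : 0 ≤ x) (hy : 0 ≤ y) :
    x ^ (q - 1) * y ≤ x ^ q + y ^ q := by
  have key : ∀ t : ℝ, 0 ≤ t → t ^ (q - 1) * t = t ^ q := by
    intro t ht
    rcases ht.eq_or_lt with rfl | ht
    · rw [mul_zero, Real.zero_rpow (by linarith)]
    · rw [← Real.rpow_add_one ht.ne']; congr 1; ring
  rcases le_total x y with h | h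
  · calc x ^ (q - 1) * y ≤ y ^ (q - 1) * y := by gcongr
      _ = y ^ q := key y hy
      _ ≤ _ := le_add_of_nonneg_left (by positivity)
  · calc x ^ (q - 1) * y ≤ x ^ (q - 1) * x := by gcongr
      _ = x ^ q := key x hx
      _ ≤ _ := le_add_of_nonneg_right (by positivity)

lemma add_rpow_le {k x y : ℝ} (hk : 0 ≤ k) (hx : 0 ≤ x) (hy : 0 ≤ y) :
    (x + y) ^ k ≤ 2 ^ k * (x ^ k + y ^ k) := by
  have h1 : (x + y) ^ k ≤ (2 * max x y) ^ k := by
    refine Real.rpow_le_rpow (by positivity) ?_ hk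
    linarith [le_max_left x y, le_max_right x y]
  refine h1.trans ?_
  rw [Real.mul_rpow (by norm_num) (by positivity)]
  gcongr
  rcases max_choice x y with h | h <;> rw [h]
  · exact le_add_of_nonneg_right (by positivity)
  · exact le_add_of_nonneg_left (by positivity)

/-! ### Differentiability of integral functionals on `L^q` -/

section Nemytskii

variable {α : Type*} [MeasurableSpace α] {μ : Measure α}
variable {Y : Type*} [NormedAddCommGroup Y] [NormedSpace ℝ Y]

/-- `ι` represents the elements of `Y` by functions in `L^q(μ; ℝ²)`, linearly and continuously. -/
structure LpRepresentation (μ : Measure α) (q M : ℝ) (ι : Y → α → ℝ × ℝ) : Prop where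
  aestronglyMeasurable : ∀ y, AEStronglyMeasurable (ι y) μ
  add : ∀ y w, ι (y + w) =ᵐ[μ] fun x => ι y x + ι w x
  smul : ∀ (c : ℝ) y, ι (c • y) =ᵐ[μ] fun x => c • ι y x
  integrable : ∀ y, Integrable (fun x => ‖ι y x‖ ^ q) μ
  nonneg : 0 ≤ M
  bound : ∀ y, ∫ x, ‖ι y x‖ ^ q ∂μ ≤ M * ‖y‖ ^ q

variable {q M C : ℝ} {ι : Y → α → ℝ × ℝ}

lemma integral_mul_le_holder (hq : 1 < q) {g f : α → ℝ} (hg : AEStronglyMeasurable g μ)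
    (hf : AEStronglyMeasurable f μ) (hg0 : ∀ x, 0 ≤ g x) (hf0 : ∀ x, 0 ≤ f x)
    (hgi : Integrable (fun x => g x ^ (q / (q - 1))) μ) (hfi : Integrable (fun x => f x ^ q) μ) :
    Integrable (fun x => g x * f x) μ ∧
    ∫ x, g x * f x ∂μ ≤
      (∫ x, g x ^ (q / (q - 1)) ∂μ) ^ ((q - 1) / q) * (∫ x, f x ^ q ∂μ) ^ (1 / q) := by
  have hq0 : 0 < q := by linarith
  have hq1 : 0 < q - 1 := by linarith
  have hc : (q / (q - 1)).HolderConjugate q := by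
    rw [Real.holderConjugate_iff]
    constructor
    · rw [one_lt_div hq1]; linarith
    · field_simp; ring
  have h1 : MemLp g (ENNReal.ofReal (q / (q - 1))) μ := by
    rw [← integrable_norm_rpow_iff hg (by simpa using by positivity) ENNReal.ofReal_ne_top,
      ENNReal.toReal_ofReal (by positivity)]
    simpa [Real.norm_eq_abs, abs_of_nonneg (hg0 _)] using hgi
  have h2 : MemLp f (ENNReal.ofReal q) μ := by
    rw [← integrable_norm_rpow_iff hf (by simpa using by positivity) ENNReal.ofReal_ne_top,
      ENNReal.toReal_ofReal (by positivity)]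
    simpa [Real.norm_eq_abs, abs_of_nonneg (hf0 _)] using hfi
  refine ⟨?_, ?_⟩
  · have : ENNReal.HolderConjugate (ENNReal.ofReal (q / (q - 1))) (ENNReal.ofReal q) :=
      hc.ennrealOfReal
    exact MemLp.integrable_mul h1 h2
  · have := integral_mul_le_Lp_mul_Lq_of_nonneg hc (Eventually.of_forall hg0)
      (Eventually.of_forall hf0) h1 h2
    rwa [one_div_div] at this

namespace LpRepresentation

lemma sub (h : LpRepresentation μ q M ι) (y w : Y) :
    ι (y - w) =ᵐ[μ] fun x => ι y x - ι w x := by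
  have h1 : ι (y - w) =ᵐ[μ] fun x => ι y x + ι ((-1 : ℝ) • w) x := by
    have := h.add y ((-1 : ℝ) • w)
    rwa [show y + (-1 : ℝ) • w = y - w by rw [neg_one_smul, sub_eq_add_neg]] at this
  filter_upwards [h1, h.smul (-1) w] with x hx hx'
  rw [hx, hx']
  simp [sub_eq_add_neg]

lemma tendsto_integral_sub (h : LpRepresentation μ q M ι) (hq : 1 < q) {y : ℕ → Y} {y₀ : Y}
    (hy : Tendsto y atTop (𝓝 y₀)) :
    Tendsto (fun n => ∫ x, ‖ι (y n - y₀) x‖ ^ q ∂μ) atTop (𝓝 0) := by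
  refine squeeze_zero (fun n => integral_nonneg fun x => by positivity) (fun n => h.bound _) ?_
  have h1 : Tendsto (fun n => ‖y n - y₀‖) atTop (𝓝 0) :=
    tendsto_iff_norm_sub_tendsto_zero.1 hy
  have h2 := (h1.rpow_const (p := q) (Or.inr (by linarith))).const_mul M
  simpa [Real.zero_rpow (by linarith : q ≠ 0)] using h2

/-- Along a sequence converging in `Y` a subsequence of the representatives converges almost
everywhere. -/
lemma exists_seq_tendsto_ae (h : LpRepresentation μ q M ι) (hq : 1 < q) {y : ℕ → Y} {y₀ : Y}
    (hy : Tendsto y atTop (𝓝 y₀)) :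
    ∃ k : ℕ → ℕ, StrictMono k ∧ ∀ᵐ x ∂μ, Tendsto (fun n => ι (y (k n)) x) atTop (𝓝 (ι y₀ x)) := by
  obtain ⟨k, hk, hk'⟩ := exists_seq_tendsto_ae_of_integral (fun n => h.integrable (y n - y₀))
    (by simpa [abs_of_nonneg, Real.rpow_nonneg] using h.tendsto_integral_sub hq hy)
  refine ⟨k, hk, ?_⟩
  filter_upwards [hk', ae_all_iff.2 fun n => h.sub (y n) y₀] with x hx hx'
  rw [tendsto_iff_norm_sub_tendsto_zero]
  have h1 := hx.rpow_const (p := 1 / q) (Or.inr (by positivity))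
  rw [Real.zero_rpow (by positivity)] at h1
  refine h1.congr fun n => ?_
  rw [← Real.rpow_mul (norm_nonneg _), mul_one_div_cancel (by linarith), Real.rpow_one, hx']

/-- Continuity of a superposition operator from `L^q` to the dual exponent, with `γ (z, z')` an
error vanishing on the diagonal. Its dual power is at most a multiple of `‖z' - z‖^q`, which tends
to zero in `L¹`, plus a multiple of the fixed integrable function `‖z‖^q`. -/
lemma tendsto_integral_superposition (h : LpRepresentation μ q M ι) (hq : 1 < q) (hC : 0 ≤ C)
    {γ : (ℝ × ℝ) × (ℝ × ℝ) → ℝ} (hγm : Measurable γ) (hγ0 : ∀ z, 0 ≤ γ z)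
    (hγ : ∀ z, Tendsto (fun z' => γ (z, z')) (𝓝 z) (𝓝 0))
    (hγC : ∀ z z', γ (z, z') ≤ C * (‖z‖ ^ (q - 1) + ‖z' - z‖ ^ (q - 1))) (y₀ : Y) :
    (∀ y, Integrable (fun x => γ (ι y₀ x, ι y x) ^ (q / (q - 1))) μ) ∧
    Tendsto (fun y => ∫ x, γ (ι y₀ x, ι y x) ^ (q / (q - 1)) ∂μ) (𝓝 y₀) (𝓝 0) := by
  have hq1 : 0 < q - 1 := by linarith
  have hk : 0 < q / (q - 1) := by positivity
  have hm : ∀ y, AEStronglyMeasurable (fun x => γ (ι y₀ x, ι y x) ^ (q / (q - 1))) μ := fun y =>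
    ((hγm.pow_const _).comp_aemeasurable
      ((h.aestronglyMeasurable y₀).aemeasurable.prodMk
        (h.aestronglyMeasurable y).aemeasurable)).aestronglyMeasurable
  set D : ℝ := C ^ (q / (q - 1)) * 2 ^ (q / (q - 1)) with hD
  have hbd : ∀ z z', γ (z, z') ^ (q / (q - 1)) ≤ D * ‖z' - z‖ ^ q + D * ‖z‖ ^ q := by
    intro z z'
    calc γ (z, z') ^ (q / (q - 1))
        ≤ (C * (‖z‖ ^ (q - 1) + ‖z' - z‖ ^ (q - 1))) ^ (q / (q - 1)) :=
          Real.rpow_le_rpow (hγ0 _) (hγC z z') hk.le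
      _ ≤ C ^ (q / (q - 1)) * (2 ^ (q / (q - 1)) * ((‖z‖ ^ (q - 1)) ^ (q / (q - 1)) +
          (‖z' - z‖ ^ (q - 1)) ^ (q / (q - 1)))) := by
          rw [Real.mul_rpow hC (by positivity)]
          gcongr
          exact add_rpow_le hk.le (by positivity) (by positivity)
      _ = D * ‖z' - z‖ ^ q + D * ‖z‖ ^ q := by
          rw [← Real.rpow_mul (norm_nonneg _), ← Real.rpow_mul (norm_nonneg _),
            mul_div_cancel₀ _ hq1.ne', hD]
          ring
  have hD0 : 0 ≤ D := by positivity
  have hbd' : ∀ y, ∀ᵐ x ∂μ, γ (ι y₀ x, ι y x) ^ (q / (q - 1)) ≤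
      D * ‖ι (y - y₀) x‖ ^ q + D * ‖ι y₀ x‖ ^ q := by
    intro y
    filter_upwards [h.sub y y₀] with x hx
    rw [hx]
    exact hbd _ _
  refine ⟨fun y => (((h.integrable (y - y₀)).const_mul D).add
    ((h.integrable y₀).const_mul D)).mono' (hm y) ?_, ?_⟩
  · filter_upwards [hbd' y] with x hx
    rw [Real.norm_eq_abs, abs_of_nonneg (Real.rpow_nonneg (hγ0 _) _)]
    exact hx
  -- Almost everywhere convergence is available only along subsequences, which suffices for a limit
  -- along the neighbourhood filter.
  refine tendsto_of_subseq_tendsto fun y hy => ?_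
  obtain ⟨k, hk', hae⟩ := h.exists_seq_tendsto_ae hq hy
  refine ⟨k, ?_⟩
  have h1 := tendsto_integral_abs_of_le_add (μ := μ)
    (h := fun n x => γ (ι y₀ x, ι (y (k n)) x) ^ (q / (q - 1))) (fun n => hm _) ?_ ?_
  · exact tendsto_integral_of_abs h1
  · filter_upwards [hae] with x hx
    have h2 := ((hγ (ι y₀ x)).comp hx).rpow_const (p := q / (q - 1)) (Or.inr hk.le)
    rwa [Real.zero_rpow hk.ne'] at h2
  · intro δ hδ
    refine ⟨fun x => D * ‖ι y₀ x‖ ^ q, fun n x => D * ‖ι (y (k n) - y₀) x‖ ^ q,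
      (h.integrable y₀).const_mul D, fun n => (h.integrable _).const_mul D,
      fun n x => by positivity, ?_, fun n => ?_⟩
    · have h3 := ((h.tendsto_integral_sub hq hy).comp hk'.tendsto_atTop).const_mul D
      rw [mul_zero] at h3
      filter_upwards [h3.eventually_le_const hδ] with n hn
      rw [integral_const_mul]
      exact hn
    · filter_upwards [hbd' (y (k n))] with x hx
      rwa [abs_of_nonneg (Real.rpow_nonneg (hγ0 _) _)]

/-- Hölder's inequality makes the smallness uniform in `w`. Differentiability uses it with `w = y -
y₀`, continuity of the derivative in operator norm with arbitrary `w`. -/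
lemma eventually_integral_superposition_le (h : LpRepresentation μ q M ι) (hq : 1 < q)
    (hC : 0 ≤ C) {γ : (ℝ × ℝ) × (ℝ × ℝ) → ℝ} (hγm : Measurable γ) (hγ0 : ∀ z, 0 ≤ γ z)
    (hγ : ∀ z, Tendsto (fun z' => γ (z, z')) (𝓝 z) (𝓝 0))
    (hγC : ∀ z z', γ (z, z') ≤ C * (‖z‖ ^ (q - 1) + ‖z' - z‖ ^ (q - 1))) (y₀ : Y) {ε : ℝ}
    (hε : 0 < ε) :
    ∀ᶠ y in 𝓝 y₀, ∀ w, Integrable (fun x => γ (ι y₀ x, ι y x) * ‖ι w x‖) μ ∧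
      ∫ x, γ (ι y₀ x, ι y x) * ‖ι w x‖ ∂μ ≤ ε * ‖w‖ := by
  obtain ⟨hi, ht⟩ := h.tendsto_integral_superposition hq hC hγm hγ0 hγ hγC y₀
  have hq1 : 0 < q - 1 := by linarith
  have hk : 0 < (q - 1) / q := by positivity
  have hM := h.nonneg
  have h1 := ((ht.rpow_const (p := (q - 1) / q) (Or.inr hk.le)).mul_const (M ^ (1 / q)))
  rw [Real.zero_rpow hk.ne', zero_mul] at h1
  filter_upwards [h1.eventually_le_const hε] with y hy w
  obtain ⟨h2, h3⟩ := integral_mul_le_holder hq (μ := μ) (g := fun x => γ (ι y₀ x, ι y x))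
    (f := fun x => ‖ι w x‖) (hγm.comp_aemeasurable
      ((h.aestronglyMeasurable y₀).aemeasurable.prodMk
        (h.aestronglyMeasurable y).aemeasurable)).aestronglyMeasurable
    (h.aestronglyMeasurable w).norm (fun x => hγ0 _) (fun x => norm_nonneg _) (hi y)
    (h.integrable w)
  refine ⟨h2, h3.trans ?_⟩
  have h4 : (∫ x, ‖ι w x‖ ^ q ∂μ) ^ (1 / q) ≤ M ^ (1 / q) * ‖w‖ := by
    calc (∫ x, ‖ι w x‖ ^ q ∂μ) ^ (1 / q) ≤ (M * ‖w‖ ^ q) ^ (1 / q) :=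
          Real.rpow_le_rpow (integral_nonneg fun x => by positivity) (h.bound w) (by positivity)
      _ = M ^ (1 / q) * ‖w‖ := by
          rw [Real.mul_rpow hM (by positivity), ← Real.rpow_mul (norm_nonneg _),
            mul_one_div_cancel (by linarith), Real.rpow_one]
  calc _ ≤ (∫ x, γ (ι y₀ x, ι y x) ^ (q / (q - 1)) ∂μ) ^ ((q - 1) / q) *
        (M ^ (1 / q) * ‖w‖) := by
        gcongr
        exact Real.rpow_nonneg (integral_nonneg fun x => Real.rpow_nonneg (hγ0 _) _) _
    _ ≤ ε * ‖w‖ := by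
        rw [← mul_assoc]; gcongr

variable {f : ℝ × ℝ → ℝ}

lemma integrable_comp (h : LpRepresentation μ q M ι) (hf : Continuous f)
    (hfC : ∀ z, |f z| ≤ C * ‖z‖ ^ q) (y : Y) : Integrable (fun x => f (ι y x)) μ :=
  ((h.integrable y).const_mul C).mono' (hf.comp_aestronglyMeasurable (h.aestronglyMeasurable y))
    (Eventually.of_forall fun x => by simpa using hfC (ι y x))

lemma aestronglyMeasurable_fderiv (h : LpRepresentation μ q M ι) (hf : ContDiff ℝ 1 f)
    (y w : Y) : AEStronglyMeasurable (fun x => fderiv ℝ f (ι y x) (ι w x)) μ := by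
  have : Continuous (fun z : (ℝ × ℝ) × (ℝ × ℝ) => fderiv ℝ f z.1 z.2) :=
    ((hf.continuous_fderiv (by norm_num)).comp continuous_fst).clm_apply continuous_snd
  exact this.comp_aestronglyMeasurable
    ((h.aestronglyMeasurable y).prodMk (h.aestronglyMeasurable w))

lemma integrable_fderiv (h : LpRepresentation μ q M ι) (hq : 1 < q) (hf : ContDiff ℝ 1 f)
    (hC : 0 ≤ C) (hf' : ∀ z, ‖fderiv ℝ f z‖ ≤ C * ‖z‖ ^ (q - 1)) (y w : Y) :
    Integrable (fun x => fderiv ℝ f (ι y x) (ι w x)) μ := by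
  refine (((h.integrable y).add (h.integrable w)).const_mul C).mono'
    (h.aestronglyMeasurable_fderiv hf y w) (Eventually.of_forall fun x => ?_)
  calc ‖fderiv ℝ f (ι y x) (ι w x)‖ ≤ C * ‖ι y x‖ ^ (q - 1) * ‖ι w x‖ :=
        (ContinuousLinearMap.le_opNorm _ _).trans (by gcongr; exact hf' _)
    _ ≤ C * (‖ι y x‖ ^ q + ‖ι w x‖ ^ q) := by
        rw [mul_assoc]
        gcongr
        exact rpow_mul_le_add hq (norm_nonneg _) (norm_nonneg _)

lemma abs_integral_fderiv_le (h : LpRepresentation μ q M ι) (hq : 1 < q)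
    (hC : 0 ≤ C) (hf' : ∀ z, ‖fderiv ℝ f z‖ ≤ C * ‖z‖ ^ (q - 1)) (y w : Y) :
    |∫ x, fderiv ℝ f (ι y x) (ι w x) ∂μ| ≤ C * M * ‖y‖ ^ (q - 1) * ‖w‖ := by
  have hq0 : 0 < q := by linarith
  have hq1 : 0 < q - 1 := by linarith
  have hM := h.nonneg
  have he : ∀ x, (‖ι y x‖ ^ (q - 1)) ^ (q / (q - 1)) = ‖ι y x‖ ^ q := fun x => by
    rw [← Real.rpow_mul (norm_nonneg _), mul_div_cancel₀ _ hq1.ne']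
  obtain ⟨h1, h2⟩ := integral_mul_le_holder hq (μ := μ) (g := fun x => ‖ι y x‖ ^ (q - 1))
    (f := fun x => ‖ι w x‖) ((h.aestronglyMeasurable y).norm.aemeasurable.pow_const
      _).aestronglyMeasurable (h.aestronglyMeasurable w).norm (fun x => by positivity)
    (fun x => norm_nonneg _) (by simpa only [he] using h.integrable y) (h.integrable w)
  simp only [he] at h2
  calc |∫ x, fderiv ℝ f (ι y x) (ι w x) ∂μ|
      ≤ ∫ x, C * (‖ι y x‖ ^ (q - 1) * ‖ι w x‖) ∂μ := by
        rw [← Real.norm_eq_abs]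
        refine norm_integral_le_of_norm_le (h1.const_mul C) (Eventually.of_forall fun x => ?_)
        rw [← mul_assoc]
        exact (ContinuousLinearMap.le_opNorm _ _).trans (by gcongr; exact hf' _)
    _ = C * ∫ x, ‖ι y x‖ ^ (q - 1) * ‖ι w x‖ ∂μ := integral_const_mul _ _
    _ ≤ C * ((M * ‖y‖ ^ q) ^ ((q - 1) / q) * (M * ‖w‖ ^ q) ^ (1 / q)) := by
        refine mul_le_mul_of_nonneg_left (h2.trans ?_) hC
        refine mul_le_mul (Real.rpow_le_rpow (integral_nonneg fun x => by positivity) (h.bound y)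
          (by positivity)) (Real.rpow_le_rpow (integral_nonneg fun x => by positivity) (h.bound w)
          (by positivity)) (Real.rpow_nonneg (integral_nonneg fun x => by positivity) _)
          (by positivity)
    _ = C * M * ‖y‖ ^ (q - 1) * ‖w‖ := by
        rw [Real.mul_rpow hM (by positivity), Real.mul_rpow hM (by positivity),
          ← Real.rpow_mul (norm_nonneg _), ← Real.rpow_mul (norm_nonneg _),
          mul_div_cancel₀ _ hq0.ne', mul_one_div_cancel hq0.ne', Real.rpow_one]
        have : M ^ ((q - 1) / q) * M ^ (1 / q) = M := by
          rcases hM.eq_or_lt with rfl | hM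
          · rw [Real.zero_rpow (by positivity), zero_mul]
          · rw [← Real.rpow_add hM, ← add_div, sub_add_cancel, div_self hq0.ne', Real.rpow_one]
        linear_combination C * ‖y‖ ^ (q - 1) * ‖w‖ * this

/-- The derivative of `y ↦ ∫ f(y)`. -/
def derivCLM (h : LpRepresentation μ q M ι) (hq : 1 < q) (hf : ContDiff ℝ 1 f)
    (hC : 0 ≤ C) (hf' : ∀ z, ‖fderiv ℝ f z‖ ≤ C * ‖z‖ ^ (q - 1)) (y : Y) : Y →L[ℝ] ℝ :=
  LinearMap.mkContinuous
    { toFun := fun w => ∫ x, fderiv ℝ f (ι y x) (ι w x) ∂μ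
      map_add' := fun w w' => by
        rw [← integral_add (h.integrable_fderiv hq hf hC hf' y w)
          (h.integrable_fderiv hq hf hC hf' y w')]
        refine integral_congr_ae ?_
        filter_upwards [h.add w w'] with x hx
        rw [hx, map_add]
      map_smul' := fun c w => by
        rw [RingHom.id_apply, smul_eq_mul, ← integral_const_mul]
        refine integral_congr_ae ?_
        filter_upwards [h.smul c w] with x hx
        rw [hx, map_smul, smul_eq_mul] }
    (C * M * ‖y‖ ^ (q - 1))
    fun w => h.abs_integral_fderiv_le hq hC hf' y w

/-- Apply the superposition estimate to the Taylor remainder divided by the increment. The mean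
value inequality gives it the required `(q-1)`-growth. -/
lemma hasFDerivAt_integral (h : LpRepresentation μ q M ι) (hq : 1 < q) (hf : ContDiff ℝ 1 f)
    (h0 : f 0 = 0) (hC : 0 ≤ C) (hf' : ∀ z, ‖fderiv ℝ f z‖ ≤ C * ‖z‖ ^ (q - 1)) (y₀ : Y) :
    HasFDerivAt (fun y => ∫ x, f (ι y x) ∂μ) (h.derivCLM hq hf hC hf' y₀) y₀ := by
  have hq1 : 0 < q - 1 := by linarith
  have hfi := h.integrable_comp hf.continuous (abs_le_of_norm_fderiv_le hq hf h0 hC hf')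
  -- On the diagonal the quotient is `0/0 = 0`, the value continuity in `z'` asks for.
  set γ : (ℝ × ℝ) × (ℝ × ℝ) → ℝ := fun z =>
    |f z.2 - f z.1 - fderiv ℝ f z.1 (z.2 - z.1)| / ‖z.2 - z.1‖ with hγdef
  have hcont : Continuous (fun z : (ℝ × ℝ) × (ℝ × ℝ) =>
      f z.2 - f z.1 - fderiv ℝ f z.1 (z.2 - z.1)) := by
    have h1 : Continuous (fun z : (ℝ × ℝ) × (ℝ × ℝ) => fderiv ℝ f z.1 (z.2 - z.1)) :=
      ((hf.continuous_fderiv (by norm_num)).comp continuous_fst).clm_apply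
        (continuous_snd.sub continuous_fst)
    exact ((hf.continuous.comp continuous_snd).sub (hf.continuous.comp continuous_fst)).sub h1
  have hγm : Measurable γ :=
    hcont.abs.measurable.div (continuous_snd.sub continuous_fst).norm.measurable
  have hγ0 : ∀ z, 0 ≤ γ z := fun z => by positivity
  have hγ : ∀ z, Tendsto (fun z' => γ (z, z')) (𝓝 z) (𝓝 0) := by
    intro z
    have h1 := (hf.differentiable (by norm_num) z).hasFDerivAt
    rw [hasFDerivAt_iff_tendsto] at h1
    refine h1.congr fun z' => ?_
    rw [Real.norm_eq_abs, ← div_eq_inv_mul]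
  have hmul : ∀ z z', |f z' - f z - fderiv ℝ f z (z' - z)| = γ (z, z') * ‖z' - z‖ := by
    intro z z'
    rcases eq_or_ne z' z with rfl | hne
    · simp
    · rw [hγdef, div_mul_cancel₀ _ (norm_ne_zero_iff.2 (sub_ne_zero.2 hne))]
  have hγC : ∀ z z', γ (z, z') ≤ C * (2 ^ (q - 1) * 2) * (‖z‖ ^ (q - 1) + ‖z' - z‖ ^ (q - 1)) := by
    intro z z'
    refine div_le_of_le_mul₀ (norm_nonneg _) (by positivity) ?_
    set m : ℝ := C * (2 ^ (q - 1) * (‖z‖ ^ (q - 1) + ‖z' - z‖ ^ (q - 1))) with hm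
    have hb : ∀ x ∈ Metric.closedBall z ‖z' - z‖, ‖fderiv ℝ f x‖ ≤ m := by
      intro x hx
      refine (hf' x).trans ?_
      rw [hm]
      gcongr
      refine le_trans (Real.rpow_le_rpow (norm_nonneg _) ?_ hq1.le)
        (add_rpow_le hq1.le (norm_nonneg _) (norm_nonneg _))
      rw [Metric.mem_closedBall, dist_eq_norm] at hx
      calc ‖x‖ = ‖z + (x - z)‖ := by congr 1; abel
        _ ≤ ‖z‖ + ‖z' - z‖ := (norm_add_le _ _).trans (by gcongr)
    have hself : z ∈ Metric.closedBall z ‖z' - z‖ := Metric.mem_closedBall_self (norm_nonneg _)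
    have h1 := (convex_closedBall z ‖z' - z‖).norm_image_sub_le_of_norm_fderiv_le
      (fun x _ => hf.differentiable (by norm_num) x) hb (x := z) (y := z') hself
      (by rw [Metric.mem_closedBall, dist_eq_norm])
    have h2 : |fderiv ℝ f z (z' - z)| ≤ m * ‖z' - z‖ :=
      ((fderiv ℝ f z).le_opNorm _).trans
        (mul_le_mul_of_nonneg_right (hb z hself) (norm_nonneg _))
    calc |f z' - f z - fderiv ℝ f z (z' - z)| ≤ |f z' - f z| + |fderiv ℝ f z (z' - z)| := abs_sub _ _
      _ ≤ m * ‖z' - z‖ + m * ‖z' - z‖ := add_le_add h1 h2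
      _ = _ := by rw [hm]; ring
  rw [hasFDerivAt_iff_isLittleO, Asymptotics.isLittleO_iff]
  intro ε hε
  filter_upwards [h.eventually_integral_superposition_le hq (by positivity) hγm hγ0 hγ hγC y₀ hε]
    with y hy
  obtain ⟨hi, hle⟩ := hy (y - y₀)
  have he : (∫ x, f (ι y x) ∂μ) - (∫ x, f (ι y₀ x) ∂μ) - h.derivCLM hq hf hC hf' y₀ (y - y₀) =
      ∫ x, (f (ι y x) - f (ι y₀ x) - fderiv ℝ f (ι y₀ x) (ι (y - y₀) x)) ∂μ := by
    have h1 : Integrable (fun x => f (ι y x) - f (ι y₀ x)) μ := (hfi y).sub (hfi y₀)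
    rw [integral_sub h1 (h.integrable_fderiv hq hf hC hf' y₀ _), integral_sub (hfi y) (hfi y₀)]
    rfl
  rw [he]
  refine (norm_integral_le_of_norm_le hi ?_).trans hle
  filter_upwards [h.sub y y₀] with x hx
  rw [hx, Real.norm_eq_abs]
  exact (hmul _ _).le

/-- The same estimate with `γ (z, z')` the norm of the difference of the two gradients. -/
lemma continuous_derivCLM (h : LpRepresentation μ q M ι) (hq : 1 < q) (hf : ContDiff ℝ 1 f)
    (hC : 0 ≤ C) (hf' : ∀ z, ‖fderiv ℝ f z‖ ≤ C * ‖z‖ ^ (q - 1)) :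
    Continuous (h.derivCLM hq hf hC hf') := by
  have hq1 : 0 < q - 1 := by linarith
  have hcf := hf.continuous_fderiv (by norm_num : (1 : WithTop ℕ∞) ≠ 0)
  rw [continuous_iff_continuousAt]
  intro y₀
  rw [ContinuousAt, Metric.tendsto_nhds]
  intro ε hε
  set γ : (ℝ × ℝ) × (ℝ × ℝ) → ℝ := fun z => ‖fderiv ℝ f z.2 - fderiv ℝ f z.1‖ with hγdef
  have hγc : Continuous γ :=
    ((hcf.comp continuous_snd).sub (hcf.comp continuous_fst)).norm
  have hγ : ∀ z, Tendsto (fun z' => γ (z, z')) (𝓝 z) (𝓝 0) := by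
    intro z
    have h1 : Continuous (fun z' => γ (z, z')) := by fun_prop
    have h2 := h1.tendsto z
    simpa [hγdef] using h2
  have hγC : ∀ z z', γ (z, z') ≤ C * (2 ^ (q - 1) * 2) * (‖z‖ ^ (q - 1) + ‖z' - z‖ ^ (q - 1)) := by
    intro z z'
    have h1 : ‖z'‖ ^ (q - 1) ≤ 2 ^ (q - 1) * (‖z‖ ^ (q - 1) + ‖z' - z‖ ^ (q - 1)) := by
      refine le_trans (Real.rpow_le_rpow (norm_nonneg _) ?_ hq1.le)
        (add_rpow_le hq1.le (norm_nonneg _) (norm_nonneg _))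
      calc ‖z'‖ = ‖z + (z' - z)‖ := by congr 1; abel
        _ ≤ _ := norm_add_le _ _
    have h2 : ‖z‖ ^ (q - 1) ≤ 2 ^ (q - 1) * (‖z‖ ^ (q - 1) + ‖z' - z‖ ^ (q - 1)) := by
      have h3 : (1 : ℝ) ≤ 2 ^ (q - 1) := Real.one_le_rpow (by norm_num) hq1.le
      have h4 : 0 ≤ ‖z' - z‖ ^ (q - 1) := by positivity
      have h5 : 0 ≤ ‖z‖ ^ (q - 1) := by positivity
      nlinarith
    calc γ (z, z') ≤ ‖fderiv ℝ f z'‖ + ‖fderiv ℝ f z‖ := norm_sub_le _ _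
      _ ≤ C * ‖z'‖ ^ (q - 1) + C * ‖z‖ ^ (q - 1) := add_le_add (hf' _) (hf' _)
      _ ≤ C * (2 ^ (q - 1) * (‖z‖ ^ (q - 1) + ‖z' - z‖ ^ (q - 1))) +
          C * (2 ^ (q - 1) * (‖z‖ ^ (q - 1) + ‖z' - z‖ ^ (q - 1))) := by gcongr
      _ = _ := by ring
  filter_upwards [h.eventually_integral_superposition_le hq (by positivity) hγc.measurable
    (fun z => norm_nonneg _) hγ hγC y₀ (half_pos hε)] with y hy
  rw [dist_eq_norm]
  refine lt_of_le_of_lt (ContinuousLinearMap.opNorm_le_bound _ (half_pos hε).le fun w => ?_)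
    (half_lt_self hε)
  obtain ⟨hi, hle⟩ := hy w
  have he : (h.derivCLM hq hf hC hf' y - h.derivCLM hq hf hC hf' y₀) w =
      ∫ x, (fderiv ℝ f (ι y x) (ι w x) - fderiv ℝ f (ι y₀ x) (ι w x)) ∂μ := by
    rw [integral_sub (h.integrable_fderiv hq hf hC hf' y _)
      (h.integrable_fderiv hq hf hC hf' y₀ _)]
    rfl
  rw [he]
  refine (norm_integral_le_of_norm_le hi (Eventually.of_forall fun x => ?_)).trans hle
  rw [← sub_apply]
  exact ContinuousLinearMap.le_opNorm _ _

/-- The integral functional of a `C¹` integrand with `(q-1)`-growth of the gradient is `C¹`. -/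
theorem contDiff_integral (h : LpRepresentation μ q M ι) (hq : 1 < q) (hf : ContDiff ℝ 1 f)
    (h0 : f 0 = 0) (hC : 0 ≤ C) (hf' : ∀ z, ‖fderiv ℝ f z‖ ≤ C * ‖z‖ ^ (q - 1)) :
    ContDiff ℝ 1 (fun y => ∫ x, f (ι y x) ∂μ) := by
  rw [contDiff_one_iff_fderiv]
  refine ⟨fun y => (h.hasFDerivAt_integral hq hf h0 hC hf' y).differentiableAt, ?_⟩
  rw [show fderiv ℝ (fun y => ∫ x, f (ι y x) ∂μ) = h.derivCLM hq hf hC hf' from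
    funext fun y => (h.hasFDerivAt_integral hq hf h0 hC hf' y).fderiv]
  exact h.continuous_derivCLM hq hf hC hf'

lemma fderiv_integral_apply (h : LpRepresentation μ q M ι) (hq : 1 < q) (hf : ContDiff ℝ 1 f)
    (h0 : f 0 = 0) (hC : 0 ≤ C) (hf' : ∀ z, ‖fderiv ℝ f z‖ ≤ C * ‖z‖ ^ (q - 1)) (y w : Y) :
    fderiv ℝ (fun y => ∫ x, f (ι y x) ∂μ) y w = ∫ x, fderiv ℝ f (ι y x) (ι w x) ∂μ := by
  rw [(h.hasFDerivAt_integral hq hf h0 hC hf' y).fderiv]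
  rfl

end LpRepresentation

end Nemytskii


/-! ### The normalisation constant is positive -/

section FracConst

variable {N : ℕ} [NeZero N] {s : ℝ}

/-- A radial majorant: `‖x‖^(2-N-2s)` near the origin, integrable as `s < 1`, and `2‖x‖^(-N-2s)` at
infinity, integrable as `s > 0`. If the integral diverged it would be zero by convention, and so
would be the constant. -/
lemma integrable_fracConst (hs₀ : 0 < s) (hs₁ : s < 1) :
    Integrable (fun x : E N => (1 - Real.cos (x 0)) / ‖x‖ ^ ((N : ℝ) + 2 * s)) := by
  have hN : 1 ≤ N := Nat.one_le_iff_ne_zero.2 (NeZero.ne N)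
  set f : ℝ → ℝ := fun t => if t < 1 then t ^ (2 - ((N : ℝ) + 2 * s))
    else 2 * t ^ (-((N : ℝ) + 2 * s)) with hf
  have hNr : ((N - 1 : ℕ) : ℝ) = (N : ℝ) - 1 := by push_cast [hN]; ring
  have h1 : Integrable (fun x : E N => f ‖x‖) := by
    rw [integrable_fun_norm_addHaar, finrank_euclideanSpace_fin]
    have h2 : IntegrableOn (fun y : ℝ => y ^ (N - 1) • f y) (Set.Ioo 0 1) := by
      have h3 : IntegrableOn (fun y : ℝ => y ^ (1 - 2 * s)) (Set.Ioo 0 1) := by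
        rw [intervalIntegral.integrableOn_Ioo_rpow_iff zero_lt_one]; linarith
      refine h3.congr_fun (fun y hy => ?_) measurableSet_Ioo
      simp only [hf, hy.2, if_true, smul_eq_mul]
      rw [← Real.rpow_natCast, ← Real.rpow_add hy.1, hNr]
      congr 1; ring
    have h4 : IntegrableOn (fun y : ℝ => y ^ (N - 1) • f y) (Set.Ici 1) := by
      rw [integrableOn_Ici_iff_integrableOn_Ioi]
      have h3 : IntegrableOn (fun y : ℝ => 2 * y ^ (-1 - 2 * s)) (Set.Ioi 1) :=
        (integrableOn_Ioi_rpow_of_lt (by linarith) zero_lt_one).const_mul 2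
      refine h3.congr_fun (fun y hy => ?_) measurableSet_Ioi
      have hy1 : (1 : ℝ) < y := hy
      have hy0 : (0 : ℝ) < y := by linarith
      simp only [hf, hy1.not_gt, if_false, smul_eq_mul]
      rw [mul_left_comm, ← Real.rpow_natCast, ← Real.rpow_add hy0, hNr]
      congr 2; ring
    rw [← Set.Ioo_union_Ici_eq_Ioi zero_lt_one]
    exact h2.union h4
  refine h1.mono' ?_ (Eventually.of_forall fun x => ?_)
  · have : Measurable (fun x : E N => (1 - Real.cos (x 0)) / ‖x‖ ^ ((N : ℝ) + 2 * s)) := by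
      fun_prop
    exact this.aestronglyMeasurable
  · have hc : 0 ≤ 1 - Real.cos (x 0) := sub_nonneg.2 (Real.cos_le_one _)
    rw [Real.norm_eq_abs, abs_of_nonneg (by positivity)]
    rcases eq_or_ne x 0 with rfl | hx
    · simp only [PiLp.zero_apply, Real.cos_zero, sub_self, zero_div, hf, norm_zero, zero_lt_one,
        if_true]
      positivity
    have hx0 : 0 < ‖x‖ := norm_pos_iff.2 hx
    by_cases hx1 : ‖x‖ < 1
    · simp only [hf, hx1, if_true]
      rw [Real.rpow_sub hx0, Real.rpow_two]
      gcongr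
      have h5 := Real.one_sub_sq_div_two_le_cos (x := x 0)
      have h6 : |x 0| ≤ ‖x‖ := PiLp.norm_apply_le x 0
      have h7 : (x 0) ^ 2 ≤ ‖x‖ ^ 2 := by
        rw [← sq_abs]; exact pow_le_pow_left₀ (abs_nonneg _) h6 2
      nlinarith [sq_nonneg (x 0)]
    · simp only [hf, hx1, if_false]
      rw [Real.rpow_neg hx0.le, div_eq_mul_inv]
      gcongr
      linarith [Real.neg_one_le_cos (x 0)]

/-- Positivity lets the fractional energy control the Gagliardo double integral, and with it the
Sobolev and compactness estimates. -/
lemma fracConst_pos (hs₀ : 0 < s) (hs₁ : s < 1) : 0 < fracConst N s := by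
  rw [fracConst, inv_pos, integral_pos_iff_support_of_nonneg
    (fun x => div_nonneg (sub_nonneg.2 (Real.cos_le_one _)) (by positivity))
    (integrable_fracConst hs₀ hs₁)]
  have ho : IsOpen {x : E N | 0 < x 0 ∧ x 0 < 1} := by
    have hc : Continuous (fun x : E N => x 0) := by fun_prop
    exact (isOpen_lt continuous_const hc).inter (isOpen_lt hc continuous_const)
  refine (ho.measure_pos volume ⟨EuclideanSpace.single 0 (1 / 2), ?_⟩).trans_le
    (measure_mono fun x hx => ?_)
  · simp; norm_num
  · obtain ⟨hx0, hx1⟩ : 0 < x 0 ∧ x 0 < 1 := hx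
    have h1 : Real.cos (x 0) < 1 := by
      rw [← Real.cos_zero]
      exact Real.cos_lt_cos_of_nonneg_of_le_pi le_rfl (by linarith [Real.pi_gt_three]) hx0
    have h2 : 0 < ‖x‖ := norm_pos_iff.2 fun h => by rw [h] at hx0; simp at hx0
    rw [Function.mem_support]
    exact (div_pos (sub_pos.2 h1) (by positivity)).ne'

end FracConst

/-! ### The fractional Sobolev inequality -/

section Sobolev

variable {N : ℕ} {s : ℝ} {u : E N → ℝ}

lemma kernel_self_nonneg (s : ℝ) (u : E N → ℝ) (q : E N × E N) : 0 ≤ gagliardoKernel s u u q :=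
  div_nonneg (mul_self_nonneg _) (by positivity)

lemma integrableOn_ball_sub_sq (hu : Integrable (fun y => u y ^ 2))
    (hm : AEStronglyMeasurable u volume) (x : E N) (c r : ℝ) :
    IntegrableOn (fun y => (u y - c) ^ 2) (Metric.ball x r) := by
  have hc : IntegrableOn (fun _ : E N => 2 * c ^ 2) (Metric.ball x r) :=
    integrableOn_const measure_ball_lt_top.ne
  refine ((hu.integrableOn.const_mul 2).add hc).mono'
    ((hm.sub aestronglyMeasurable_const).pow 2).restrict (Eventually.of_forall fun y => ?_)
  simp only [Pi.add_apply]
  rw [Real.norm_eq_abs, abs_of_nonneg (sq_nonneg _)]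
  nlinarith [sq_nonneg (u y + c)]

/-- Inside the ball the singular weight is at least `r^(-(N+2s))`. -/
lemma setIntegral_ball_sub_sq_le (hs₀ : 0 < s) (hu : Integrable (fun y => u y ^ 2))
    (hm : AEStronglyMeasurable u volume) {x : E N}
    (hx : Integrable (fun y => gagliardoKernel s u u (x, y))) {r : ℝ} (hr : 0 < r) :
    ∫ y in Metric.ball x r, (u y - u x) ^ 2 ≤
      r ^ ((N : ℝ) + 2 * s) * ∫ y, gagliardoKernel s u u (x, y) := by
  have hpt : ∀ y ∈ Metric.ball x r, (u y - u x) ^ 2 ≤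
      r ^ ((N : ℝ) + 2 * s) * gagliardoKernel s u u (x, y) := by
    intro y hy
    rcases eq_or_ne x y with rfl | hne
    · simp [gagliardoKernel]
    · rw [Metric.mem_ball, dist_comm, dist_eq_norm] at hy
      have h0 : 0 < ‖x - y‖ := norm_pos_iff.2 (sub_ne_zero.2 hne)
      have h1 : 0 < ‖x - y‖ ^ ((N : ℝ) + 2 * s) := by positivity
      have h2 : ‖x - y‖ ^ ((N : ℝ) + 2 * s) ≤ r ^ ((N : ℝ) + 2 * s) :=
        Real.rpow_le_rpow h0.le hy.le (by positivity)
      rw [gagliardoKernel, mul_div_assoc', le_div_iff₀ h1]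
      nlinarith [sq_nonneg (u x - u y)]
  calc ∫ y in Metric.ball x r, (u y - u x) ^ 2
      ≤ ∫ y in Metric.ball x r, r ^ ((N : ℝ) + 2 * s) * gagliardoKernel s u u (x, y) :=
        setIntegral_mono_on (integrableOn_ball_sub_sq hu hm x _ r) (hx.const_mul _).integrableOn
          measurableSet_ball hpt
    _ ≤ ∫ y, r ^ ((N : ℝ) + 2 * s) * gagliardoKernel s u u (x, y) :=
        setIntegral_le_integral (hx.const_mul _) (Eventually.of_forall fun y =>
          mul_nonneg (by positivity) (kernel_self_nonneg s u _))
    _ = _ := integral_const_mul _ _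

lemma measureReal_ball (x : E N) {r : ℝ} (hr : 0 < r) :
    volume.real (Metric.ball x r) = r ^ N * volume.real (Metric.ball (0 : E N) 1) := by
  rw [Measure.real, Measure.addHaar_ball_of_pos _ _ hr, finrank_euclideanSpace_fin,
    ENNReal.toReal_mul, ENNReal.toReal_ofReal (by positivity)]
  rfl

lemma measureReal_unitBall_pos : 0 < volume.real (Metric.ball (0 : E N) 1) :=
  ENNReal.toReal_pos (Metric.measure_ball_pos _ _ one_pos).ne' measure_ball_lt_top.ne

/-- Average `u(x)² ≤ 2u(y)² + 2(u(y) - u(x))²` over `y` in the ball. -/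
lemma ball_mul_sq_le (hs₀ : 0 < s) (hu : Integrable (fun y => u y ^ 2))
    (hm : AEStronglyMeasurable u volume) {x : E N}
    (hx : Integrable (fun y => gagliardoKernel s u u (x, y))) {r : ℝ} (hr : 0 < r) :
    volume.real (Metric.ball x r) * u x ^ 2 ≤ 2 * (∫ y in Metric.ball x r, u y ^ 2) +
      2 * (r ^ ((N : ℝ) + 2 * s) * ∫ y, gagliardoKernel s u u (x, y)) := by
  have h1 := setIntegral_ball_sub_sq_le hs₀ hu hm hx hr
  have hi := integrableOn_ball_sub_sq hu hm x (u x) r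
  calc volume.real (Metric.ball x r) * u x ^ 2 = ∫ y in Metric.ball x r, u x ^ 2 := by
        rw [setIntegral_const, smul_eq_mul]
    _ ≤ ∫ y in Metric.ball x r, (2 * u y ^ 2 + 2 * (u y - u x) ^ 2) := by
        refine integral_mono (integrableOn_const measure_ball_lt_top.ne)
          ((hu.integrableOn.const_mul 2).add (hi.const_mul 2)) fun y => ?_
        simp only
        nlinarith [sq_nonneg (2 * u y - u x)]
    _ = 2 * (∫ y in Metric.ball x r, u y ^ 2) + 2 * ∫ y in Metric.ball x r, (u y - u x) ^ 2 := by
        rw [integral_add (hu.integrableOn.const_mul 2) (hi.const_mul 2), integral_const_mul,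
          integral_const_mul]
    _ ≤ _ := by linarith

lemma setIntegral_ball_sq_le {q : ℝ} (hq : 2 < q) (hu : Integrable (fun y => |u y| ^ q))
    (hm : AEStronglyMeasurable u volume) (x : E N) (r : ℝ) :
    ∫ y in Metric.ball x r, u y ^ 2 ≤
      volume.real (Metric.ball x r) ^ ((q - 2) / q) * (∫ y, |u y| ^ q) ^ (2 / q) := by
  have he : ∀ y, (u y ^ 2) ^ (q / 2) = |u y| ^ q := fun y => by
    rw [← sq_abs, ← Real.rpow_two, ← Real.rpow_mul (abs_nonneg _)]; congr 1; ring
  have h1 : IntegrableOn (fun _ : E N => (1 : ℝ)) (Metric.ball x r) :=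
    integrableOn_const measure_ball_lt_top.ne
  have h2 : IntegrableOn (fun y => (u y ^ 2) ^ (q / 2)) (Metric.ball x r) := by
    simp only [he]; exact hu.integrableOn
  obtain ⟨-, h⟩ := integral_mul_le_holder (q := q / 2) (μ := volume.restrict (Metric.ball x r))
    (g := fun _ => 1) (f := fun y => u y ^ 2) (by linarith) aestronglyMeasurable_const
    (hm.pow 2).restrict (fun _ => zero_le_one) (fun _ => sq_nonneg _)
    (by simp only [Real.one_rpow]; exact h1) h2
  simp only [one_mul, Real.one_rpow, he] at h
  rw [setIntegral_const, smul_eq_mul, mul_one] at h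
  refine h.trans (le_of_le_of_eq (mul_le_mul_of_nonneg_left (Real.rpow_le_rpow
    (integral_nonneg fun y => by positivity) (setIntegral_le_integral hu
      (Eventually.of_forall fun y => by positivity)) (by positivity)) (by positivity)) ?_)
  congr 2
  · field_simp
  · field_simp

/-- The volume `m = (2/t)^q I` makes the first term on the right equal to half of the left side, so
it is absorbed; the second term then bounds `t^q`. -/
lemma rpow_le_of_forall_scale {q t I ω g : ℝ} (hq : 2 < q) (ht : 0 < t) (hI : 0 < I) (hω : 0 < ω)
    (h : ∀ m > 0, m * t ^ 2 ≤ 2 * (m ^ ((q - 2) / q) * I ^ (2 / q)) +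
      2 * ((m / ω) ^ (1 + (q - 2) / q) * g)) :
    t ^ q ≤ 2 ^ q * ω⁻¹ ^ (1 + (q - 2) / q) * I ^ ((q - 2) / q) * g := by
  have hq0 : q ≠ 0 := by linarith
  set κ : ℝ := (q - 2) / q with hκ
  have hκ1 : κ + 2 / q = 1 := by rw [hκ]; field_simp; ring
  set m : ℝ := (2 / t) ^ q * I with hm
  have hm0 : 0 < m := by positivity
  have h1 : m ^ κ * I ^ (2 / q) = m * t ^ 2 / 4 := by
    have h2 : m ^ (2 / q) = (2 / t) ^ 2 * I ^ (2 / q) := by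
      rw [hm, Real.mul_rpow (by positivity) hI.le, ← Real.rpow_mul (by positivity),
        mul_div_cancel₀ _ hq0, Real.rpow_two]
    have h3 : m ^ κ * m ^ (2 / q) = m := by rw [← Real.rpow_add hm0, hκ1, Real.rpow_one]
    rw [h2] at h3
    have h4 : (2 / t) ^ 2 * t ^ 2 = 4 := by field_simp; norm_num
    linear_combination (t ^ 2 / 4) * h3 - (m ^ κ * I ^ (2 / q) / 4) * h4
  have h5 := h m hm0
  rw [h1, div_eq_mul_inv m ω, Real.mul_rpow hm0.le (by positivity), Real.rpow_add hm0,
    Real.rpow_one] at h5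
  have h6 : t ^ 2 ≤ 4 * (m ^ κ * ω⁻¹ ^ (1 + κ) * g) := by
    refine le_of_mul_le_mul_left ?_ hm0
    linarith
  have h7 : m ^ κ * t ^ (q - 2) = 2 ^ (q - 2) * I ^ κ := by
    rw [hm, Real.mul_rpow (by positivity) hI.le, ← Real.rpow_mul (by positivity), hκ,
      mul_div_cancel₀ _ hq0, Real.div_rpow (by norm_num) ht.le]
    field_simp
  have h8 : t ^ q = t ^ (q - 2) * t ^ 2 := by
    rw [← Real.rpow_two, ← Real.rpow_add ht]; congr 1; ring
  have h9 : (2 : ℝ) ^ q = 2 ^ (q - 2) * 4 := by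
    rw [show (4 : ℝ) = 2 ^ (2 : ℝ) by norm_num, ← Real.rpow_add (by norm_num)]; congr 1; ring
  calc t ^ q ≤ t ^ (q - 2) * (4 * (m ^ κ * ω⁻¹ ^ (1 + κ) * g)) := by rw [h8]; gcongr
    _ = _ := by rw [h9]; linear_combination (4 * ω⁻¹ ^ (1 + κ) * g) * h7

lemma two_lt_critExp (hs₀ : 0 < s) (hN : 2 * s < N) : 2 < critExp N s := by
  rw [critExp, lt_div_iff₀ (by linarith)]
  linarith

/-- This identity is where the critical exponent enters: in terms of the volume of a ball,
`r^(N+2s)` is the power `1 + 2s/N`. -/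
lemma critExp_sub_two_div (hs₀ : 0 < s) (hN : 2 * s < N) :
    (critExp N s - 2) / critExp N s = 2 * s / N := by
  have h1 : (N : ℝ) - 2 * s ≠ 0 := by linarith
  have h2 : (N : ℝ) ≠ 0 := by linarith
  rw [critExp]
  field_simp
  ring

/-- For each volume `m`, use the ball around `x` of exactly that volume and optimise in `m`. -/
lemma rpow_le_of_bounded (hs₀ : 0 < s) (hN : 2 * s < N) (hu : Integrable (fun y => u y ^ 2))
    (hm : AEStronglyMeasurable u volume) (huq : Integrable (fun y => |u y| ^ critExp N s))
    (hI : 0 < ∫ y, |u y| ^ critExp N s) {x : E N}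
    (hx : Integrable (fun y => gagliardoKernel s u u (x, y))) :
    |u x| ^ critExp N s ≤ 2 ^ critExp N s *
      (volume.real (Metric.ball (0 : E N) 1))⁻¹ ^
        (1 + (critExp N s - 2) / critExp N s) *
      (∫ y, |u y| ^ critExp N s) ^ ((critExp N s - 2) / critExp N s) *
        ∫ y, gagliardoKernel s u u (x, y) := by
  have hq := two_lt_critExp hs₀ hN
  have hN0 : (0 : ℝ) < N := by linarith
  have hNn : N ≠ 0 := fun h => by rw [h] at hN0; simp at hN0
  have hg : 0 ≤ ∫ y, gagliardoKernel s u u (x, y) :=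
    integral_nonneg fun y => kernel_self_nonneg s u _
  have hω := measureReal_unitBall_pos (N := N)
  set ω := volume.real (Metric.ball (0 : E N) 1) with hωdef
  rcases (abs_nonneg (u x)).eq_or_lt with h0 | h0
  · rw [← h0, Real.zero_rpow (by linarith)]
    positivity
  refine rpow_le_of_forall_scale hq h0 hI hω fun m hm0 => ?_
  set r : ℝ := (m / ω) ^ (1 / (N : ℝ)) with hr
  have hr0 : 0 < r := by positivity
  have hrN : r ^ N = m / ω := by
    rw [hr, ← Real.rpow_natCast, ← Real.rpow_mul (by positivity), one_div_mul_cancel hN0.ne',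
      Real.rpow_one]
  have hball : volume.real (Metric.ball x r) = m := by
    rw [measureReal_ball x hr0, hrN, ← hωdef]; field_simp
  have hrs : r ^ ((N : ℝ) + 2 * s) = (m / ω) ^ (1 + (critExp N s - 2) / critExp N s) := by
    rw [critExp_sub_two_div hs₀ hN, hr, ← Real.rpow_mul (by positivity)]
    congr 1; field_simp
  have h1 := ball_mul_sq_le hs₀ hu hm hx hr0
  have h2 := setIntegral_ball_sq_le hq huq hm x r
  rw [hball] at h1 h2
  rw [hrs] at h1
  rw [sq_abs]
  linarith

/-- The Sobolev constant for the Gagliardo seminorm obtained from averaging over balls. -/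
def sobolevConst (N : ℕ) (s : ℝ) : ℝ :=
  2 ^ critExp N s * (volume.real (Metric.ball (0 : E N) 1))⁻¹ ^
    (1 + (critExp N s - 2) / critExp N s)

lemma sobolevConst_pos (N : ℕ) (s : ℝ) : 0 < sobolevConst N s := by
  have := measureReal_unitBall_pos (N := N)
  rw [sobolevConst]; positivity

lemma integral_kernel_nonneg (s : ℝ) (u : E N → ℝ) :
    0 ≤ ∫ q, gagliardoKernel s u u q ∂((volume : Measure (E N)).prod volume) :=
  integral_nonneg fun q => kernel_self_nonneg s u q

/-- Integrating the pointwise bound in `x` gives `I ≤ S I^((q-2)/q) G`, where `I` is the integral on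
the left, `S` the constant and `G` the double integral. Cancelling the power of `I` needs `I < ∞`,
hence the integrability assumption, which truncation removes afterwards. -/
lemma sobolev_of_integrable (hs₀ : 0 < s) (hN : 2 * s < N) (hu : Integrable (fun y => u y ^ 2))
    (hm : AEStronglyMeasurable u volume) (huq : Integrable (fun y => |u y| ^ critExp N s))
    (hHs : MemHs s u) :
    ∫ y, |u y| ^ critExp N s ≤ (sobolevConst N s *
      ∫ q, gagliardoKernel s u u q ∂((volume : Measure (E N)).prod volume)) ^
        (critExp N s / 2) := by
  have hq := two_lt_critExp hs₀ hN
  have hS := sobolevConst_pos N s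
  have hG := integral_kernel_nonneg s u
  have hI0 : 0 ≤ ∫ y, |u y| ^ critExp N s := integral_nonneg fun y => by positivity
  set q := critExp N s with hqdef
  rcases hI0.eq_or_lt with h0 | hI
  · rw [← h0]; positivity
  have h1 : ∫ y, |u y| ^ q ≤ ∫ x, sobolevConst N s * (∫ y, |u y| ^ q) ^ ((q - 2) / q) *
      ∫ y, gagliardoKernel s u u (x, y) := by
    refine integral_mono_ae huq (hHs.integral_prod_left.const_mul _) ?_
    filter_upwards [hHs.prod_right_ae] with x hx
    exact rpow_le_of_bounded hs₀ hN hu hm huq hI hx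
  rw [integral_const_mul, ← integral_prod _ hHs] at h1
  set I := ∫ y, |u y| ^ q with hIdef
  set G := ∫ q, gagliardoKernel s u u q ∂((volume : Measure (E N)).prod volume) with hGdef
  have h2 : I ^ (2 / q) ≤ sobolevConst N s * G := by
    have h3 : I ^ ((q - 2) / q) * I ^ (2 / q) = I := by
      rw [← Real.rpow_add hI, ← add_div, sub_add_cancel, div_self (by linarith), Real.rpow_one]
    have h4 : 0 < I ^ ((q - 2) / q) := by positivity
    refine le_of_mul_le_mul_left ?_ h4
    rw [h3]
    linarith
  calc I = (I ^ (2 / q)) ^ (q / 2) := by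
        rw [← Real.rpow_mul hI0, show 2 / q * (q / 2) = 1 by field_simp, Real.rpow_one]
    _ ≤ _ := Real.rpow_le_rpow (by positivity) h2 (by linarith)

end Sobolev

/-- Fatou's lemma for sequences of nonnegative functions with bounded integrals. -/
lemma integrable_of_tendsto_of_integral_le {α : Type*} [MeasurableSpace α] {μ : Measure α}
    {f : ℕ → α → ℝ} {g : α → ℝ} {M : ℝ} (hf : ∀ n, Integrable (f n) μ)
    (hf0 : ∀ n, ∀ᵐ x ∂μ, 0 ≤ f n x) (hM : ∀ n, ∫ x, f n x ∂μ ≤ M)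
    (hfg : ∀ᵐ x ∂μ, Tendsto (fun n => f n x) atTop (𝓝 (g x))) :
    Integrable g μ ∧ ∫ x, g x ∂μ ≤ M := by
  have hg : AEStronglyMeasurable g μ :=
    aestronglyMeasurable_of_tendsto_ae atTop (fun n => (hf n).1) hfg
  have hg0 : 0 ≤ᵐ[μ] g := by
    filter_upwards [hfg, ae_all_iff.2 hf0] with x hx hx0
    exact ge_of_tendsto' hx hx0
  have hM0 : 0 ≤ M := (integral_nonneg_of_ae (hf0 0)).trans (hM 0)
  have h1 : ∫⁻ x, ENNReal.ofReal (g x) ∂μ ≤ ENNReal.ofReal M := by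
    calc ∫⁻ x, ENNReal.ofReal (g x) ∂μ
        = ∫⁻ x, liminf (fun n => ENNReal.ofReal (f n x)) atTop ∂μ := by
          refine lintegral_congr_ae ?_
          filter_upwards [hfg] with x hx
          exact ((ENNReal.continuous_ofReal.tendsto _).comp hx).liminf_eq.symm
      _ ≤ liminf (fun n => ∫⁻ x, ENNReal.ofReal (f n x) ∂μ) atTop :=
          lintegral_liminf_le' fun n => (hf n).1.aemeasurable.ennreal_ofReal
      _ ≤ liminf (fun _ => ENNReal.ofReal M) atTop := by
          refine liminf_le_liminf (Eventually.of_forall fun n => ?_)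
          rw [← ofReal_integral_eq_lintegral_ofReal (hf n) (hf0 n)]
          exact ENNReal.ofReal_le_ofReal (hM n)
      _ = ENNReal.ofReal M := liminf_const _
  have hi : Integrable g μ :=
    ⟨hg, (hasFiniteIntegral_iff_ofReal hg0).2 (h1.trans_lt ENNReal.ofReal_lt_top)⟩
  refine ⟨hi, ?_⟩
  rwa [← ofReal_integral_eq_lintegral_ofReal hi hg0, ENNReal.ofReal_le_ofReal_iff hM0] at h1

section Truncation

variable {N : ℕ} {s : ℝ} {u : E N → ℝ}

/-- Truncation of a real number at the levels `±k`. -/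
def trunc (k t : ℝ) : ℝ := max (-k) (min t k)

lemma abs_trunc_sub_le (k t t' : ℝ) : |trunc k t - trunc k t'| ≤ |t - t'| :=
  (abs_max_sub_max_le_abs _ _ (-k)).trans' (by rw [trunc, trunc, max_comm, max_comm (-k)]) |>.trans
    (abs_inf_sub_inf_le_abs t t' k)

lemma abs_trunc_le_abs {k : ℝ} (hk : 0 ≤ k) (t : ℝ) : |trunc k t| ≤ |t| := by
  have h := abs_trunc_sub_le k t 0
  have h0 : trunc k 0 = 0 := by rw [trunc, min_eq_left hk, max_eq_right (by linarith)]
  rwa [h0, sub_zero, sub_zero] at h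

lemma abs_trunc_le {k : ℝ} (hk : 0 ≤ k) (t : ℝ) : |trunc k t| ≤ k :=
  abs_le.2 ⟨le_max_left _ _, max_le (by linarith) (min_le_right _ _)⟩

lemma continuous_trunc (k : ℝ) : Continuous (trunc k) := by unfold trunc; fun_prop

lemma trunc_eq_self {k t : ℝ} (h : |t| ≤ k) : trunc k t = t := by
  rw [abs_le] at h
  rw [trunc, min_eq_left h.2, max_eq_right h.1]

/-- The fractional Sobolev inequality `‖u‖_{2*_s} ≤ C [u]_s`. -/
theorem sobolev (hs₀ : 0 < s) (hN : 2 * s < N) (hu : Integrable (fun y => u y ^ 2))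
    (hm : AEStronglyMeasurable u volume) (hHs : MemHs s u) :
    Integrable (fun y => |u y| ^ critExp N s) ∧
    ∫ y, |u y| ^ critExp N s ≤ (sobolevConst N s *
      ∫ q, gagliardoKernel s u u q ∂((volume : Measure (E N)).prod volume)) ^
        (critExp N s / 2) := by
  have hq := two_lt_critExp hs₀ hN
  have hS := sobolevConst_pos N s
  set q := critExp N s with hqdef
  have hmk : ∀ k : ℝ, AEStronglyMeasurable (fun y => trunc k (u y)) volume := fun k =>
    (continuous_trunc k).comp_aestronglyMeasurable hm
  have hk2 : ∀ n : ℕ, Integrable (fun y => trunc n (u y) ^ 2) := fun n =>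
    hu.mono' ((hmk n).pow 2) (Eventually.of_forall fun y => by
      rw [Real.norm_eq_abs, abs_of_nonneg (sq_nonneg _)]
      exact sq_le_sq.2 (abs_trunc_le_abs n.cast_nonneg _))
  -- A bounded `L²` function lies in every higher `L^q`: `|t|^q ≤ n^(q-2) t²` for `|t| ≤ n`.
  have hkq : ∀ n : ℕ, Integrable (fun y => |trunc n (u y)| ^ q) := fun n => by
    refine ((hk2 n).const_mul ((n : ℝ) ^ (q - 2))).mono'
      ((hmk n).norm.aemeasurable.pow_const q).aestronglyMeasurable (Eventually.of_forall fun y => ?_)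
    rw [Real.norm_eq_abs, abs_of_nonneg (by positivity), ← sq_abs]
    rcases (abs_nonneg (trunc n (u y))).eq_or_lt with h0 | h0
    · rw [← h0, Real.zero_rpow (by linarith)]; positivity
    · rw [show q = (q - 2) + 2 by ring, Real.rpow_add h0, Real.rpow_two, add_sub_cancel_right]
      exact mul_le_mul_of_nonneg_right (Real.rpow_le_rpow (abs_nonneg _)
        (abs_trunc_le n.cast_nonneg _) (by linarith)) (by positivity)
  -- Truncation is 1-Lipschitz, so it does not increase the seminorm; the bound is uniform in `n`
  -- and Fatou's lemma applies.
  have hker : ∀ (n : ℕ) p, gagliardoKernel s (fun y => trunc n (u y)) (fun y => trunc n (u y)) p ≤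
      gagliardoKernel s u u p := fun n p => by
    rw [gagliardoKernel, gagliardoKernel]
    gcongr ?_ / _
    exact abs_le_iff_mul_self_le.1 (abs_trunc_sub_le n _ _)
  have hHk : ∀ n : ℕ, MemHs s (fun y => trunc n (u y)) := fun n => by
    refine hHs.mono' ?_ (Eventually.of_forall fun p => ?_)
    · have h1 : AEStronglyMeasurable (fun p : E N × E N => trunc n (u p.1) - trunc n (u p.2))
          (volume.prod volume) := (hmk n).comp_fst.sub (hmk n).comp_snd
      exact ((aesm_weight s).mul (h1.mul h1)).congr
        (Eventually.of_forall fun p => by rw [kernel_eq]; rfl)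
    · rw [Real.norm_eq_abs, abs_of_nonneg (kernel_self_nonneg s _ p)]
      exact hker n p
  refine integrable_of_tendsto_of_integral_le hkq
    (fun n => Eventually.of_forall fun y => by positivity) (fun n => ?_)
    (Eventually.of_forall fun y => ?_)
  · refine (sobolev_of_integrable hs₀ hN (hk2 n) (hmk n) (hkq n) (hHk n)).trans ?_
    refine Real.rpow_le_rpow (mul_nonneg hS.le (integral_kernel_nonneg s _)) ?_ (by linarith)
    exact mul_le_mul_of_nonneg_left (integral_mono (hHk n) hHs (hker n)) hS.le
  · obtain ⟨n₀, hn₀⟩ := exists_nat_ge |u y|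
    refine tendsto_const_nhds.congr' ?_
    filter_upwards [eventually_ge_atTop n₀] with n hn
    rw [trunc_eq_self (hn₀.trans (by exact_mod_cast hn))]

end Truncation


/-! ### Local compactness of `H^s` through ball averages -/

section Compactness

variable {N : ℕ} {s : ℝ}

lemma memHs_fun_sub {u v : E N → ℝ} (hmu : AEStronglyMeasurable u volume)
    (hmv : AEStronglyMeasurable v volume) (hu : MemHs s u) (hv : MemHs s v) :
    MemHs s (fun x => u x - v x) ∧
    ∫ q, gagliardoKernel s (fun x => u x - v x) (fun x => u x - v x) q
        ∂((volume : Measure (E N)).prod volume) ≤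
      2 * (∫ q, gagliardoKernel s u u q ∂((volume : Measure (E N)).prod volume)) +
      2 * ∫ q, gagliardoKernel s v v q ∂((volume : Measure (E N)).prod volume) := by
  have hle : ∀ q, gagliardoKernel s (fun x => u x - v x) (fun x => u x - v x) q ≤
      2 * gagliardoKernel s u u q + 2 * gagliardoKernel s v v q := fun q => by
    simp only [gagliardoKernel]
    rw [mul_div_assoc', mul_div_assoc', ← add_div]
    gcongr ?_ / _
    nlinarith [sq_nonneg ((u q.1 - u q.2) + (v q.1 - v q.2))]
  have hi : Integrable (fun q => 2 * gagliardoKernel s u u q + 2 * gagliardoKernel s v v q)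
      ((volume : Measure (E N)).prod volume) := (hu.const_mul 2).add (hv.const_mul 2)
  have hm : MemHs s (fun x => u x - v x) := by
    refine hi.mono' ?_ (Eventually.of_forall fun q => ?_)
    · have hw := hmu.sub hmv
      have h1 : AEStronglyMeasurable (fun p : E N × E N => (u - v) p.1 - (u - v) p.2)
          (volume.prod volume) := hw.comp_fst.sub hw.comp_snd
      exact ((aesm_weight s).mul (h1.mul h1)).congr
        (Eventually.of_forall fun p => by rw [kernel_eq]; rfl)
    · rw [Real.norm_eq_abs, abs_of_nonneg (kernel_self_nonneg s _ q)]
      exact hle q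
  refine ⟨hm, (integral_mono hm hi hle).trans_eq ?_⟩
  rw [integral_add (hu.const_mul 2) (hv.const_mul 2), integral_const_mul, integral_const_mul]

/-- Cauchy-Schwarz, read off from the nonnegativity of the variance. -/
lemma sq_setIntegral_le {α : Type*} [MeasurableSpace α] {μ : Measure α} {B : Set α} {h : α → ℝ}
    (hB : μ B ≠ ⊤) (hB0 : 0 < μ.real B) (hi : IntegrableOn h B μ)
    (hi2 : IntegrableOn (fun y => h y ^ 2) B μ) :
    (∫ y in B, h y ∂μ) ^ 2 ≤ μ.real B * ∫ y in B, h y ^ 2 ∂μ := by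
  set b := μ.real B
  set A := ∫ y in B, h y ∂μ with hA
  have hc : IntegrableOn (fun _ => (A / b) ^ 2) B μ := integrableOn_const hB
  have h1 : ∫ y in B, (h y - A / b) ^ 2 ∂μ = (∫ y in B, h y ^ 2 ∂μ) - A ^ 2 / b := by
    have h2 : ∀ y, (h y - A / b) ^ 2 = h y ^ 2 - 2 * (A / b) * h y + (A / b) ^ 2 := fun y => by ring
    have hi3 : IntegrableOn (fun y => h y ^ 2 - 2 * (A / b) * h y) B μ :=
      hi2.sub (hi.const_mul _)
    simp only [h2]
    rw [integral_add hi3 hc, integral_sub hi2 (hi.const_mul _), integral_const_mul,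
      setIntegral_const, smul_eq_mul, ← hA]
    field_simp
    ring
  have h3 : 0 ≤ ∫ y in B, (h y - A / b) ^ 2 ∂μ := integral_nonneg fun y => sq_nonneg _
  rw [h1, sub_nonneg, div_le_iff₀ hB0] at h3
  linarith

lemma integrableOn_ball_of_sq {u : E N → ℝ} (hu : Integrable (fun y => u y ^ 2))
    (hm : AEStronglyMeasurable u volume) (x : E N) (r : ℝ) :
    IntegrableOn u (Metric.ball x r) := by
  have hc : IntegrableOn (fun _ : E N => (1 : ℝ)) (Metric.ball x r) :=
    integrableOn_const measure_ball_lt_top.ne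
  refine (hu.integrableOn.add hc).mono' hm.restrict (Eventually.of_forall fun y => ?_)
  rw [Real.norm_eq_abs, Pi.add_apply, ← sq_abs]
  nlinarith [sq_nonneg (|u y| - 1)]

/-- A function in `H^s` is controlled by its averages over balls of a fixed small radius. -/
lemma sq_le_average_add (hs₀ : 0 < s) {u : E N → ℝ} (hu : Integrable (fun y => u y ^ 2))
    (hm : AEStronglyMeasurable u volume) {x : E N}
    (hx : Integrable (fun y => gagliardoKernel s u u (x, y))) {r : ℝ} (hr : 0 < r) :
    u x ^ 2 ≤ 2 * ((∫ y in Metric.ball x r, u y) / volume.real (Metric.ball x r)) ^ 2 +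
      2 * (r ^ (2 * s) / volume.real (Metric.ball (0 : E N) 1)) *
        ∫ y, gagliardoKernel s u u (x, y) := by
  have hω := measureReal_unitBall_pos (N := N)
  have hb := measureReal_ball x hr
  have hb0 : 0 < volume.real (Metric.ball x r) := by rw [hb]; positivity
  have hiu := integrableOn_ball_of_sq hu hm x r
  have hc : IntegrableOn (fun _ : E N => u x) (Metric.ball x r) :=
    integrableOn_const measure_ball_lt_top.ne
  have h1 := sq_setIntegral_le (h := fun y => u y - u x) measure_ball_lt_top.ne hb0 (hiu.sub hc)
    (integrableOn_ball_sub_sq hu hm x (u x) r)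
  have h2 := setIntegral_ball_sub_sq_le hs₀ hu hm hx hr
  have h3 : ∫ y in Metric.ball x r, (u y - u x) =
      (∫ y in Metric.ball x r, u y) - volume.real (Metric.ball x r) * u x := by
    rw [integral_sub hiu hc, setIntegral_const, smul_eq_mul]
  rw [h3] at h1
  set b := volume.real (Metric.ball x r) with hbdef
  set A := ∫ y in Metric.ball x r, u y with hA
  set g := ∫ y, gagliardoKernel s u u (x, y) with hg
  have h4 : (A / b - u x) ^ 2 ≤ r ^ (2 * s) / volume.real (Metric.ball (0 : E N) 1) * g := by
    have h5 : (A / b - u x) ^ 2 = (A - b * u x) ^ 2 / b ^ 2 := by field_simp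
    rw [h5, div_le_iff₀ (by positivity)]
    refine h1.trans ((mul_le_mul_of_nonneg_left h2 hb0.le).trans_eq ?_)
    have h6 : r ^ ((N : ℝ) + 2 * s) = r ^ N * r ^ (2 * s) := by
      rw [Real.rpow_add hr, Real.rpow_natCast]
    rw [h6, sq b]
    nth_rewrite 3 [hb]
    field_simp
  nlinarith [sq_nonneg (2 * (A / b) - u x)]

lemma aestronglyMeasurable_ball_integral {u : E N → ℝ} (hu : StronglyMeasurable u) (r : ℝ) :
    AEStronglyMeasurable (fun x => ∫ y in Metric.ball x r, u y) volume := by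
  have h1 : MeasurableSet {q : E N × E N | q.2 ∈ Metric.ball q.1 r} := by
    simp only [Metric.mem_ball]
    exact (isOpen_lt (continuous_snd.dist continuous_fst) continuous_const).measurableSet
  have h2 : StronglyMeasurable (fun q : E N × E N =>
      {q : E N × E N | q.2 ∈ Metric.ball q.1 r}.indicator (fun q => u q.2) q) :=
    (hu.comp_measurable measurable_snd).indicator h1
  have h3 := (h2.integral_prod_right' (ν := volume)).aestronglyMeasurable (μ := volume)
  refine h3.congr (Eventually.of_forall fun x => ?_)
  simp only
  rw [← integral_indicator measurableSet_ball]
  rfl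

/-- Bounded sequences in `L²` have subsequences whose ball averages all converge. -/
lemma exists_seq_tendsto_ball_integral {u : ℕ → L2 N} {M : ℝ} (hu : ∀ n, ‖u n‖ ≤ M) :
    ∃ k : ℕ → ℕ, StrictMono k ∧ ∀ (x : E N) (r : ℝ), ∃ l : ℝ,
      Tendsto (fun n => ∫ y in Metric.ball x r, u (k n) y) atTop (𝓝 l) := by
  have : Fact ((2 : ENNReal) ≠ ⊤) := ⟨by norm_num⟩
  -- Sequential Banach-Alaoglu in the dual of the separable space `L²`; integrals over balls are
  -- pairings with indicators, so one subsequence serves all balls.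
  obtain ⟨ℓ, -, k, hk, hℓ⟩ := WeakDual.isSeqCompact_closedBall ℝ (L2 N) 0 M
    (x := fun n => StrongDual.toWeakDual (InnerProductSpace.toDualMap ℝ (L2 N) (u n)))
    (fun n => by simpa using hu n)
  refine ⟨k, hk, fun x r => ⟨ℓ (indicatorConstLp 2 measurableSet_ball
    (measure_ball_lt_top (μ := volume) (x := x) (r := r)).ne (1 : ℝ)), ?_⟩⟩
  have h1 := ((WeakDual.eval_continuous (indicatorConstLp 2 measurableSet_ball
    (measure_ball_lt_top (μ := volume) (x := x) (r := r)).ne (1 : ℝ))).tendsto ℓ).comp hℓ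
  refine h1.congr fun n => ?_
  simp only [Function.comp_apply, StrongDual.coe_toWeakDual, InnerProductSpace.toDualMap_apply_apply]
  rw [real_inner_comm, L2.inner_indicatorConstLp_one]

lemma integrable_sq (u : L2 N) : Integrable (fun x => u x ^ 2) := (Lp.memLp u).integrable_sq

lemma integral_sq_eq (u : L2 N) : ∫ x, u x ^ 2 = ‖u‖ ^ 2 := by
  rw [← real_inner_self_eq_norm_sq, L2.inner_def]
  simp [sq]

/-- A positive integrable weight, bounded by `1`. -/
def decay (x : E N) : ℝ := (1 + ‖x‖) ^ (-((N : ℝ) + 1))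

lemma decay_pos (x : E N) : 0 < decay x := by rw [decay]; positivity

lemma decay_le_one (x : E N) : decay x ≤ 1 :=
  Real.rpow_le_one_of_one_le_of_nonpos (by linarith [norm_nonneg x])
    (by linarith [(Nat.cast_nonneg N : (0 : ℝ) ≤ N)])

lemma decay_sq_le (x : E N) : decay x ^ 2 ≤ decay x := by
  nlinarith [decay_pos x, decay_le_one x]

lemma integrable_decay : Integrable (decay : E N → ℝ) :=
  integrable_one_add_norm (by simp)

lemma measurable_decay : Measurable (decay : E N → ℝ) := by unfold decay; fun_prop

/-- A difference of two terms is controlled by its ball average plus a multiple of `r^(2s)` times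
the seminorm. The second part is small uniformly for small `r`; with `r` fixed the averages tend to
zero pointwise and are bounded, so the integrable weight permits dominated convergence on all of
`ℝ^N`. -/
lemma tendsto_integral_decay_sub (hs₀ : 0 < s) {u : ℕ → L2 N} {M D : ℝ} (hu : ∀ n, ‖u n‖ ≤ M)
    (hHs : ∀ n, MemHs s (u n))
    (hD : ∀ n, ∫ q, gagliardoKernel s (u n) (u n) q ∂((volume : Measure (E N)).prod volume) ≤ D)
    (hB : ∀ (x : E N) (r : ℝ), ∃ l : ℝ,
      Tendsto (fun n => ∫ y in Metric.ball x r, u n y) atTop (𝓝 l)) :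
    Tendsto (fun n : ℕ × ℕ => ∫ x, decay x ^ 2 * (u n.1 x - u n.2 x) ^ 2) (atTop ×ˢ atTop)
      (𝓝 0) := by
  have hω := measureReal_unitBall_pos (N := N)
  have hD0 : 0 ≤ D := (integral_kernel_nonneg s _).trans (hD 0)
  have hM0 : 0 ≤ M := (norm_nonneg _).trans (hu 0)
  set ω := volume.real (Metric.ball (0 : E N) 1) with hωdef
  have hm : ∀ n, AEStronglyMeasurable (u n) volume := fun n => Lp.aestronglyMeasurable (u n)
  have hsm : ∀ n : ℕ × ℕ, StronglyMeasurable (fun x => u n.1 x - u n.2 x) := fun n =>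
    (Lp.stronglyMeasurable _).sub (Lp.stronglyMeasurable _)
  have hv2 : ∀ n : ℕ × ℕ, Integrable (fun x => (u n.1 x - u n.2 x) ^ 2) := fun n => by
    refine (((integrable_sq (u n.1)).const_mul 2).add ((integrable_sq (u n.2)).const_mul 2)).mono'
      ((hsm n).pow 2).aestronglyMeasurable (Eventually.of_forall fun x => ?_)
    rw [Real.norm_eq_abs, abs_of_nonneg (sq_nonneg _), Pi.add_apply]
    nlinarith [sq_nonneg (u n.1 x + u n.2 x)]
  have hv2le : ∀ n : ℕ × ℕ, ∫ x, (u n.1 x - u n.2 x) ^ 2 ≤ 4 * M ^ 2 := fun n => by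
    have h1 : ∀ n, ‖u n‖ ^ 2 ≤ M ^ 2 := fun n => pow_le_pow_left₀ (norm_nonneg _) (hu n) 2
    calc ∫ x, (u n.1 x - u n.2 x) ^ 2 ≤ ∫ x, (2 * u n.1 x ^ 2 + 2 * u n.2 x ^ 2) := by
          refine integral_mono (hv2 n) (((integrable_sq (u n.1)).const_mul 2).add
            ((integrable_sq (u n.2)).const_mul 2)) fun x => ?_
          simp only
          nlinarith [sq_nonneg (u n.1 x + u n.2 x)]
      _ = 2 * ‖u n.1‖ ^ 2 + 2 * ‖u n.2‖ ^ 2 := by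
          rw [integral_add ((integrable_sq (u n.1)).const_mul 2)
            ((integrable_sq (u n.2)).const_mul 2), integral_const_mul, integral_const_mul,
            integral_sq_eq, integral_sq_eq]
      _ ≤ 4 * M ^ 2 := by linarith [h1 n.1, h1 n.2]
  have hvHs := fun n : ℕ × ℕ => memHs_fun_sub (hm n.1) (hm n.2) (hHs n.1) (hHs n.2)
  rw [Metric.tendsto_nhds]
  intro ε hε
  -- the radius of the averages
  obtain ⟨r, hr, hrε⟩ : ∃ r > 0, 2 * (r ^ (2 * s) / ω) * (4 * D) < ε / 2 := by
    have h1 : Tendsto (fun r : ℝ => 2 * (r ^ (2 * s) / ω) * (4 * D)) (𝓝[>] 0) (𝓝 0) := by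
      have h2 : Continuous (fun r : ℝ => 2 * (r ^ (2 * s) / ω) * (4 * D)) := by
        have := Real.continuous_rpow_const (q := 2 * s) (by linarith)
        fun_prop
      have h3 := h2.tendsto 0
      rw [Real.zero_rpow (by linarith)] at h3
      simp only [zero_div, mul_zero, zero_mul] at h3
      exact h3.mono_left nhdsWithin_le_nhds
    obtain ⟨r, hr1, hr2⟩ := ((h1.eventually_lt_const (half_pos hε)).and
      self_mem_nhdsWithin).exists
    exact ⟨r, hr2, hr1⟩
  set b := r ^ N * ω with hbdef
  have hb0 : 0 < b := by positivity
  have hbx : ∀ x : E N, volume.real (Metric.ball x r) = b := fun x => measureReal_ball x hr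
  set A : ℕ × ℕ → E N → ℝ := fun n x => ∫ y in Metric.ball x r, (u n.1 y - u n.2 y) with hA
  have hAm : ∀ n, AEStronglyMeasurable (fun x => decay x ^ 2 * (2 * (A n x / b) ^ 2)) volume :=
    fun n => (measurable_decay.pow_const 2).aestronglyMeasurable.mul
      (((aestronglyMeasurable_ball_integral (hsm n) r).aemeasurable.div_const
        b).pow_const 2 |>.const_mul 2).aestronglyMeasurable
  have hAb : ∀ n x, (A n x / b) ^ 2 ≤ 4 * M ^ 2 / b := fun n x => by
    have h1 := sq_setIntegral_le measure_ball_lt_top.ne (by rw [hbx x]; exact hb0)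
      (integrableOn_ball_of_sq (hv2 n) (hsm n).aestronglyMeasurable x r) (hv2 n).integrableOn
    rw [hbx x] at h1
    have h2 : ∫ y in Metric.ball x r, (u n.1 y - u n.2 y) ^ 2 ≤ 4 * M ^ 2 :=
      (setIntegral_le_integral (hv2 n) (Eventually.of_forall fun y => sq_nonneg _)).trans (hv2le n)
    rw [div_pow, div_le_div_iff₀ (by positivity) hb0]
    have h3 : A n x ^ 2 ≤ b * (4 * M ^ 2) := h1.trans (by gcongr)
    nlinarith
  have hAi : ∀ n, Integrable (fun x => decay x ^ 2 * (2 * (A n x / b) ^ 2)) := fun n => by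
    refine (integrable_decay.const_mul (2 * (4 * M ^ 2 / b))).mono' (hAm n)
      (Eventually.of_forall fun x => ?_)
    rw [Real.norm_eq_abs, abs_of_nonneg (by positivity)]
    rw [mul_comm]
    have := hAb n x
    exact mul_le_mul (by linarith) (decay_sq_le x) (by positivity) (by positivity)
  have hAt : Tendsto (fun n => ∫ x, decay x ^ 2 * (2 * (A n x / b) ^ 2)) (atTop ×ˢ atTop)
      (𝓝 (∫ _ : E N, (0 : ℝ))) := by
    refine tendsto_integral_filter_of_dominated_convergence
      (fun x => 2 * (4 * M ^ 2 / b) * decay x) (Eventually.of_forall hAm)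
      (Eventually.of_forall fun n => Eventually.of_forall fun x => ?_)
      (integrable_decay.const_mul _) (Eventually.of_forall fun x => ?_)
    · rw [Real.norm_eq_abs, abs_of_nonneg (by positivity), mul_comm]
      have := hAb n x
      exact mul_le_mul (by linarith) (decay_sq_le x) (by positivity) (by positivity)
    · obtain ⟨l, hl⟩ := hB x r
      have h1 : Tendsto (fun n : ℕ × ℕ => A n x) (atTop ×ˢ atTop) (𝓝 (l - l)) := by
        refine ((hl.comp tendsto_fst).sub (hl.comp tendsto_snd)).congr fun n => ?_
        exact (integral_sub (integrableOn_ball_of_sq (integrable_sq _) (hm _) x r)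
          (integrableOn_ball_of_sq (integrable_sq _) (hm _) x r)).symm
      rw [sub_self] at h1
      have h2 := (((h1.div_const b).pow 2).const_mul 2).const_mul (decay x ^ 2)
      simpa using h2
  rw [integral_zero] at hAt
  filter_upwards [hAt.eventually_lt_const (half_pos hε)] with n hn
  rw [Real.dist_eq, sub_zero, abs_of_nonneg (integral_nonneg fun x => by positivity)]
  obtain ⟨hHn, hGn⟩ := hvHs n
  have hgi := hHn.integral_prod_left
  have hcoef : 0 ≤ 2 * (r ^ (2 * s) / ω) := by positivity
  calc ∫ x, decay x ^ 2 * (u n.1 x - u n.2 x) ^ 2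
      ≤ ∫ x, (decay x ^ 2 * (2 * (A n x / b) ^ 2) + 2 * (r ^ (2 * s) / ω) *
          ∫ y, gagliardoKernel s (fun x => u n.1 x - u n.2 x) (fun x => u n.1 x - u n.2 x)
            (x, y)) := by
        refine integral_mono_of_nonneg (Eventually.of_forall fun x => by positivity)
          ((hAi n).add (hgi.const_mul _)) ?_
        filter_upwards [hHn.prod_right_ae] with x hx
        have h1 := sq_le_average_add hs₀ (hv2 n) (hsm n).aestronglyMeasurable hx hr
        rw [hbx x, ← hωdef] at h1
        have hg : 0 ≤ ∫ y, gagliardoKernel s (fun x => u n.1 x - u n.2 x)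
            (fun x => u n.1 x - u n.2 x) (x, y) := integral_nonneg fun y => kernel_self_nonneg s _ _
        have hd : decay x ^ 2 ≤ 1 := (decay_sq_le x).trans (decay_le_one x)
        have h2 := mul_le_mul_of_nonneg_left h1 (sq_nonneg (decay x))
        rw [mul_add] at h2
        refine h2.trans (add_le_add le_rfl ?_)
        exact mul_le_of_le_one_left (mul_nonneg hcoef hg) hd
    _ = (∫ x, decay x ^ 2 * (2 * (A n x / b) ^ 2)) + 2 * (r ^ (2 * s) / ω) *
          ∫ q, gagliardoKernel s (fun x => u n.1 x - u n.2 x) (fun x => u n.1 x - u n.2 x) q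
            ∂((volume : Measure (E N)).prod volume) := by
        rw [integral_add (hAi n) (hgi.const_mul _), integral_const_mul, ← integral_prod _ hHn]
    _ < ε := by
        have h3 := mul_le_mul_of_nonneg_left (hGn.trans
          (by linarith [hD n.1, hD n.2] : _ ≤ 4 * D)) hcoef
        linarith

/-- Local compactness of the embedding `H^s ⊂ L²`: bounded sequences in `H^s` have subsequences
converging almost everywhere. -/
theorem exists_seq_tendsto_ae_of_bounded (hs₀ : 0 < s) {u : ℕ → L2 N} {M D : ℝ}
    (hu : ∀ n, ‖u n‖ ≤ M) (hHs : ∀ n, MemHs s (u n))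
    (hD : ∀ n, ∫ q, gagliardoKernel s (u n) (u n) q ∂((volume : Measure (E N)).prod volume) ≤ D) :
    ∃ (k : ℕ → ℕ) (f : E N → ℝ), StrictMono k ∧
      ∀ᵐ x, Tendsto (fun n => u (k n) x) atTop (𝓝 (f x)) := by
  obtain ⟨k, hk, hB⟩ := exists_seq_tendsto_ball_integral hu
  have hT := tendsto_integral_decay_sub hs₀ (fun n => hu (k n)) (fun n => hHs (k n))
    (fun n => hD (k n)) hB
  have hmem : ∀ n, MemLp (fun x => decay x * u (k n) x) 2 volume := fun n =>
    (Lp.memLp (u (k n))).of_le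
      (measurable_decay.aestronglyMeasurable.mul (Lp.aestronglyMeasurable _))
      (Eventually.of_forall fun x => by
        rw [norm_mul, Real.norm_eq_abs, abs_of_pos (decay_pos x)]
        exact mul_le_of_le_one_left (norm_nonneg _) (decay_le_one x))
  -- The weighted functions are Cauchy in `L²`. The weight is positive everywhere, so dividing by it
  -- afterwards recovers pointwise convergence of the functions themselves.
  set w : ℕ → L2 N := fun n => (hmem n).toLp with hw
  have hdist : ∀ n m, dist (w n) (w m) ^ 2 =
      ∫ x, decay x ^ 2 * (u (k n) x - u (k m) x) ^ 2 := fun n m => by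
    rw [dist_eq_norm, ← integral_sq_eq]
    refine integral_congr_ae ?_
    filter_upwards [Lp.coeFn_sub (w n) (w m), (hmem n).coeFn_toLp, (hmem m).coeFn_toLp]
      with x h1 h2 h3
    rw [h1, Pi.sub_apply, h2, h3]
    ring
  have hC : CauchySeq w := by
    rw [cauchySeq_iff_tendsto_dist_atTop_0, ← prod_atTop_atTop_eq]
    have h1 := hT.sqrt
    rw [Real.sqrt_zero] at h1
    refine h1.congr fun n => ?_
    rw [← hdist, Real.sqrt_sq dist_nonneg]
  obtain ⟨g, hg⟩ := cauchySeq_tendsto_of_complete hC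
  obtain ⟨j, hj, hae⟩ := (tendstoInMeasure_of_tendsto_Lp hg).exists_seq_tendsto_ae
  refine ⟨k ∘ j, fun x => (decay x)⁻¹ * g x, hk.comp hj, ?_⟩
  filter_upwards [hae, ae_all_iff.2 fun n => (hmem n).coeFn_toLp] with x hx hx'
  refine (hx.const_mul (decay x)⁻¹).congr fun n => ?_
  rw [hx' (j n), inv_mul_cancel_left₀ (decay_pos x).ne']
  rfl

end Compactness


/-! ### The space `X_ε` and its embeddings -/

section XSpace

variable {N : ℕ} {P : Potentials N} {s ε : ℝ}

/-- The `ℝ²`-valued function represented by an element of `X_ε`. -/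
def X.pair (z : X P s ε) (x : E N) : ℝ × ℝ := (z.u x, z.v x)

lemma X.add_u (z w : X P s ε) : (z + w).u = z.u + w.u := rfl

lemma X.add_v (z w : X P s ε) : (z + w).v = z.v + w.v := rfl

lemma X.smul_u (c : ℝ) (z : X P s ε) : (c • z).u = c • z.u := rfl

lemma X.smul_v (c : ℝ) (z : X P s ε) : (c • z).v = c • z.v := rfl

lemma X.pair_add (z w : X P s ε) : (z + w).pair =ᵐ[volume] fun x => z.pair x + w.pair x := by
  filter_upwards [Lp.coeFn_add z.u w.u, Lp.coeFn_add z.v w.v] with x h1 h2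
  simp only [X.pair, X.add_u, X.add_v, h1, h2]
  rfl

lemma X.pair_smul (c : ℝ) (z : X P s ε) : (c • z).pair =ᵐ[volume] fun x => c • z.pair x := by
  filter_upwards [Lp.coeFn_smul c z.u, Lp.coeFn_smul c z.v] with x h1 h2
  simp only [X.pair, X.smul_u, X.smul_v, h1, h2]
  rfl

lemma X.pair_sub (z w : X P s ε) : (z - w).pair =ᵐ[volume] fun x => z.pair x - w.pair x := by
  have h1 := z.pair_add ((-1 : ℝ) • w)
  rw [show z + (-1 : ℝ) • w = z - w by rw [neg_one_smul, sub_eq_add_neg]] at h1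
  filter_upwards [h1, w.pair_smul (-1)] with x hx hx'
  rw [hx, hx']
  simp [sub_eq_add_neg]

lemma X.aestronglyMeasurable_pair (z : X P s ε) : AEStronglyMeasurable z.pair volume :=
  (Lp.aestronglyMeasurable z.u).prodMk (Lp.aestronglyMeasurable z.v)

lemma X.memHs_u (z : X P s ε) : MemHs s z.u := z.2.1.1

lemma X.memHs_v (z : X P s ε) : MemHs s z.v := z.2.2.1

/-- The minimum of the two potentials over `ℝ^N`. -/
def Potentials.inf (P : Potentials N) : ℝ := min (P.V P.x₀) (P.W P.x₀)

lemma Potentials.inf_pos (P : Potentials N) : 0 < P.inf := lt_min P.h3_pos.1 P.h3_pos.2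

lemma Potentials.inf_le_V (P : Potentials N) (x : E N) : P.inf ≤ P.V x :=
  (min_le_left _ _).trans (P.h3_min x).1

lemma Potentials.inf_le_W (P : Potentials N) (x : E N) : P.inf ≤ P.W x :=
  (min_le_right _ _).trans (P.h3_min x).2

/-- The potential energy `∫ V(εx) u² + W(εx) v² dx`. -/
def X.pot (z : X P s ε) : ℝ :=
  weightForm (fun x => P.V (ε • x)) z.u z.u + weightForm (fun x => P.W (ε • x)) z.v z.v

lemma X.integral_pair_sq_le (z : X P s ε) :
    Integrable (fun x => ‖z.pair x‖ ^ 2) ∧ P.inf * ∫ x, ‖z.pair x‖ ^ 2 ≤ z.pot := by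
  have hi : Integrable (fun x => z.u x ^ 2 + z.v x ^ 2) :=
    (integrable_sq z.u).add (integrable_sq z.v)
  have h1 : Integrable (fun x => ‖z.pair x‖ ^ 2) :=
    hi.mono' (z.aestronglyMeasurable_pair.norm.pow 2) (Eventually.of_forall fun x => by
      rw [Real.norm_eq_abs, abs_of_nonneg (sq_nonneg _)]
      exact norm_sq_le (z.pair x))
  have hV := integrable_weightForm (P.continuous_V ε) (fun _ => P.V_pos _) z.2.1 z.2.1
  have hW := integrable_weightForm (P.continuous_W ε) (fun _ => P.W_pos _) z.2.2 z.2.2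
  refine ⟨h1, ?_⟩
  rw [X.pot, weightForm, weightForm, ← integral_const_mul]
  refine le_of_le_of_eq (integral_mono (h1.const_mul _) (hV.add hW) fun x => ?_)
    (integral_add hV hW)
  have h2 := mul_le_mul_of_nonneg_left (norm_sq_le (z.pair x)) P.inf_pos.le
  have h3 := mul_le_mul_of_nonneg_right (P.inf_le_V (ε • x)) (mul_self_nonneg (z.u x))
  have h4 := mul_le_mul_of_nonneg_right (P.inf_le_W (ε • x)) (mul_self_nonneg (z.v x))
  simp only [X.pair] at h2
  simp only [Pi.add_apply]
  change P.inf * ‖z.pair x‖ ^ 2 ≤ P.V (ε • x) * (z.u x * z.u x) + P.W (ε • x) * (z.v x * z.v x)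
  have h5 : ‖z.pair x‖ ^ 2 = ‖(z.u x, z.v x)‖ ^ 2 := rfl
  rw [h5]
  nlinarith

lemma X.pot_nonneg (z : X P s ε) : 0 ≤ z.pot :=
  add_nonneg (weightForm_self_nonneg (fun _ => P.V_pos _) _)
    (weightForm_self_nonneg (fun _ => P.W_pos _) _)

lemma X.setIntegral_pair_sq_le (z : X P s ε) (S : Set (E N)) :
    P.inf * ∫ x in S, ‖z.pair x‖ ^ 2 ≤ z.pot := by
  obtain ⟨h2, h2'⟩ := z.integral_pair_sq_le
  refine le_trans ?_ h2'
  exact mul_le_mul_of_nonneg_left (setIntegral_le_integral h2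
    (Eventually.of_forall fun x => by positivity)) P.inf_pos.le

variable [NeZero N]

/-- The fractional energy `∫ |(-Δ)^(s/2) u|² + |(-Δ)^(s/2) v|² dx`. -/
def X.frac (z : X P s ε) : ℝ := fracForm s z.u z.u + fracForm s z.v z.v

lemma X.frac_nonneg (z : X P s ε) : 0 ≤ z.frac :=
  add_nonneg (fracForm_self_nonneg _ _) (fracForm_self_nonneg _ _)

lemma X.norm_sq (z : X P s ε) : ‖z‖ ^ 2 = z.frac + z.pot := by
  rw [← real_inner_self_eq_norm_sq]
  rfl

lemma X.pot_le (z : X P s ε) : z.pot ≤ ‖z‖ ^ 2 := by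
  rw [X.norm_sq]; linarith [z.frac_nonneg]

lemma integral_kernel_eq (hs₀ : 0 < s) (hs₁ : s < 1) (u : E N → ℝ) :
    ∫ q, gagliardoKernel s u u q ∂((volume : Measure (E N)).prod volume) =
      2 / fracConst N s * fracForm s u u := by
  have := fracConst_pos (N := N) hs₀ hs₁
  rw [fracForm]
  field_simp

lemma X.fracForm_u_le (z : X P s ε) : fracForm s z.u z.u ≤ ‖z‖ ^ 2 := by
  rw [X.norm_sq, X.frac]; linarith [z.pot_nonneg, fracForm_self_nonneg s z.v]

lemma X.fracForm_v_le (z : X P s ε) : fracForm s z.v z.v ≤ ‖z‖ ^ 2 := by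
  rw [X.norm_sq, X.frac]; linarith [z.pot_nonneg, fracForm_self_nonneg s z.u]

lemma norm_prod_rpow_le (q : ℝ) (z : ℝ × ℝ) : ‖z‖ ^ q ≤ |z.1| ^ q + |z.2| ^ q := by
  rw [Prod.norm_def, Real.norm_eq_abs, Real.norm_eq_abs]
  rcases max_choice |z.1| |z.2| with h | h <;> rw [h]
  · exact le_add_of_nonneg_right (by positivity)
  · exact le_add_of_nonneg_left (by positivity)

/-- The constant of the embedding of `X_ε` into `L^{2*_s}`. -/
def critEmbConst (N : ℕ) [NeZero N] (s : ℝ) : ℝ :=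
  2 * (sobolevConst N s * (2 / fracConst N s)) ^ (critExp N s / 2)

lemma critEmbConst_nonneg (N : ℕ) [NeZero N] (s : ℝ) : 0 ≤ critEmbConst N s := by
  have h1 := sobolevConst_pos N s
  have h2 := fracConst_nonneg (N := N) s
  rw [critEmbConst]
  positivity

lemma X.integral_pair_crit_le (hs₀ : 0 < s) (hs₁ : s < 1) (hN : 2 * s < N) (z : X P s ε) :
    Integrable (fun x => ‖z.pair x‖ ^ critExp N s) ∧
    ∫ x, ‖z.pair x‖ ^ critExp N s ≤ critEmbConst N s * ‖z‖ ^ critExp N s := by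
  have hq := two_lt_critExp hs₀ hN
  have hS := sobolevConst_pos N s
  have hC := fracConst_pos (N := N) hs₀ hs₁
  obtain ⟨hu, hu'⟩ := sobolev hs₀ hN (integrable_sq z.u) (Lp.aestronglyMeasurable z.u) z.memHs_u
  obtain ⟨hv, hv'⟩ := sobolev hs₀ hN (integrable_sq z.v) (Lp.aestronglyMeasurable z.v) z.memHs_v
  rw [integral_kernel_eq hs₀ hs₁] at hu' hv'
  have hle : ∀ x, ‖z.pair x‖ ^ critExp N s ≤ |z.u x| ^ critExp N s + |z.v x| ^ critExp N s :=
    fun x => norm_prod_rpow_le _ (z.pair x)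
  have hi : Integrable (fun x => ‖z.pair x‖ ^ critExp N s) := by
    refine (hu.add hv).mono'
      (z.aestronglyMeasurable_pair.norm.aemeasurable.pow_const _).aestronglyMeasurable
      (Eventually.of_forall fun x => ?_)
    rw [Real.norm_eq_abs, abs_of_nonneg (by positivity)]
    exact hle x
  have key : ∀ t : ℝ, 0 ≤ t → t ≤ ‖z‖ ^ 2 →
      (sobolevConst N s * (2 / fracConst N s * t)) ^ (critExp N s / 2) ≤
      (sobolevConst N s * (2 / fracConst N s)) ^ (critExp N s / 2) * ‖z‖ ^ critExp N s := by
    intro t ht htz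
    rw [← mul_assoc, Real.mul_rpow (by positivity) ht]
    gcongr
    calc t ^ (critExp N s / 2) ≤ (‖z‖ ^ 2) ^ (critExp N s / 2) :=
          Real.rpow_le_rpow ht htz (by linarith)
      _ = ‖z‖ ^ critExp N s := by
          rw [← Real.rpow_two, ← Real.rpow_mul (norm_nonneg _)]; congr 1; ring
  refine ⟨hi, ?_⟩
  calc ∫ x, ‖z.pair x‖ ^ critExp N s ≤ ∫ x, (|z.u x| ^ critExp N s + |z.v x| ^ critExp N s) :=
        integral_mono hi (hu.add hv) hle
    _ = (∫ x, |z.u x| ^ critExp N s) + ∫ x, |z.v x| ^ critExp N s := integral_add hu hv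
    _ ≤ _ := by
        rw [critEmbConst]
        linarith [hu'.trans (key _ (fracForm_self_nonneg _ _) z.fracForm_u_le),
          hv'.trans (key _ (fracForm_self_nonneg _ _) z.fracForm_v_le)]

lemma rpow_le_add_of_mem_Icc {t q r : ℝ} (ht : 0 ≤ t) (hq : 2 ≤ q) (hqr : q ≤ r) :
    t ^ q ≤ t ^ 2 + t ^ r := by
  rcases ht.eq_or_lt with rfl | ht
  · rw [Real.zero_rpow (by linarith), Real.zero_rpow (by linarith)]; norm_num
  rw [← Real.rpow_two]
  rcases le_total t 1 with h | h
  · exact (Real.rpow_le_rpow_of_exponent_ge ht h hq).trans (le_add_of_nonneg_right (by positivity))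
  · exact (Real.rpow_le_rpow_of_exponent_le h hqr).trans (le_add_of_nonneg_left (by positivity))

/-- The constant of the embeddings of `X_ε` into `L^q`, `2 ≤ q ≤ 2*_s`. -/
def embConst (P : Potentials N) (s : ℝ) : ℝ := 1 / P.inf + critEmbConst N s

lemma embConst_nonneg (P : Potentials N) (s : ℝ) : 0 ≤ embConst P s :=
  add_nonneg (one_div_nonneg.2 P.inf_pos.le) (critEmbConst_nonneg N s)

/-- Apply `t^q ≤ t² + t^(2*_s)` to `t = ‖z(x)‖ / ‖z‖`: rescaling makes the resulting bound
homogeneous of degree `q`. -/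
lemma X.integral_pair_rpow_le (hs₀ : 0 < s) (hs₁ : s < 1) (hN : 2 * s < N) {q : ℝ} (hq : 2 ≤ q)
    (hq' : q ≤ critExp N s) (z : X P s ε) :
    Integrable (fun x => ‖z.pair x‖ ^ q) ∧
    ∫ x, ‖z.pair x‖ ^ q ≤ embConst P s * ‖z‖ ^ q := by
  obtain ⟨h2, h2'⟩ := z.integral_pair_sq_le
  obtain ⟨hr, hr'⟩ := z.integral_pair_crit_le hs₀ hs₁ hN
  have hi : Integrable (fun x => ‖z.pair x‖ ^ q) := by
    refine (h2.add hr).mono'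
      (z.aestronglyMeasurable_pair.norm.aemeasurable.pow_const _).aestronglyMeasurable
      (Eventually.of_forall fun x => ?_)
    rw [Real.norm_eq_abs, abs_of_nonneg (by positivity)]
    exact rpow_le_add_of_mem_Icc (norm_nonneg _) hq hq'
  refine ⟨hi, ?_⟩
  have hinf := P.inf_pos
  have h2'' : ∫ x, ‖z.pair x‖ ^ 2 ≤ 1 / P.inf * ‖z‖ ^ 2 := by
    rw [one_div_mul_eq_div, le_div_iff₀ hinf, mul_comm]
    exact h2'.trans z.pot_le
  rcases (norm_nonneg z).eq_or_lt with hz | hz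
  · rw [← hz, Real.zero_rpow (by linarith), mul_zero]
    rw [← hz, zero_pow two_ne_zero, mul_zero] at h2''
    rw [← hz, Real.zero_rpow (by linarith), mul_zero] at hr'
    calc ∫ x, ‖z.pair x‖ ^ q ≤ ∫ x, (‖z.pair x‖ ^ 2 + ‖z.pair x‖ ^ critExp N s) :=
          integral_mono hi (h2.add hr) fun x => rpow_le_add_of_mem_Icc (norm_nonneg _) hq hq'
      _ = (∫ x, ‖z.pair x‖ ^ 2) + ∫ x, ‖z.pair x‖ ^ critExp N s := integral_add h2 hr
      _ ≤ 0 := by linarith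
  · have hpt : ∀ x, ‖z.pair x‖ ^ q ≤ ‖z‖ ^ q * (‖z.pair x‖ ^ 2 / ‖z‖ ^ 2 +
        ‖z.pair x‖ ^ critExp N s / ‖z‖ ^ critExp N s) := fun x => by
      have h := rpow_le_add_of_mem_Icc (t := ‖z.pair x‖ / ‖z‖) (by positivity) hq hq'
      rw [Real.div_rpow (norm_nonneg _) hz.le, Real.div_rpow (norm_nonneg _) hz.le, div_pow,
        div_le_iff₀ (by positivity)] at h
      linarith
    calc ∫ x, ‖z.pair x‖ ^ q ≤ ∫ x, ‖z‖ ^ q * (‖z.pair x‖ ^ 2 / ‖z‖ ^ 2 +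
        ‖z.pair x‖ ^ critExp N s / ‖z‖ ^ critExp N s) :=
          integral_mono hi (((h2.div_const _).add (hr.div_const _)).const_mul _) hpt
      _ = ‖z‖ ^ q * ((∫ x, ‖z.pair x‖ ^ 2) / ‖z‖ ^ 2 +
          (∫ x, ‖z.pair x‖ ^ critExp N s) / ‖z‖ ^ critExp N s) := by
          rw [integral_const_mul, integral_add (h2.div_const _) (hr.div_const _),
            integral_div, integral_div]
      _ ≤ ‖z‖ ^ q * (1 / P.inf + critEmbConst N s) := by
          refine mul_le_mul_of_nonneg_left (add_le_add ?_ ?_) (by positivity)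
          · rwa [div_le_iff₀ (by positivity)]
          · rwa [div_le_iff₀ (by positivity)]
      _ = _ := mul_comm _ _

/-- The embeddings of `X_ε` into `L^q(S)`. -/
lemma X.lpRepresentation (P : Potentials N) (ε : ℝ) (hs₀ : 0 < s) (hs₁ : s < 1) (hN : 2 * s < N)
    (S : Set (E N)) {q : ℝ} (hq : 2 ≤ q) (hq' : q ≤ critExp N s) :
    LpRepresentation (volume.restrict S) q (embConst P s) (X.pair (P := P) (s := s) (ε := ε)) where
  aestronglyMeasurable z := z.aestronglyMeasurable_pair.restrict
  add z w := ae_restrict_of_ae (z.pair_add w)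
  smul c z := ae_restrict_of_ae (z.pair_smul c)
  integrable z := (z.integral_pair_rpow_le hs₀ hs₁ hN hq hq').1.integrableOn
  nonneg := embConst_nonneg P s
  bound z := (setIntegral_le_integral (z.integral_pair_rpow_le hs₀ hs₁ hN hq hq').1
    (Eventually.of_forall fun x => by positivity)).trans
      (z.integral_pair_rpow_le hs₀ hs₁ hN hq hq').2

end XSpace

/-! ### The penalised functional -/

section Functional

variable {N : ℕ}

/-- The set `{x : εx ∈ Λ}`. -/
def scaledLam (P : Potentials N) (ε : ℝ) : Set (E N) := {x | ε • x ∈ P.Lam}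

lemma isOpen_scaledLam (P : Potentials N) (ε : ℝ) : IsOpen (scaledLam P ε) :=
  P.isOpen_Lam.preimage (continuous_const_smul ε)

/-- Finite measure is what makes the subcritical term compact. -/
lemma volume_scaledLam_ne_top (P : Potentials N) {ε : ℝ} (hε : 0 < ε) :
    volume (scaledLam P ε) ≠ ⊤ := by
  obtain ⟨R, hR⟩ := P.isBounded_Lam.subset_closedBall 0
  have h1 : scaledLam P ε ⊆ Metric.closedBall 0 (R / ε) := fun x hx => by
    have h2 := hR hx
    rw [mem_closedBall_zero_iff, norm_smul, Real.norm_eq_abs, abs_of_pos hε] at h2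
    rw [mem_closedBall_zero_iff, le_div_iff₀ hε]
    linarith
  exact ((measure_mono h1).trans_lt measure_closedBall_lt_top).ne

/-- The data of the penalised problem: the nonlinearity is `Q + K / 2*_s` inside `Λ`, and outside
`Λ` it is a function `h` whose gradient has linear growth with the small constant `δ`. -/
structure PenalizedProblem (P : Potentials N) (s p : ℝ) (Q K h : ℝ × ℝ → ℝ) (ε δ : ℝ) : Prop where
  s_pos : 0 < s
  s_lt_one : s < 1
  two_s_lt : 2 * s < N
  two_lt_p : 2 < p
  p_lt : p < critExp N s
  hQ : HomogeneousNonlinearity p Q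
  hK : HomogeneousNonlinearity (critExp N s) K
  ε_pos : 0 < ε
  δ_pos : 0 < δ
  δ_small : δ * (8 * (p + 1)) ≤ P.inf * (p - 2)
  contDiff : ContDiff ℝ 1 h
  contDiff_radial : ContDiff ℝ 1 (fun z => fderiv ℝ h z z)
  norm_fderiv_le : ∀ z, ‖fderiv ℝ h z‖ ≤ δ * ‖z‖
  norm_fderiv_radial_le : ∀ z, ‖fderiv ℝ (fun z => fderiv ℝ h z z) z‖ ≤ δ * ‖z‖
  le_half : ∀ z, h z ≤ 1 / 2 * fderiv ℝ h z z
  zero : h 0 = 0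

namespace PenalizedProblem

variable {P : Potentials N} {s p : ℝ} {Q K h : ℝ × ℝ → ℝ} {ε δ : ℝ}

lemma one_lt_p (H : PenalizedProblem P s p Q K h ε δ) : 1 < p := by linarith [H.two_lt_p]

lemma two_lt_crit (H : PenalizedProblem P s p Q K h ε δ) : 2 < critExp N s :=
  H.two_lt_p.trans H.p_lt

lemma one_lt_crit (H : PenalizedProblem P s p Q K h ε δ) : 1 < critExp N s := by
  linarith [H.two_lt_crit]

lemma norm_fderiv_le' (H : PenalizedProblem P s p Q K h ε δ) (z : ℝ × ℝ) :
    ‖fderiv ℝ h z‖ ≤ δ * ‖z‖ ^ ((2 : ℝ) - 1) := by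
  rw [show (2 : ℝ) - 1 = 1 by norm_num, Real.rpow_one]; exact H.norm_fderiv_le z

lemma norm_fderiv_radial_le' (H : PenalizedProblem P s p Q K h ε δ) (z : ℝ × ℝ) :
    ‖fderiv ℝ (fun z => fderiv ℝ h z z) z‖ ≤ δ * ‖z‖ ^ ((2 : ℝ) - 1) := by
  rw [show (2 : ℝ) - 1 = 1 by norm_num, Real.rpow_one]; exact H.norm_fderiv_radial_le z

lemma radial_zero : fderiv ℝ h 0 0 = 0 := map_zero _

lemma abs_le (H : PenalizedProblem P s p Q K h ε δ) (z : ℝ × ℝ) : |h z| ≤ δ * ‖z‖ ^ 2 := by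
  have := abs_le_of_norm_fderiv_le one_lt_two H.contDiff H.zero H.δ_pos.le H.norm_fderiv_le' z
  rwa [Real.rpow_two] at this

lemma abs_radial_le (H : PenalizedProblem P s p Q K h ε δ) (z : ℝ × ℝ) :
    |fderiv ℝ h z z| ≤ δ * ‖z‖ ^ 2 := by
  have := abs_le_of_norm_fderiv_le one_lt_two H.contDiff_radial radial_zero H.δ_pos.le
    H.norm_fderiv_radial_le' z
  rwa [Real.rpow_two] at this

end PenalizedProblem

variable [NeZero N]

/-- The functional of the penalised problem. -/
def penalizedFun (P : Potentials N) (s : ℝ) (Q K h : ℝ × ℝ → ℝ) (ε : ℝ) (z : X P s ε) : ℝ :=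
  1 / 2 * ‖z‖ ^ 2 - (∫ x in scaledLam P ε, extendZero Q (z.pair x)) -
    1 / critExp N s * (∫ x in scaledLam P ε, extendZero K (z.pair x)) -
    ∫ x in (scaledLam P ε)ᶜ, h (z.pair x)

namespace PenalizedProblem

variable {P : Potentials N} {s p : ℝ} {Q K h : ℝ × ℝ → ℝ} {ε δ : ℝ}

lemma repQ (H : PenalizedProblem P s p Q K h ε δ) :
    LpRepresentation (volume.restrict (scaledLam P ε)) p (embConst P s)
      (X.pair (P := P) (s := s) (ε := ε)) :=
  X.lpRepresentation P ε H.s_pos H.s_lt_one H.two_s_lt _ H.two_lt_p.le H.p_lt.le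

lemma repK (H : PenalizedProblem P s p Q K h ε δ) :
    LpRepresentation (volume.restrict (scaledLam P ε)) (critExp N s) (embConst P s)
      (X.pair (P := P) (s := s) (ε := ε)) :=
  X.lpRepresentation P ε H.s_pos H.s_lt_one H.two_s_lt _ H.two_lt_crit.le le_rfl

lemma repH (H : PenalizedProblem P s p Q K h ε δ) :
    LpRepresentation (volume.restrict (scaledLam P ε)ᶜ) 2 (embConst P s)
      (X.pair (P := P) (s := s) (ε := ε)) :=
  X.lpRepresentation P ε H.s_pos H.s_lt_one H.two_s_lt _ le_rfl H.two_lt_crit.le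

lemma integrable_Q (H : PenalizedProblem P s p Q K h ε δ) (z : X P s ε) :
    IntegrableOn (fun x => extendZero Q (z.pair x)) (scaledLam P ε) := by
  obtain ⟨C, hC, hC'⟩ := H.hQ.norm_fderiv_extendZero_le H.one_lt_p
  have h1 := H.hQ.contDiff_extendZero H.one_lt_p
  exact H.repQ.integrable_comp h1.continuous
    (abs_le_of_norm_fderiv_le H.one_lt_p h1 (extendZero_zero Q) hC.le hC') z

lemma integrable_K (H : PenalizedProblem P s p Q K h ε δ) (z : X P s ε) :
    IntegrableOn (fun x => extendZero K (z.pair x)) (scaledLam P ε) := by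
  obtain ⟨C, hC, hC'⟩ := H.hK.norm_fderiv_extendZero_le H.one_lt_crit
  have h1 := H.hK.contDiff_extendZero H.one_lt_crit
  exact H.repK.integrable_comp h1.continuous
    (abs_le_of_norm_fderiv_le H.one_lt_crit h1 (extendZero_zero K) hC.le hC') z

lemma integrable_h (H : PenalizedProblem P s p Q K h ε δ) (z : X P s ε) :
    IntegrableOn (fun x => h (z.pair x)) (scaledLam P ε)ᶜ :=
  H.repH.integrable_comp H.contDiff.continuous
    (fun z => by rw [Real.rpow_two]; exact H.abs_le z) z

lemma integrable_radial (H : PenalizedProblem P s p Q K h ε δ) (z : X P s ε) :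
    IntegrableOn (fun x => fderiv ℝ h (z.pair x) (z.pair x)) (scaledLam P ε)ᶜ :=
  H.repH.integrable_comp H.contDiff_radial.continuous
    (fun z => by rw [Real.rpow_two]; exact H.abs_radial_le z) z

/-- The functional is `C¹`, with the expected derivative. -/
lemma contDiff_penalizedFun (H : PenalizedProblem P s p Q K h ε δ) :
    ContDiff ℝ 1 (penalizedFun P s Q K h ε) ∧ ∀ z w,
      fderiv ℝ (penalizedFun P s Q K h ε) z w = inner ℝ z w -
        (∫ x in scaledLam P ε, fderiv ℝ (extendZero Q) (z.pair x) (w.pair x)) -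
        1 / critExp N s * (∫ x in scaledLam P ε, fderiv ℝ (extendZero K) (z.pair x) (w.pair x)) -
        ∫ x in (scaledLam P ε)ᶜ, fderiv ℝ h (z.pair x) (w.pair x) := by
  obtain ⟨C, hC, hC'⟩ := H.hQ.norm_fderiv_extendZero_le H.one_lt_p
  obtain ⟨D, hD, hD'⟩ := H.hK.norm_fderiv_extendZero_le H.one_lt_crit
  have hQ1 := H.hQ.contDiff_extendZero H.one_lt_p
  have hK1 := H.hK.contDiff_extendZero H.one_lt_crit
  have cQ := H.repQ.contDiff_integral H.one_lt_p hQ1 (extendZero_zero Q) hC.le hC'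
  have cK := H.repK.contDiff_integral H.one_lt_crit hK1 (extendZero_zero K) hD.le hD'
  have cH := H.repH.contDiff_integral one_lt_two H.contDiff H.zero H.δ_pos.le H.norm_fderiv_le'
  have cN : ContDiff ℝ 1 (fun z : X P s ε => 1 / 2 * ‖z‖ ^ 2) :=
    contDiff_const.mul (contDiff_norm_sq ℝ)
  refine ⟨((cN.sub cQ).sub (contDiff_const.mul cK)).sub cH, fun z w => ?_⟩
  have dQ := (cQ.differentiable (by norm_num) z).hasFDerivAt
  have dK := (cK.differentiable (by norm_num) z).hasFDerivAt
  have dH := (cH.differentiable (by norm_num) z).hasFDerivAt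
  have dN : HasFDerivAt (fun z : X P s ε => 1 / 2 * ‖z‖ ^ 2) (innerSL ℝ z) z := by
    have := (hasStrictFDerivAt_norm_sq z).hasFDerivAt.const_mul (1 / 2 : ℝ)
    refine this.congr_fderiv ?_
    ext w
    simp
  have := (((dN.sub dQ).sub (dK.const_mul (1 / critExp N s))).sub dH).fderiv
  have h1 := congrArg (fun L : X P s ε →L[ℝ] ℝ => L w) this
  refine h1.trans ?_
  have eQ := H.repQ.fderiv_integral_apply H.one_lt_p hQ1 (extendZero_zero Q) hC.le hC' z w
  have eK := H.repK.fderiv_integral_apply H.one_lt_crit hK1 (extendZero_zero K) hD.le hD' z w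
  have eH := H.repH.fderiv_integral_apply one_lt_two H.contDiff H.zero H.δ_pos.le
    H.norm_fderiv_le' z w
  rw [← eQ, ← eK, ← eH]
  simp

/-- Euler's identity replaces the derivatives of `Q` and `K` by the functions themselves, so `φ` is
again an integral functional with `C¹` integrands. -/
lemma nehariFun_eq (H : PenalizedProblem P s p Q K h ε δ) (z : X P s ε) :
    nehariFun (penalizedFun P s Q K h ε) z = ‖z‖ ^ 2 -
      p * (∫ x in scaledLam P ε, extendZero Q (z.pair x)) -
      (∫ x in scaledLam P ε, extendZero K (z.pair x)) -
      ∫ x in (scaledLam P ε)ᶜ, fderiv ℝ h (z.pair x) (z.pair x) := by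
  have hr : critExp N s ≠ 0 := by linarith [H.two_lt_crit]
  rw [nehariFun, H.contDiff_penalizedFun.2 z z]
  simp only [H.hQ.euler H.one_lt_p, H.hK.euler H.one_lt_crit]
  rw [integral_const_mul, integral_const_mul, real_inner_self_eq_norm_sq]
  field_simp

lemma contDiff_nehariFun (H : PenalizedProblem P s p Q K h ε δ) :
    ContDiff ℝ 1 (nehariFun (penalizedFun P s Q K h ε)) ∧ ∀ z w,
      fderiv ℝ (nehariFun (penalizedFun P s Q K h ε)) z w = 2 * inner ℝ z w -
        p * (∫ x in scaledLam P ε, fderiv ℝ (extendZero Q) (z.pair x) (w.pair x)) -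
        (∫ x in scaledLam P ε, fderiv ℝ (extendZero K) (z.pair x) (w.pair x)) -
        ∫ x in (scaledLam P ε)ᶜ, fderiv ℝ (fun y => fderiv ℝ h y y) (z.pair x) (w.pair x) := by
  obtain ⟨C, hC, hC'⟩ := H.hQ.norm_fderiv_extendZero_le H.one_lt_p
  obtain ⟨D, hD, hD'⟩ := H.hK.norm_fderiv_extendZero_le H.one_lt_crit
  have hQ1 := H.hQ.contDiff_extendZero H.one_lt_p
  have hK1 := H.hK.contDiff_extendZero H.one_lt_crit
  have cQ := H.repQ.contDiff_integral H.one_lt_p hQ1 (extendZero_zero Q) hC.le hC'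
  have cK := H.repK.contDiff_integral H.one_lt_crit hK1 (extendZero_zero K) hD.le hD'
  have cH := H.repH.contDiff_integral one_lt_two H.contDiff_radial radial_zero H.δ_pos.le
    H.norm_fderiv_radial_le'
  have cN : ContDiff ℝ 1 (fun z : X P s ε => ‖z‖ ^ 2) := contDiff_norm_sq ℝ
  rw [show nehariFun (penalizedFun P s Q K h ε) = _ from funext H.nehariFun_eq]
  refine ⟨((cN.sub (contDiff_const.mul cQ)).sub cK).sub cH, fun z w => ?_⟩
  have dQ := (cQ.differentiable (by norm_num) z).hasFDerivAt
  have dK := (cK.differentiable (by norm_num) z).hasFDerivAt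
  have dH := (cH.differentiable (by norm_num) z).hasFDerivAt
  have dN := (hasStrictFDerivAt_norm_sq z).hasFDerivAt
  have := (((dN.sub (dQ.const_mul p)).sub dK).sub dH).fderiv
  have h1 := congrArg (fun L : X P s ε →L[ℝ] ℝ => L w) this
  refine h1.trans ?_
  have eQ := H.repQ.fderiv_integral_apply H.one_lt_p hQ1 (extendZero_zero Q) hC.le hC' z w
  have eK := H.repK.fderiv_integral_apply H.one_lt_crit hK1 (extendZero_zero K) hD.le hD' z w
  have eH := H.repH.fderiv_integral_apply one_lt_two H.contDiff_radial radial_zero H.δ_pos.le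
    H.norm_fderiv_radial_le' z w
  rw [← eQ, ← eK, ← eH]
  simp

end PenalizedProblem

/-- `J_ε` is the functional of the penalised problem with `h = Q̂`. -/
lemma J_eq_penalizedFun {P : Potentials N} {s p : ℝ} {Q K : ℝ × ℝ → ℝ} {ε δ a : ℝ} {η : ℝ → ℝ}
    (H : PenalizedProblem P s p Q K (Qhat (critExp N s) Q K a η) ε δ) :
    J P s Q K a η ε = penalizedFun P s Q K (Qhat (critExp N s) Q K a η) ε := by
  funext z
  have hm : MeasurableSet (scaledLam P ε) := (isOpen_scaledLam P ε).measurableSet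
  have h1 : ∀ x, penalized (critExp N s) P.Lam Q K a η (ε • x) (z.u x, z.v x) =
      (scaledLam P ε).indicator (fun x => extendZero Q (z.pair x) +
        1 / critExp N s * extendZero K (z.pair x)) x +
      (scaledLam P ε)ᶜ.indicator (fun x => Qhat (critExp N s) Q K a η (z.pair x)) x := fun x => by
    by_cases hx : x ∈ scaledLam P ε
    · have hx' : ε • x ∈ P.Lam := hx
      rw [penalized, Set.indicator_of_mem hx', Set.indicator_of_mem hx,
        Set.indicator_of_notMem (by simpa using hx), totalNonlin]
      simp [X.pair]
    · have hx' : ε • x ∉ P.Lam := hx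
      rw [penalized, Set.indicator_of_notMem hx', Set.indicator_of_notMem hx,
        Set.indicator_of_mem (by simpa using hx)]
      simp [X.pair]
  have hQK : IntegrableOn (fun x => extendZero Q (z.pair x) +
      1 / critExp N s * extendZero K (z.pair x)) (scaledLam P ε) :=
    (H.integrable_Q z).add ((H.integrable_K z).const_mul _)
  rw [J, penalizedFun]
  simp only [h1]
  rw [integral_add ((integrable_indicator_iff hm).2 hQK)
    ((integrable_indicator_iff hm.compl).2 (H.integrable_h z)), integral_indicator hm,
    integral_indicator hm.compl, integral_add (H.integrable_Q z) ((H.integrable_K z).const_mul _),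
    integral_const_mul]
  ring

end Functional


/-! ### Inequalities of Young type and weak limits -/

section Limits

variable {α : Type*} [MeasurableSpace α] {μ : Measure α}

/-- Weak convergence in a weighted `L²` space: bounded sequences converging to zero almost
everywhere converge weakly to zero. -/
lemma tendsto_integral_weight_mul {ω f : α → ℝ} {g : ℕ → α → ℝ} {M : ℝ}
    (hω : AEStronglyMeasurable ω μ) (hω0 : ∀ x, 0 ≤ ω x) (hf : AEStronglyMeasurable f μ)
    (hg : ∀ n, AEStronglyMeasurable (g n) μ) (hf2 : Integrable (fun x => ω x * f x ^ 2) μ)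
    (hg2 : ∀ n, Integrable (fun x => ω x * g n x ^ 2) μ)
    (hM : ∀ n, ∫ x, ω x * g n x ^ 2 ∂μ ≤ M)
    (h0 : ∀ᵐ x ∂μ, Tendsto (fun n => g n x) atTop (𝓝 0)) :
    Tendsto (fun n => ∫ x, |ω x * (f x * g n x)| ∂μ) atTop (𝓝 0) := by
  refine tendsto_integral_abs_of_le_mul_add (fun n => hω.mul (hf.mul (hg n))) ?_ hg2
    (fun n x => mul_nonneg (hω0 x) (sq_nonneg _)) hM fun δ hδ => ?_
  · filter_upwards [h0] with x hx
    simpa using (hx.const_mul (f x)).const_mul (ω x)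
  · refine ⟨fun x => 1 / δ * (ω x * f x ^ 2), hf2.const_mul _,
      fun n => Eventually.of_forall fun x => ?_⟩
    -- Young's inequality with a parameter: the sequence enters with the small factor, the fixed
    -- function with the large one.
    have h1 : |f x * g n x| ≤ δ * g n x ^ 2 + 1 / δ * f x ^ 2 := by
      rw [abs_mul]
      have h2 : 0 ≤ (δ * |g n x| - |f x|) ^ 2 := sq_nonneg _
      have h3 : 0 ≤ |f x| * |g n x| := by positivity
      have h4 : δ * g n x ^ 2 + 1 / δ * f x ^ 2 - |f x| * |g n x| =
          1 / δ * ((δ * |g n x| - |f x|) ^ 2 + δ * (|f x| * |g n x|)) := by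
        rw [← sq_abs (g n x), ← sq_abs (f x)]; field_simp; ring
      have h5 : 0 ≤ 1 / δ * ((δ * |g n x| - |f x|) ^ 2 + δ * (|f x| * |g n x|)) := by positivity
      linarith
    calc |ω x * (f x * g n x)| = ω x * |f x * g n x| := by rw [abs_mul, abs_of_nonneg (hω0 x)]
      _ ≤ ω x * (δ * g n x ^ 2 + 1 / δ * f x ^ 2) := mul_le_mul_of_nonneg_left h1 (hω0 x)
      _ = _ := by ring

/-- Split at `t = (1/δ)^(1/(r-p))`: above it the first term suffices, below it the constant does. -/
lemma rpow_le_mul_rpow_add {p r δ : ℝ} (hp : 0 < p) (hpr : p < r) (hδ : 0 < δ) {t : ℝ}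
    (ht : 0 ≤ t) : t ^ p ≤ δ * t ^ r + (1 / δ) ^ (p / (r - p)) := by
  have hrp : 0 < r - p := by linarith
  rcases le_or_gt ((1 / δ) ^ (1 / (r - p))) t with h | h
  · have ht' : 0 < t := lt_of_lt_of_le (by positivity) h
    have h1 : 1 / δ ≤ t ^ (r - p) := by
      have := Real.rpow_le_rpow (by positivity) h hrp.le
      rwa [← Real.rpow_mul (by positivity), one_div_mul_cancel hrp.ne', Real.rpow_one] at this
    have h2 : t ^ r = t ^ (r - p) * t ^ p := by rw [← Real.rpow_add ht']; congr 1; ring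
    have h3 : 1 ≤ δ * t ^ (r - p) := by
      rw [div_le_iff₀ hδ] at h1; linarith
    have h4 : 0 ≤ (1 / δ) ^ (p / (r - p)) := by positivity
    rw [h2]
    nlinarith [Real.rpow_pos_of_pos ht' p]
  · have h1 := Real.rpow_le_rpow ht h.le hp.le
    rw [← Real.rpow_mul (by positivity), one_div_mul_eq_div] at h1
    exact h1.trans (le_add_of_nonneg_left (by positivity))

/-- If `y ≤ τx`, the left side is at most `τ 2^(r-1) x^r`; otherwise `x ≤ y/τ` and everything is a
power of `y`. The choice of `τ` makes the first factor at most `δ`. -/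
lemma exists_add_rpow_mul_le {r δ : ℝ} (hr : 1 < r) (hδ : 0 < δ) :
    ∃ D > 0, ∀ x y : ℝ, 0 ≤ x → 0 ≤ y → (x + y) ^ (r - 1) * y ≤ δ * x ^ r + D * y ^ r := by
  have hr1 : 0 < r - 1 := by linarith
  have key : ∀ t : ℝ, 0 ≤ t → t ^ (r - 1) * t = t ^ r := by
    intro t ht
    rcases ht.eq_or_lt with rfl | ht
    · rw [mul_zero, Real.zero_rpow (by linarith)]
    · rw [← Real.rpow_add_one ht.ne']; congr 1; ring
  set τ : ℝ := min 1 (δ / 2 ^ (r - 1)) with hτ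
  have hτ0 : 0 < τ := by positivity
  refine ⟨(1 / τ + 1) ^ (r - 1), by positivity, fun x y hx hy => ?_⟩
  rcases le_or_gt y (τ * x) with h | h
  · have h1 : x + y ≤ 2 * x := by
      have : τ * x ≤ 1 * x := mul_le_mul_of_nonneg_right (min_le_left _ _) hx
      linarith
    have h2 : (x + y) ^ (r - 1) ≤ 2 ^ (r - 1) * x ^ (r - 1) := by
      rw [← Real.mul_rpow (by norm_num) hx]
      exact Real.rpow_le_rpow (by positivity) h1 hr1.le
    have h3 : τ * 2 ^ (r - 1) ≤ δ := by
      rw [← le_div_iff₀ (by positivity)]; exact min_le_right _ _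
    calc (x + y) ^ (r - 1) * y ≤ (2 ^ (r - 1) * x ^ (r - 1)) * (τ * x) := by gcongr
      _ = τ * 2 ^ (r - 1) * x ^ r := by rw [← key x hx]; ring
      _ ≤ δ * x ^ r := by gcongr
      _ ≤ _ := le_add_of_nonneg_right (by positivity)
  · have h1 : x + y ≤ (1 / τ + 1) * y := by
      have : x ≤ 1 / τ * y := by rw [one_div_mul_eq_div, le_div_iff₀ hτ0]; linarith
      linarith
    calc (x + y) ^ (r - 1) * y ≤ ((1 / τ + 1) * y) ^ (r - 1) * y := by gcongr
      _ = (1 / τ + 1) ^ (r - 1) * y ^ r := by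
          rw [Real.mul_rpow (by positivity) hy, mul_assoc, key y hy]
      _ ≤ _ := le_add_of_nonneg_left (by positivity)

end Limits

/-! ### Extraction of limits in `X_ε` -/

section Extraction

variable {N : ℕ} {s : ℝ}

/-- Almost everywhere limits of sequences bounded in `L²`, in `H^s` and in a weighted space. -/
lemma exists_memWeighted_of_tendsto {U : E N → ℝ} (hU0 : ∀ x, 0 < U x) {u : ℕ → L2 N}
    {f : E N → ℝ} {M D B : ℝ} (hu : ∀ n, MemWeighted s U (u n)) (hM : ∀ n, ‖u n‖ ≤ M)
    (hD : ∀ n, ∫ q, gagliardoKernel s (u n) (u n) q ∂((volume : Measure (E N)).prod volume) ≤ D)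
    (hB : ∀ n, ∫ x, U x * u n x ^ 2 ≤ B)
    (hf : ∀ᵐ x, Tendsto (fun n => u n x) atTop (𝓝 (f x))) :
    ∃ u₀ : L2 N, MemWeighted s U u₀ ∧ u₀ =ᵐ[volume] f := by
  have hfm : AEStronglyMeasurable f volume :=
    aestronglyMeasurable_of_tendsto_ae atTop (fun n => Lp.aestronglyMeasurable (u n)) hf
  have h2 : Integrable (fun x => f x ^ 2) := by
    refine (integrable_of_tendsto_of_integral_le (M := M ^ 2) (fun n => integrable_sq (u n))
      (fun n => Eventually.of_forall fun x => sq_nonneg _) (fun n => ?_) ?_).1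
    · rw [integral_sq_eq]
      exact pow_le_pow_left₀ (norm_nonneg _) (hM n) 2
    · filter_upwards [hf] with x hx using hx.pow 2
  have hmem : MemLp f 2 volume := (memLp_two_iff_integrable_sq hfm).2 h2
  refine ⟨hmem.toLp, ⟨?_, ?_⟩, hmem.coeFn_toLp⟩
  -- Fatou's lemma on the product space: the kernels converge almost everywhere there.
  · refine (integrable_of_tendsto_of_integral_le (fun n => (hu n).1)
      (fun n => Eventually.of_forall fun q => kernel_self_nonneg s _ q) hD ?_).1
    filter_upwards [ae_fst_snd hf, ae_fst_snd hmem.coeFn_toLp] with q h3 h4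
    simp only [gagliardoKernel, h4.1, h4.2]
    exact ((h3.1.sub h3.2).mul (h3.1.sub h3.2)).div_const _
  · refine (integrable_of_tendsto_of_integral_le (fun n => (hu n).2)
      (fun n => Eventually.of_forall fun x => mul_nonneg (hU0 x).le (sq_nonneg _)) hB ?_).1
    filter_upwards [hf, hmem.coeFn_toLp] with x h3 h4
    rw [h4]
    exact (h3.pow 2).const_mul _

variable [NeZero N] {P : Potentials N} {ε : ℝ}

lemma X.inf_mul_norm_u_le (z : X P s ε) : P.inf * ‖z.u‖ ^ 2 ≤ ‖z‖ ^ 2 := by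
  obtain ⟨h1, h2⟩ := z.integral_pair_sq_le
  refine le_trans (mul_le_mul_of_nonneg_left ?_ P.inf_pos.le) (h2.trans z.pot_le)
  rw [← integral_sq_eq]
  refine integral_mono (integrable_sq z.u) h1 fun x => ?_
  simp only
  rw [← sq_abs]
  exact pow_le_pow_left₀ (abs_nonneg _) (norm_fst_le (z.pair x)) 2

lemma X.inf_mul_norm_v_le (z : X P s ε) : P.inf * ‖z.v‖ ^ 2 ≤ ‖z‖ ^ 2 := by
  obtain ⟨h1, h2⟩ := z.integral_pair_sq_le
  refine le_trans (mul_le_mul_of_nonneg_left ?_ P.inf_pos.le) (h2.trans z.pot_le)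
  rw [← integral_sq_eq]
  refine integral_mono (integrable_sq z.v) h1 fun x => ?_
  simp only
  rw [← sq_abs]
  exact pow_le_pow_left₀ (abs_nonneg _) (norm_snd_le (z.pair x)) 2

/-- Bounded sequences in `X_ε` have subsequences converging almost everywhere to an element
of `X_ε`. -/
theorem X.exists_seq_tendsto_ae (hs₀ : 0 < s) (hs₁ : s < 1) {z : ℕ → X P s ε} {M : ℝ}
    (hM : ∀ n, ‖z n‖ ≤ M) :
    ∃ (z₀ : X P s ε) (k : ℕ → ℕ), StrictMono k ∧
      ∀ᵐ x, Tendsto (fun n => (z (k n)).pair x) atTop (𝓝 (z₀.pair x)) := by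
  have hinf := P.inf_pos
  have hC := fracConst_pos (N := N) hs₀ hs₁
  have hM2 : ∀ n, ‖z n‖ ^ 2 ≤ M ^ 2 := fun n => pow_le_pow_left₀ (norm_nonneg _) (hM n) 2
  have hroot : ∀ t : ℝ, 0 ≤ t → ∀ n, P.inf * t ^ 2 ≤ ‖z n‖ ^ 2 → t ≤ √(M ^ 2 / P.inf) := by
    intro t ht n h
    refine Real.le_sqrt_of_sq_le ?_
    rw [le_div_iff₀ hinf]
    linarith [hM2 n]
  have hu2 : ∀ n, ‖(z n).u‖ ≤ √(M ^ 2 / P.inf) := fun n =>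
    hroot _ (norm_nonneg _) n (z n).inf_mul_norm_u_le
  have hv2 : ∀ n, ‖(z n).v‖ ≤ √(M ^ 2 / P.inf) := fun n =>
    hroot _ (norm_nonneg _) n (z n).inf_mul_norm_v_le
  have hker : ∀ (t : E N → ℝ) n, fracForm s t t ≤ ‖z n‖ ^ 2 →
      ∫ q, gagliardoKernel s t t q ∂((volume : Measure (E N)).prod volume) ≤
        2 / fracConst N s * M ^ 2 := by
    intro t n h
    rw [integral_kernel_eq hs₀ hs₁]
    exact mul_le_mul_of_nonneg_left (h.trans (hM2 n)) (by positivity)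
  obtain ⟨k₁, f, hk₁, hf⟩ := exists_seq_tendsto_ae_of_bounded hs₀ hu2 (fun n => (z n).memHs_u)
    (fun n => hker _ n (z n).fracForm_u_le)
  obtain ⟨k₂, g, hk₂, hg⟩ := exists_seq_tendsto_ae_of_bounded hs₀ (fun n => hv2 (k₁ n))
    (fun n => (z (k₁ n)).memHs_v) (fun n => hker _ (k₁ n) (z (k₁ n)).fracForm_v_le)
  have hf' : ∀ᵐ x, Tendsto (fun n => (z (k₁ (k₂ n))).u x) atTop (𝓝 (f x)) := by
    filter_upwards [hf] with x hx using hx.comp hk₂.tendsto_atTop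
  have hpot : ∀ n, (∫ x, P.V (ε • x) * (z n).u x ^ 2) ≤ M ^ 2 ∧
      (∫ x, P.W (ε • x) * (z n).v x ^ 2) ≤ M ^ 2 := fun n => by
    have h1 := (z n).pot_le.trans (hM2 n)
    have h2 := weightForm_self_nonneg (U := fun x => P.V (ε • x)) (fun _ => P.V_pos _) (z n).u
    have h3 := weightForm_self_nonneg (U := fun x => P.W (ε • x)) (fun _ => P.W_pos _) (z n).v
    rw [X.pot] at h1
    simp only [weightForm, ← sq] at h1 h2 h3
    constructor <;> linarith
  obtain ⟨u₀, hu₀, hu₀'⟩ := exists_memWeighted_of_tendsto (s := s)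
    (U := fun x => P.V (ε • x)) (fun _ => P.V_pos _)
    (fun n => (z (k₁ (k₂ n))).2.1) (fun n => hu2 (k₁ (k₂ n)))
    (fun n => hker _ _ (z (k₁ (k₂ n))).fracForm_u_le) (fun n => (hpot _).1) hf'
  obtain ⟨v₀, hv₀, hv₀'⟩ := exists_memWeighted_of_tendsto (s := s)
    (U := fun x => P.W (ε • x)) (fun _ => P.W_pos _)
    (fun n => (z (k₁ (k₂ n))).2.2) (fun n => hv2 (k₁ (k₂ n)))
    (fun n => hker _ _ (z (k₁ (k₂ n))).fracForm_v_le) (fun n => (hpot _).2) hg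
  refine ⟨⟨(u₀, v₀), hu₀, hv₀⟩, k₁ ∘ k₂, hk₁.comp hk₂, ?_⟩
  filter_upwards [hf', hg, hu₀', hv₀'] with x h1 h2 h3 h4
  have h5 : X.pair (⟨(u₀, v₀), hu₀, hv₀⟩ : X P s ε) x = (f x, g x) := by
    rw [← h3, ← h4]; rfl
  rw [h5]
  exact h1.prodMk_nhds h2

/-- Bounded sequences in `X_ε` converging to zero almost everywhere converge weakly to zero. -/
lemma X.tendsto_inner_zero (hs₀ : 0 < s) (hs₁ : s < 1) (z : X P s ε) {w : ℕ → X P s ε} {M : ℝ}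
    (hM : ∀ n, ‖w n‖ ≤ M) (hw : ∀ᵐ x, Tendsto (fun n => (w n).pair x) atTop (𝓝 0)) :
    Tendsto (fun n => inner ℝ z (w n)) atTop (𝓝 0) := by
  have hC := fracConst_pos (N := N) hs₀ hs₁
  have hM2 : ∀ n, ‖w n‖ ^ 2 ≤ M ^ 2 := fun n => pow_le_pow_left₀ (norm_nonneg _) (hM n) 2
  have hwu : ∀ᵐ x, Tendsto (fun n => (w n).u x) atTop (𝓝 0) := by
    filter_upwards [hw] with x hx
    exact (continuous_fst.tendsto (0 : ℝ × ℝ)).comp hx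
  have hwv : ∀ᵐ x, Tendsto (fun n => (w n).v x) atTop (𝓝 0) := by
    filter_upwards [hw] with x hx
    exact (continuous_snd.tendsto (0 : ℝ × ℝ)).comp hx
  -- The Gagliardo form is a weighted `L²` pairing on the product space, so the weak limit lemma
  -- covers it as it does the potential part.
  have hfrac : ∀ (f : L2 N) (g : ℕ → L2 N), MemHs s f → (∀ n, MemHs s (g n)) →
      (∀ n, fracForm s (g n) (g n) ≤ M ^ 2) → (∀ᵐ x, Tendsto (fun n => g n x) atTop (𝓝 0)) →
      Tendsto (fun n => fracForm s f (g n)) atTop (𝓝 0) := by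
    intro f g hf hg hgM hg0
    have hsq : ∀ t : L2 N, (fun q : E N × E N => (‖q.1 - q.2‖ ^ ((N : ℝ) + 2 * s))⁻¹ *
        (t q.1 - t q.2) ^ 2) = gagliardoKernel s t t := fun t => by
      funext q; rw [kernel_eq, sq]
    have h1 := tendsto_integral_weight_mul (μ := (volume : Measure (E N)).prod volume)
      (M := 2 / fracConst N s * M ^ 2)
      (aesm_weight s) (fun q => by positivity) (aesm_diff f) (fun n => aesm_diff (g n))
      (by rw [hsq]; exact hf) (fun n => by rw [hsq]; exact hg n) (fun n => ?_) ?_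
    · have h2 := (tendsto_integral_of_abs h1).const_mul (fracConst N s / 2)
      rw [mul_zero] at h2
      refine h2.congr fun n => ?_
      rw [fracForm]
      simp only [kernel_eq]
    · rw [hsq, integral_kernel_eq hs₀ hs₁]
      exact mul_le_mul_of_nonneg_left (hgM n) (by positivity)
    · filter_upwards [ae_fst_snd hg0] with q hq
      simpa using hq.1.sub hq.2
  have hweight : ∀ (U : E N → ℝ), Continuous U → (∀ x, 0 < U x) → ∀ (f : L2 N) (g : ℕ → L2 N),
      MemWeighted s U f → (∀ n, MemWeighted s U (g n)) → (∀ n, weightForm U (g n) (g n) ≤ M ^ 2) →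
      (∀ᵐ x, Tendsto (fun n => g n x) atTop (𝓝 0)) →
      Tendsto (fun n => weightForm U f (g n)) atTop (𝓝 0) := by
    intro U hU hU0 f g hf hg hgM hg0
    refine tendsto_integral_of_abs (tendsto_integral_weight_mul (M := M ^ 2)
      hU.aestronglyMeasurable (fun x => (hU0 x).le) (Lp.aestronglyMeasurable f)
      (fun n => Lp.aestronglyMeasurable (g n)) hf.2 (fun n => (hg n).2) (fun n => ?_) hg0)
    have := hgM n
    simpa only [weightForm, ← sq] using this
  have hpot : ∀ n, weightForm (fun x => P.V (ε • x)) (w n).u (w n).u ≤ M ^ 2 ∧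
      weightForm (fun x => P.W (ε • x)) (w n).v (w n).v ≤ M ^ 2 := fun n => by
    have h1 := (w n).pot_le.trans (hM2 n)
    have h2 := weightForm_self_nonneg (U := fun x => P.V (ε • x)) (fun _ => P.V_pos _) (w n).u
    have h3 := weightForm_self_nonneg (U := fun x => P.W (ε • x)) (fun _ => P.W_pos _) (w n).v
    rw [X.pot] at h1
    constructor <;> linarith
  have h1 := hfrac z.u (fun n => (w n).u) z.memHs_u (fun n => (w n).memHs_u)
    (fun n => (w n).fracForm_u_le.trans (hM2 n)) hwu
  have h2 := hfrac z.v (fun n => (w n).v) z.memHs_v (fun n => (w n).memHs_v)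
    (fun n => (w n).fracForm_v_le.trans (hM2 n)) hwv
  have h3 := hweight _ (P.continuous_V ε) (fun _ => P.V_pos _) z.u (fun n => (w n).u) z.2.1
    (fun n => (w n).2.1) (fun n => (hpot n).1) hwu
  have h4 := hweight _ (P.continuous_W ε) (fun _ => P.W_pos _) z.v (fun n => (w n).v) z.2.2
    (fun n => (w n).2.2) (fun n => (hpot n).2) hwv
  have h5 := (h1.add h2).add (h3.add h4)
  simp only [add_zero] at h5
  exact h5

/-- The inequality defining `S̃_K`, in homogeneous form. -/
lemma X.SK_mul_rpow_le {K : ℝ × ℝ → ℝ} (hs₀ : 0 < s) (hN : 2 * s < N)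
    (hK : HomogeneousNonlinearity (critExp N s) K) (z : X P s ε) :
    SK N s K * (∫ x, extendZero K (z.pair x)) ^ (2 / critExp N s) ≤ z.frac := by
  have hr := two_lt_critExp hs₀ hN
  set r := critExp N s with hrdef
  set κ := ∫ x, extendZero K (z.pair x) with hκ
  have hκ0 : 0 ≤ κ := integral_nonneg fun x => hK.extendZero_nonneg _
  rcases hκ0.eq_or_lt with h0 | h0
  · rw [← h0, Real.zero_rpow (by positivity), mul_zero]
    exact z.frac_nonneg
  -- This factor normalises the constraint: the integral of `K` over `t • z` is `t^r κ = 1`.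
  set t := κ ^ (-(1 / r)) with ht
  have ht0 : 0 < t := by positivity
  have h1 : SK N s K ≤ t ^ 2 * z.frac := by
    refine csInf_le ⟨0, ?_⟩ ⟨(t • z).u, (t • z).v, (t • z).memHs_u, (t • z).memHs_v, ?_, ?_⟩
    · rintro _ ⟨u, v, -, -, -, rfl⟩
      exact add_nonneg (fracForm_self_nonneg _ _) (fracForm_self_nonneg _ _)
    · simp only [← hK.extendZero_eq_max (by linarith : 1 < r)]
      have h2 : ∫ x, extendZero K ((t • z).u x, (t • z).v x) =
          ∫ x, t ^ r * extendZero K (z.pair x) := by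
        refine integral_congr_ae ?_
        filter_upwards [z.pair_smul t] with x hx
        rw [← hK.extendZero_smul ht0, ← hx]
        rfl
      rw [h2, integral_const_mul, ← hκ, ht, ← Real.rpow_mul hκ0,
        show -(1 / r) * r = -1 by field_simp, Real.rpow_neg_one, inv_mul_cancel₀ h0.ne']
    · rw [X.smul_u, X.smul_v, fracForm_smul, fracForm_smul, fracForm_comm s z.u,
        fracForm_comm s z.v, fracForm_smul, fracForm_smul, X.frac]
      ring
  have h2 : t ^ 2 * κ ^ (2 / r) = 1 := by
    rw [ht, ← Real.rpow_two, ← Real.rpow_mul hκ0, ← Real.rpow_add h0]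
    rw [show -(1 / r) * 2 + 2 / r = 0 by ring, Real.rpow_zero]
  calc SK N s K * κ ^ (2 / r) ≤ t ^ 2 * z.frac * κ ^ (2 / r) := by gcongr
    _ = z.frac := by linear_combination z.frac * h2

end Extraction


/-! ### Palais-Smale sequences of the penalised functional -/

lemma tendsto_fderiv_apply {f : ℝ × ℝ → ℝ} (hf : ContDiff ℝ 1 f) {y w : ℕ → ℝ × ℝ}
    {y₀ w₀ : ℝ × ℝ} (hy : Tendsto y atTop (𝓝 y₀)) (hw : Tendsto w atTop (𝓝 w₀)) :
    Tendsto (fun n => fderiv ℝ f (y n) (w n)) atTop (𝓝 (fderiv ℝ f y₀ w₀)) := by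
  have h1 : Continuous (fun q : (ℝ × ℝ) × (ℝ × ℝ) => fderiv ℝ f q.1 q.2) :=
    ((hf.continuous_fderiv (by norm_num)).comp continuous_fst).clm_apply continuous_snd
  exact (h1.tendsto (y₀, w₀)).comp (hy.prodMk_nhds hw)

variable {N : ℕ}

namespace PenalizedProblem

variable {P : Potentials N} {s p : ℝ} {Q K h : ℝ × ℝ → ℝ} {ε δ : ℝ}

lemma δ_div_le (H : PenalizedProblem P s p Q K h ε δ) :
    δ / P.inf * (8 * (p + 1)) ≤ p - 2 := by
  rw [div_mul_eq_mul_div, div_le_iff₀ P.inf_pos]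
  linarith [H.δ_small]

lemma δ_setIntegral_le (H : PenalizedProblem P s p Q K h ε δ) (z : X P s ε) (S : Set (E N)) :
    δ * ∫ x in S, ‖z.pair x‖ ^ 2 ≤ δ / P.inf * z.pot := by
  have h1 := z.setIntegral_pair_sq_le S
  have hinf := P.inf_pos
  have h2 : δ * ∫ x in S, ‖z.pair x‖ ^ 2 = δ / P.inf * (P.inf * ∫ x in S, ‖z.pair x‖ ^ 2) := by
    field_simp
  rw [h2]
  exact mul_le_mul_of_nonneg_left h1 (div_nonneg H.δ_pos.le hinf.le)

lemma Q_nonneg (H : PenalizedProblem P s p Q K h ε δ) (z : X P s ε) :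
    0 ≤ ∫ x in scaledLam P ε, extendZero Q (z.pair x) :=
  integral_nonneg fun _ => H.hQ.extendZero_nonneg _

lemma K_nonneg (H : PenalizedProblem P s p Q K h ε δ) (z : X P s ε) :
    0 ≤ ∫ x in scaledLam P ε, extendZero K (z.pair x) :=
  integral_nonneg fun _ => H.hK.extendZero_nonneg _

lemma ae_tendsto_sub {z : ℕ → X P s ε} {z₀ : X P s ε}
    (hz : ∀ᵐ x, Tendsto (fun n => (z n).pair x) atTop (𝓝 (z₀.pair x))) :
    ∀ᵐ x, Tendsto (fun n => (z n - z₀).pair x) atTop (𝓝 0) := by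
  filter_upwards [hz, ae_all_iff.2 fun n => (z n).pair_sub z₀] with x hx hx'
  simp only [hx']
  simpa using hx.sub_const (z₀.pair x)

variable [NeZero N]

/-- Two values of `c` matter: `1/p` removes `Q` and bounds the norm, `1/2` removes the norm and
isolates the critical mass. -/
lemma penalizedFun_sub (H : PenalizedProblem P s p Q K h ε δ) (c : ℝ) (z : X P s ε) :
    penalizedFun P s Q K h ε z - c * fderiv ℝ (penalizedFun P s Q K h ε) z z =
      (1 / 2 - c) * ‖z‖ ^ 2 + (c * p - 1) * (∫ x in scaledLam P ε, extendZero Q (z.pair x)) +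
      (c - 1 / critExp N s) * (∫ x in scaledLam P ε, extendZero K (z.pair x)) +
      ∫ x in (scaledLam P ε)ᶜ, (c * fderiv ℝ h (z.pair x) (z.pair x) - h (z.pair x)) := by
  have h1 := H.nehariFun_eq z
  rw [nehariFun] at h1
  rw [h1, penalizedFun, integral_sub ((H.integrable_radial z).const_mul c) (H.integrable_h z),
    integral_const_mul]
  ring

/-- A bound on the integral over `Λᶜ` of a function of small quadratic growth. -/
lemma abs_integral_compl_le (H : PenalizedProblem P s p Q K h ε δ) {f : ℝ × ℝ → ℝ} {c : ℝ}
    (hc : 0 ≤ c) (hf : ∀ y, |f y| ≤ c * (δ * ‖y‖ ^ 2)) (z : X P s ε) :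
    |∫ x in (scaledLam P ε)ᶜ, f (z.pair x)| ≤ c * (δ / P.inf) * ‖z‖ ^ 2 := by
  have hi : IntegrableOn (fun x => ‖z.pair x‖ ^ 2) (scaledLam P ε)ᶜ :=
    z.integral_pair_sq_le.1.integrableOn
  have h1 : |∫ x in (scaledLam P ε)ᶜ, f (z.pair x)| ≤
      ∫ x in (scaledLam P ε)ᶜ, c * (δ * ‖z.pair x‖ ^ 2) := by
    rw [← Real.norm_eq_abs]
    exact norm_integral_le_of_norm_le ((hi.const_mul δ).const_mul c)
      (Eventually.of_forall fun x => hf _)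
  rw [integral_const_mul, integral_const_mul] at h1
  refine h1.trans ?_
  rw [mul_assoc]
  refine mul_le_mul_of_nonneg_left ((H.δ_setIntegral_le z _).trans ?_) hc
  exact mul_le_mul_of_nonneg_left z.pot_le (div_nonneg H.δ_pos.le P.inf_pos.le)

/-- The Ambrosetti-Rabinowitz type inequality. -/
lemma norm_sq_le_sub (H : PenalizedProblem P s p Q K h ε δ) (z : X P s ε) :
    (p - 2) / (4 * p) * ‖z‖ ^ 2 ≤ penalizedFun P s Q K h ε z -
      1 / p * fderiv ℝ (penalizedFun P s Q K h ε) z z := by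
  have hp := H.two_lt_p
  have hp0 : 0 < p := by linarith
  rw [H.penalizedFun_sub, one_div_mul_cancel hp0.ne', sub_self, zero_mul, add_zero]
  have h1 : 0 ≤ (1 / p - 1 / critExp N s) * ∫ x in scaledLam P ε, extendZero K (z.pair x) :=
    mul_nonneg (sub_nonneg.2 (one_div_le_one_div_of_le hp0 H.p_lt.le)) (H.K_nonneg z)
  have h2 := H.abs_integral_compl_le (f := fun y => 1 / p * fderiv ℝ h y y - h y)
    (c := 2) (by norm_num) (fun y => by
      have h3 := H.abs_le y
      have h4 := H.abs_radial_le y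
      have h5 : 1 / p ≤ 1 := by rw [div_le_one hp0]; linarith
      have h6 : |1 / p * fderiv ℝ h y y| ≤ δ * ‖y‖ ^ 2 := by
        rw [abs_mul, abs_of_pos (by positivity)]
        exact (mul_le_of_le_one_left (abs_nonneg _) h5).trans h4
      exact (abs_sub _ _).trans (by linarith)) z
  have h3 := neg_le_of_abs_le h2
  have h4 := H.δ_div_le
  -- The quadratic coefficient without penalisation is `(p-2)/(2p)`; the smallness of `δ` costs at
  -- most half of it.
  have h5 : (p - 2) / (4 * p) ≤ 1 / 2 - 1 / p - 2 * (δ / P.inf) := by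
    have h6 : δ / P.inf ≤ (p - 2) / (8 * (p + 1)) := by rwa [le_div_iff₀ (by linarith)]
    have h7 : (p - 2) / (8 * (p + 1)) ≤ (p - 2) / (8 * p) :=
      div_le_div_of_nonneg_left (by linarith) (by linarith) (by linarith)
    have h8 : (p - 2) / (4 * p) = 1 / 2 - 1 / p - 2 * ((p - 2) / (8 * p)) := by field_simp; ring
    linarith
  have h6 := mul_le_mul_of_nonneg_right h5 (sq_nonneg ‖z‖)
  linarith

/-- With coefficient `1/2` the quadratic part disappears, `Q` contributes nonnegatively as `p > 2`,
the outer part is nonnegative by `le_half`, and `1/2 - 1/2*_s = s/N`. -/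
lemma integral_K_le_sub (H : PenalizedProblem P s p Q K h ε δ) (z : X P s ε) :
    s / N * (∫ x in scaledLam P ε, extendZero K (z.pair x)) ≤ penalizedFun P s Q K h ε z -
      1 / 2 * fderiv ℝ (penalizedFun P s Q K h ε) z z := by
  have hp := H.two_lt_p
  rw [H.penalizedFun_sub]
  have h1 : 0 ≤ (1 / 2 * p - 1) * ∫ x in scaledLam P ε, extendZero Q (z.pair x) :=
    mul_nonneg (by linarith) (H.Q_nonneg z)
  have h2 : 0 ≤ ∫ x in (scaledLam P ε)ᶜ, (1 / 2 * fderiv ℝ h (z.pair x) (z.pair x) -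
      h (z.pair x)) := integral_nonneg fun x => sub_nonneg.2 (H.le_half _)
  have h3 : 1 / 2 - 1 / critExp N s = s / N := by
    have h4 := H.two_s_lt
    have h5 : (N : ℝ) ≠ 0 := by linarith [H.s_pos]
    have h6 : (N : ℝ) - 2 * s ≠ 0 := by linarith
    rw [critExp]
    field_simp
    ring
  rw [h3]
  linarith

section Sequence

variable {z : ℕ → X P s ε} {z₀ : X P s ε} {M : ℝ}

lemma norm_sub_le_of_bounded (hM : ∀ n, ‖z n‖ ≤ M) (n : ℕ) : ‖z n - z₀‖ ≤ M + ‖z₀‖ :=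
  (norm_sub_le _ _).trans (by linarith [hM n])

/-- As `p < 2*_s`, the integrand is at most a small multiple of critical powers, bounded in `L¹`,
plus a constant, integrable on a set of finite measure. -/
lemma tendsto_integral_Q (H : PenalizedProblem P s p Q K h ε δ) (hM : ∀ n, ‖z n‖ ≤ M)
    (hz : ∀ᵐ x, Tendsto (fun n => (z n).pair x) atTop (𝓝 (z₀.pair x))) :
    Tendsto (fun n => ∫ x in scaledLam P ε,
      fderiv ℝ (extendZero Q) ((z n).pair x) ((z n - z₀).pair x)) atTop (𝓝 0) := by
  obtain ⟨C, hC, hC'⟩ := H.hQ.norm_fderiv_extendZero_le H.one_lt_p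
  have hQ1 := H.hQ.contDiff_extendZero H.one_lt_p
  have hr0 : 0 ≤ critExp N s := by linarith [H.two_lt_crit]
  have hp1 := H.one_lt_p
  have hemb := embConst_nonneg P s
  have hfin : IsFiniteMeasure (volume.restrict (scaledLam P ε)) :=
    ⟨by simpa using (volume_scaledLam_ne_top P H.ε_pos).lt_top⟩
  refine tendsto_integral_of_abs (tendsto_integral_abs_of_le_mul_add
    (κ := fun n x => ‖(z n).pair x‖ ^ critExp N s + ‖(z n - z₀).pair x‖ ^ critExp N s)
    (M := embConst P s * M ^ critExp N s + embConst P s * (M + ‖z₀‖) ^ critExp N s)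
    (fun n => H.repQ.aestronglyMeasurable_fderiv hQ1 _ _) ?_
    (fun n => (H.repK.integrable _).add (H.repK.integrable _)) (fun n x => by positivity)
    (fun n => ?_) fun τ hτ => ?_)
  · filter_upwards [ae_restrict_of_ae hz, ae_restrict_of_ae (ae_tendsto_sub hz)] with x h1 h2
    simpa using tendsto_fderiv_apply hQ1 h1 h2
  · rw [integral_add (H.repK.integrable _) (H.repK.integrable _)]
    refine add_le_add ((H.repK.bound _).trans ?_) ((H.repK.bound _).trans ?_)
    · exact mul_le_mul_of_nonneg_left (Real.rpow_le_rpow (norm_nonneg _) (hM n) hr0) hemb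
    · exact mul_le_mul_of_nonneg_left (Real.rpow_le_rpow (norm_nonneg _)
        (norm_sub_le_of_bounded hM n) hr0) hemb
  · refine ⟨fun _ => C * (2 * (1 / (τ / C)) ^ (p / (critExp N s - p))), integrable_const _,
      fun n => Eventually.of_forall fun x => ?_⟩
    have hτC : 0 < τ / C := by positivity
    have h1 := rpow_le_mul_rpow_add (by linarith : 0 < p) H.p_lt hτC (norm_nonneg ((z n).pair x))
    have h2 := rpow_le_mul_rpow_add (by linarith : 0 < p) H.p_lt hτC
      (norm_nonneg ((z n - z₀).pair x))
    calc |fderiv ℝ (extendZero Q) ((z n).pair x) ((z n - z₀).pair x)|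
        ≤ C * ‖(z n).pair x‖ ^ (p - 1) * ‖(z n - z₀).pair x‖ :=
          (ContinuousLinearMap.le_opNorm _ _).trans (mul_le_mul_of_nonneg_right (hC' _) (norm_nonneg _))
      _ ≤ C * (‖(z n).pair x‖ ^ p + ‖(z n - z₀).pair x‖ ^ p) := by
          rw [mul_assoc]
          gcongr
          exact rpow_mul_le_add H.one_lt_p (norm_nonneg _) (norm_nonneg _)
      _ ≤ C * ((τ / C * ‖(z n).pair x‖ ^ critExp N s +
            (1 / (τ / C)) ^ (p / (critExp N s - p))) +
          (τ / C * ‖(z n - z₀).pair x‖ ^ critExp N s +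
            (1 / (τ / C)) ^ (p / (critExp N s - p)))) := by gcongr
      _ = _ := by field_simp; ring

/-- The common part of the convergence statements for the critical term. -/
lemma tendsto_integral_crit (H : PenalizedProblem P s p Q K h ε δ) (hM : ∀ n, ‖z n‖ ≤ M)
    {f : ℕ → E N → ℝ} {C : ℝ} (hC : 0 < C)
    (hfm : ∀ n, AEStronglyMeasurable (f n) (volume.restrict (scaledLam P ε)))
    (hf0 : ∀ᵐ x, Tendsto (fun n => f n x) atTop (𝓝 0))
    (hf : ∀ n, ∀ᵐ x, |f n x| ≤ C * ((‖(z n - z₀).pair x‖ + ‖z₀.pair x‖) ^ (critExp N s - 1) *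
      ‖z₀.pair x‖) + C * ‖z₀.pair x‖ ^ critExp N s) :
    Tendsto (fun n => ∫ x in scaledLam P ε, f n x) atTop (𝓝 0) := by
  have hr0 : 0 ≤ critExp N s := by linarith [H.two_lt_crit]
  have hemb := embConst_nonneg P s
  refine tendsto_integral_of_abs (tendsto_integral_abs_of_le_mul_add
    (κ := fun n x => ‖(z n - z₀).pair x‖ ^ critExp N s)
    (M := embConst P s * (M + ‖z₀‖) ^ critExp N s) hfm (ae_restrict_of_ae hf0)
    (fun n => H.repK.integrable _) (fun n x => by positivity) (fun n => ?_) fun τ hτ => ?_)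
  · exact (H.repK.bound _).trans (mul_le_mul_of_nonneg_left (Real.rpow_le_rpow (norm_nonneg _)
      (norm_sub_le_of_bounded hM n) hr0) hemb)
  · obtain ⟨D, hD, hD'⟩ := exists_add_rpow_mul_le H.one_lt_crit (div_pos hτ hC)
    refine ⟨fun x => (C * D + C) * ‖z₀.pair x‖ ^ critExp N s, (H.repK.integrable z₀).const_mul _,
      fun n => ?_⟩
    filter_upwards [ae_restrict_of_ae (hf n)] with x hx
    refine hx.trans ?_
    have h1 := mul_le_mul_of_nonneg_left
      (hD' _ _ (norm_nonneg ((z n - z₀).pair x)) (norm_nonneg (z₀.pair x))) hC.le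
    have h2 : C * (τ / C * ‖(z n - z₀).pair x‖ ^ critExp N s +
        D * ‖z₀.pair x‖ ^ critExp N s) = τ * ‖(z n - z₀).pair x‖ ^ critExp N s +
        C * D * ‖z₀.pair x‖ ^ critExp N s := by field_simp
    rw [h2] at h1
    linarith

/-- The Brezis-Lieb splitting of the critical term. -/
lemma tendsto_integral_K (H : PenalizedProblem P s p Q K h ε δ) (hM : ∀ n, ‖z n‖ ≤ M)
    (hz : ∀ᵐ x, Tendsto (fun n => (z n).pair x) atTop (𝓝 (z₀.pair x))) :
    Tendsto (fun n => (∫ x in scaledLam P ε, extendZero K ((z n).pair x)) -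
      (∫ x in scaledLam P ε, extendZero K ((z n - z₀).pair x))) atTop
      (𝓝 (∫ x in scaledLam P ε, extendZero K (z₀.pair x))) := by
  obtain ⟨C, hC, hC'⟩ := H.hK.norm_fderiv_extendZero_le H.one_lt_crit
  have hK1 := H.hK.contDiff_extendZero H.one_lt_crit
  have hr1 : 0 ≤ critExp N s - 1 := by linarith [H.one_lt_crit]
  have hK0 := abs_le_of_norm_fderiv_le H.one_lt_crit hK1 (extendZero_zero K) hC.le hC'
  have h1 := H.tendsto_integral_crit (z := z) (z₀ := z₀) hM (f := fun n x =>
    extendZero K ((z n).pair x) - extendZero K ((z n - z₀).pair x) - extendZero K (z₀.pair x)) hC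
    (fun n => (((H.integrable_K _).sub (H.integrable_K _)).sub (H.integrable_K _)).1) ?_ ?_
  · have h2 : ∀ n, ∫ x in scaledLam P ε, (extendZero K ((z n).pair x) -
        extendZero K ((z n - z₀).pair x) - extendZero K (z₀.pair x)) =
        (∫ x in scaledLam P ε, extendZero K ((z n).pair x)) -
        (∫ x in scaledLam P ε, extendZero K ((z n - z₀).pair x)) -
        ∫ x in scaledLam P ε, extendZero K (z₀.pair x) := fun n => by
      have h3 : IntegrableOn (fun x => extendZero K ((z n).pair x) -
        extendZero K ((z n - z₀).pair x)) (scaledLam P ε) :=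
          (H.integrable_K _).sub (H.integrable_K _)
      rw [integral_sub h3 (H.integrable_K _), integral_sub (H.integrable_K _) (H.integrable_K _)]
    simp only [h2] at h1
    simpa using h1.add_const (∫ x in scaledLam P ε, extendZero K (z₀.pair x))
  · filter_upwards [hz, ae_tendsto_sub hz] with x h2 h3
    have h4 := (hK1.continuous.tendsto _).comp h2
    have h5 := (hK1.continuous.tendsto _).comp h3
    rw [extendZero_zero] at h5
    have h6 := (h4.sub h5).sub_const (extendZero K (z₀.pair x))
    simpa [Function.comp_def] using h6
  · intro n
    filter_upwards [(z n).pair_sub z₀] with x hx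
    set w := (z n - z₀).pair x with hw
    set y := z₀.pair x with hy
    have hzn : (z n).pair x = w + y := by rw [hx]; abel
    rw [hzn]
    -- This ball contains both `w` and `w + y`, so the mean value inequality bounds `K(w + y) -
    -- K(w)`.
    have hb : ∀ v ∈ Metric.closedBall (0 : ℝ × ℝ) (‖w‖ + ‖y‖),
        ‖fderiv ℝ (extendZero K) v‖ ≤ C * (‖w‖ + ‖y‖) ^ (critExp N s - 1) := by
      intro v hv
      rw [mem_closedBall_zero_iff] at hv
      exact (hC' v).trans (mul_le_mul_of_nonneg_left
        (Real.rpow_le_rpow (norm_nonneg _) hv hr1) hC.le)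
    have h2 := (convex_closedBall (0 : ℝ × ℝ) (‖w‖ + ‖y‖)).norm_image_sub_le_of_norm_fderiv_le
      (fun v _ => hK1.differentiable (by norm_num) v) hb (x := w) (y := w + y)
      (by rw [mem_closedBall_zero_iff]; linarith [norm_nonneg y])
      (by rw [mem_closedBall_zero_iff]; exact norm_add_le _ _)
    rw [add_sub_cancel_left, Real.norm_eq_abs, mul_assoc] at h2
    exact (abs_sub _ _).trans (add_le_add h2 (hK0 y))

/-- Testing with the fixed function `z₀` places one factor `‖z₀‖` in the integrand, which prevents
concentration; Euler's identity evaluates the limit. -/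
lemma tendsto_integral_fderiv_K (H : PenalizedProblem P s p Q K h ε δ) (hM : ∀ n, ‖z n‖ ≤ M)
    (hz : ∀ᵐ x, Tendsto (fun n => (z n).pair x) atTop (𝓝 (z₀.pair x))) :
    Tendsto (fun n => ∫ x in scaledLam P ε,
      fderiv ℝ (extendZero K) ((z n).pair x) (z₀.pair x)) atTop
      (𝓝 (critExp N s * ∫ x in scaledLam P ε, extendZero K (z₀.pair x))) := by
  obtain ⟨C, hC, hC'⟩ := H.hK.norm_fderiv_extendZero_le H.one_lt_crit
  have hK1 := H.hK.contDiff_extendZero H.one_lt_crit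
  have hr0 : 0 ≤ critExp N s := by linarith [H.one_lt_crit]
  have hr1 : 0 ≤ critExp N s - 1 := by linarith [H.one_lt_crit]
  have hK0 := abs_le_of_norm_fderiv_le H.one_lt_crit hK1 (extendZero_zero K) hC.le hC'
  have hi : ∀ n, IntegrableOn (fun x => fderiv ℝ (extendZero K) ((z n).pair x) (z₀.pair x))
      (scaledLam P ε) := fun n => H.repK.integrable_fderiv H.one_lt_crit hK1 hC.le hC' _ _
  have h1 := H.tendsto_integral_crit (z := z) (z₀ := z₀) hM (f := fun n x =>
    fderiv ℝ (extendZero K) ((z n).pair x) (z₀.pair x) -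
      critExp N s * extendZero K (z₀.pair x)) (C := critExp N s * C)
    (mul_pos (by linarith [H.one_lt_crit]) hC)
    (fun n => ((hi n).sub ((H.integrable_K _).const_mul _)).1) ?_ ?_
  · have h2 : ∀ n, ∫ x in scaledLam P ε, (fderiv ℝ (extendZero K) ((z n).pair x) (z₀.pair x) -
        critExp N s * extendZero K (z₀.pair x)) =
        (∫ x in scaledLam P ε, fderiv ℝ (extendZero K) ((z n).pair x) (z₀.pair x)) -
        critExp N s * ∫ x in scaledLam P ε, extendZero K (z₀.pair x) := fun n => by
      rw [integral_sub (hi n) ((H.integrable_K _).const_mul _), integral_const_mul]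
    simp only [h2] at h1
    simpa using h1.add_const (critExp N s * ∫ x in scaledLam P ε, extendZero K (z₀.pair x))
  · filter_upwards [hz] with x h2
    have h4 := (tendsto_fderiv_apply hK1 h2 (tendsto_const_nhds (x := z₀.pair x))).sub_const
      (critExp N s * extendZero K (z₀.pair x))
    rw [H.hK.euler H.one_lt_crit, sub_self] at h4
    exact h4
  · intro n
    filter_upwards [(z n).pair_sub z₀] with x hx
    set w := (z n - z₀).pair x with hw
    set y := z₀.pair x with hy
    have hzn : (z n).pair x = w + y := by rw [hx]; abel
    rw [hzn]
    have h2 : |fderiv ℝ (extendZero K) (w + y) y| ≤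
        C * ((‖w‖ + ‖y‖) ^ (critExp N s - 1) * ‖y‖) := by
      rw [← mul_assoc]
      refine (ContinuousLinearMap.le_opNorm _ _).trans (mul_le_mul_of_nonneg_right
        ((hC' _).trans (mul_le_mul_of_nonneg_left
          (Real.rpow_le_rpow (norm_nonneg _) (norm_add_le _ _) hr1) hC.le)) (norm_nonneg _))
    have h3 : |critExp N s * extendZero K y| ≤ critExp N s * C * ‖y‖ ^ critExp N s := by
      rw [abs_mul, abs_of_nonneg hr0, mul_assoc]
      exact mul_le_mul_of_nonneg_left (hK0 y) hr0
    have h4 : 0 ≤ C * ((‖w‖ + ‖y‖) ^ (critExp N s - 1) * ‖y‖) := by positivity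
    have h5 := mul_le_mul_of_nonneg_right H.one_lt_crit.le h4
    refine (abs_sub _ _).trans (add_le_add (h2.trans ?_) h3)
    linarith

/-- Euler's identity in the direction `z` itself. Together with the two preceding limits, the
critical term tested with `z n - z₀` equals the critical mass of `z n - z₀` up to `o(1)`. -/
lemma integral_fderiv_K_sub (H : PenalizedProblem P s p Q K h ε δ) (z z₀ : X P s ε) :
    1 / critExp N s * (∫ x in scaledLam P ε,
      fderiv ℝ (extendZero K) (z.pair x) ((z - z₀).pair x)) =
    (∫ x in scaledLam P ε, extendZero K (z.pair x)) -
      1 / critExp N s * ∫ x in scaledLam P ε,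
        fderiv ℝ (extendZero K) (z.pair x) (z₀.pair x) := by
  obtain ⟨C, hC, hC'⟩ := H.hK.norm_fderiv_extendZero_le H.one_lt_crit
  have hK1 := H.hK.contDiff_extendZero H.one_lt_crit
  have hr : critExp N s ≠ 0 := by linarith [H.one_lt_crit]
  have hi := H.repK.integrable_fderiv H.one_lt_crit hK1 hC.le hC' z z₀
  have h1 : ∫ x in scaledLam P ε, fderiv ℝ (extendZero K) (z.pair x) ((z - z₀).pair x) =
      ∫ x in scaledLam P ε, (critExp N s * extendZero K (z.pair x) -
        fderiv ℝ (extendZero K) (z.pair x) (z₀.pair x)) := by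
    refine integral_congr_ae ?_
    filter_upwards [ae_restrict_of_ae (z.pair_sub z₀)] with x hx
    rw [hx, map_sub, H.hK.euler H.one_lt_crit]
  rw [h1, integral_sub ((H.integrable_K z).const_mul _) hi, integral_const_mul]
  field_simp

/-- The contribution of the complement of `Λ` is absorbed by the potential energy. -/
lemma exists_tendsto_integral_h_le (H : PenalizedProblem P s p Q K h ε δ) (hM : ∀ n, ‖z n‖ ≤ M)
    (hz : ∀ᵐ x, Tendsto (fun n => (z n).pair x) atTop (𝓝 (z₀.pair x))) :
    ∃ e : ℕ → ℝ, Tendsto e atTop (𝓝 0) ∧ ∀ n, ∫ x in (scaledLam P ε)ᶜ,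
      fderiv ℝ h ((z n).pair x) ((z n - z₀).pair x) ≤ 1 / 2 * (z n - z₀).pot + e n := by
  set μ := (volume : Measure (E N)).restrict (scaledLam P ε)ᶜ with hμ
  have hwi : ∀ w : X P s ε, Integrable (fun x => ‖w.pair x‖ ^ 2) μ := fun w =>
    w.integral_pair_sq_le.1.integrableOn
  have hinf := P.inf_pos
  have hδ := H.δ_pos
  -- With `w = z n - z₀`, the integrand is at most `δ(‖w‖² + ‖z₀‖‖w‖)`. The cross term tends to zero
  -- and is the error `e n`.
  have h1 := tendsto_integral_weight_mul (μ := μ) (ω := fun _ => 1)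
    (f := fun x => ‖z₀.pair x‖) (g := fun n x => ‖(z n - z₀).pair x‖)
    (M := 1 / P.inf * (M + ‖z₀‖) ^ 2) aestronglyMeasurable_const (fun _ => zero_le_one)
    z₀.aestronglyMeasurable_pair.norm.restrict
    (fun n => (z n - z₀).aestronglyMeasurable_pair.norm.restrict)
    (by simpa only [one_mul] using hwi z₀) (fun n => by simpa only [one_mul] using hwi _)
    (fun n => ?_) ?_
  · simp only [one_mul, abs_mul, abs_norm] at h1
    refine ⟨fun n => δ * ∫ x, ‖z₀.pair x‖ * ‖(z n - z₀).pair x‖ ∂μ,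
      by simpa using h1.const_mul δ, fun n => ?_⟩
    have hmul : Integrable (fun x => ‖z₀.pair x‖ * ‖(z n - z₀).pair x‖) μ := by
      have := integrable_weight_mul (μ := μ) (w := fun _ => 1)
        aestronglyMeasurable_const (fun _ => zero_le_one)
        z₀.aestronglyMeasurable_pair.norm.restrict
        (z n - z₀).aestronglyMeasurable_pair.norm.restrict
        (by simpa only [one_mul] using hwi z₀) (by simpa only [one_mul] using hwi (z n - z₀))
      simpa only [one_mul] using this
    have h2 : ∫ x, fderiv ℝ h ((z n).pair x) ((z n - z₀).pair x) ∂μ ≤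
        ∫ x, (δ * ‖(z n - z₀).pair x‖ ^ 2 + δ * (‖z₀.pair x‖ * ‖(z n - z₀).pair x‖)) ∂μ := by
      refine integral_mono_ae (H.repH.integrable_fderiv one_lt_two H.contDiff hδ.le
        H.norm_fderiv_le' _ _) (((hwi _).const_mul δ).add (hmul.const_mul δ)) ?_
      filter_upwards [ae_restrict_of_ae ((z n).pair_sub z₀)] with x hx
      set w := (z n - z₀).pair x with hw
      set y := z₀.pair x with hy
      have hzn : (z n).pair x = w + y := by rw [hx]; abel
      rw [hzn]
      calc fderiv ℝ h (w + y) w ≤ ‖fderiv ℝ h (w + y)‖ * ‖w‖ :=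
            (Real.le_norm_self _).trans (ContinuousLinearMap.le_opNorm _ _)
        _ ≤ δ * (‖w‖ + ‖y‖) * ‖w‖ := mul_le_mul_of_nonneg_right ((H.norm_fderiv_le _).trans
            (mul_le_mul_of_nonneg_left (norm_add_le _ _) hδ.le)) (norm_nonneg _)
        _ = _ := by ring
    rw [integral_add ((hwi _).const_mul δ) (hmul.const_mul δ), integral_const_mul,
      integral_const_mul] at h2
    have h3 := H.δ_setIntegral_le (z n - z₀) (scaledLam P ε)ᶜ
    have h4 : δ / P.inf ≤ 1 / 2 := by
      have h5 := H.δ_div_le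
      have h6 : 0 ≤ δ / P.inf := by positivity
      nlinarith [H.two_lt_p]
    have h5 := mul_le_mul_of_nonneg_right h4 (z n - z₀).pot_nonneg
    linarith
  · simp only [one_mul]
    have h2 := (z n - z₀).setIntegral_pair_sq_le (scaledLam P ε)ᶜ
    rw [one_div_mul_eq_div, le_div_iff₀ hinf, mul_comm]
    refine h2.trans ((z n - z₀).pot_le.trans ?_)
    exact pow_le_pow_left₀ (norm_nonneg _) (norm_sub_le_of_bounded hM n) 2
  · filter_upwards [ae_restrict_of_ae (ae_tendsto_sub hz)] with x hx
    simpa using hx.norm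

/-- Testing the equation with `z n - z₀`. -/
lemma exists_tendsto_frac_add_pot_le (H : PenalizedProblem P s p Q K h ε δ) (hM : ∀ n, ‖z n‖ ≤ M)
    (hz : ∀ᵐ x, Tendsto (fun n => (z n).pair x) atTop (𝓝 (z₀.pair x)))
    (hz' : Tendsto (fun n => ‖fderiv ℝ (penalizedFun P s Q K h ε) (z n)‖) atTop (𝓝 0)) :
    ∃ e : ℕ → ℝ, Tendsto e atTop (𝓝 0) ∧ ∀ n, (z n - z₀).frac + 1 / 2 * (z n - z₀).pot ≤
      (∫ x in scaledLam P ε, extendZero K ((z n - z₀).pair x)) + e n := by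
  obtain ⟨e, he, he'⟩ := H.exists_tendsto_integral_h_le hM hz
  have hr : critExp N s ≠ 0 := by linarith [H.one_lt_crit]
  have h1 := X.tendsto_inner_zero H.s_pos H.s_lt_one z₀ (norm_sub_le_of_bounded hM)
    (ae_tendsto_sub hz)
  have h2 := H.tendsto_integral_Q hM hz
  -- The two limits cancel: the factor `1/2*_s` undoes the `2*_s` from Euler's identity.
  have h3 := (H.tendsto_integral_K hM hz).sub
    ((H.tendsto_integral_fderiv_K hM hz).const_mul (1 / critExp N s))
  rw [← mul_assoc, one_div_mul_cancel hr, one_mul, sub_self] at h3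
  have h4 := hz'.mul_const (M + ‖z₀‖)
  rw [zero_mul] at h4
  have h5 := (((h4.sub h1).add h2).add h3).add he
  simp only [sub_zero, add_zero] at h5
  refine ⟨_, h5, fun n => ?_⟩
  have h6 := H.contDiff_penalizedFun.2 (z n) (z n - z₀)
  have h7 := H.integral_fderiv_K_sub (z n) z₀
  -- Writing `z n = (z n - z₀) + z₀` leaves the squared norm plus a weakly vanishing term.
  have h8 : inner ℝ (z n) (z n - z₀) = (z n - z₀).frac + (z n - z₀).pot +
      inner ℝ z₀ (z n - z₀) := by
    rw [← X.norm_sq, ← real_inner_self_eq_norm_sq, ← inner_add_left, sub_add_cancel]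
  have h9 : fderiv ℝ (penalizedFun P s Q K h ε) (z n) (z n - z₀) ≤
      ‖fderiv ℝ (penalizedFun P s Q K h ε) (z n)‖ * (M + ‖z₀‖) :=
    (Real.le_norm_self _).trans ((ContinuousLinearMap.le_opNorm _ _).trans
      (mul_le_mul_of_nonneg_left (norm_sub_le_of_bounded hM n) (norm_nonneg _)))
  have h10 := he' n
  linarith

end Sequence

/-- Palais-Smale sequences are bounded. -/
lemma exists_norm_le (H : PenalizedProblem P s p Q K h ε δ) {z : ℕ → X P s ε} {B : ℝ}
    (h1 : ∀ n, |penalizedFun P s Q K h ε (z n)| ≤ B)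
    (h2 : ∀ n, |fderiv ℝ (penalizedFun P s Q K h ε) (z n) (z n)| ≤ B * ‖z n‖) :
    ∃ M, ∀ n, ‖z n‖ ≤ M := by
  have hp := H.two_lt_p
  have hκ : 0 < (p - 2) / (4 * p) := div_pos (by linarith) (by linarith)
  -- For `‖z n‖ > 1` the energy bound `B` is at most `B ‖z n‖`, so the quadratic is dominated by `2B
  -- ‖z n‖`.
  refine ⟨max 1 (2 * B / ((p - 2) / (4 * p))), fun n => ?_⟩
  rcases le_or_gt ‖z n‖ 1 with hle | hgt
  · exact hle.trans (le_max_left _ _)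
  refine le_trans ?_ (le_max_right _ _)
  have hB : 0 ≤ B := (abs_nonneg _).trans (h1 n)
  rw [le_div_iff₀ hκ]
  have h3 := H.norm_sq_le_sub (z n)
  have h4 : |1 / p * fderiv ℝ (penalizedFun P s Q K h ε) (z n) (z n)| ≤ B * ‖z n‖ := by
    rw [abs_mul, abs_of_pos (by positivity)]
    refine (mul_le_of_le_one_left (abs_nonneg _) ?_).trans (h2 n)
    rw [div_le_one (by linarith)]; linarith
  have h5 := neg_le_of_abs_le h4
  have h6 := le_of_abs_le (h1 n)
  have h7 : (p - 2) / (4 * p) * ‖z n‖ ^ 2 ≤ 2 * B * ‖z n‖ := by nlinarith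
  nlinarith

lemma SK_nonneg (K : ℝ × ℝ → ℝ) (s : ℝ) : 0 ≤ SK N s K := by
  refine Real.sInf_nonneg ?_
  rintro _ ⟨u, v, -, -, -, rfl⟩
  exact add_nonneg (fracForm_self_nonneg _ _) (fracForm_self_nonneg _ _)

/-- Since `K ≥ 0`, the mass over the scaled set is at most that over `ℝ^N`, where the definition of
`S̃_K` applies. -/
lemma SK_mul_setIntegral_le (H : PenalizedProblem P s p Q K h ε δ) (w : X P s ε) :
    SK N s K * (∫ x in scaledLam P ε, extendZero K (w.pair x)) ^ (2 / critExp N s) ≤ w.frac := by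
  obtain ⟨C, hC, hC'⟩ := H.hK.norm_fderiv_extendZero_le H.one_lt_crit
  have hK1 := H.hK.contDiff_extendZero H.one_lt_crit
  have hi : Integrable (fun x => extendZero K (w.pair x)) := by
    have := (X.lpRepresentation P ε H.s_pos H.s_lt_one H.two_s_lt Set.univ H.two_lt_crit.le
      le_rfl).integrable_comp hK1.continuous (abs_le_of_norm_fderiv_le H.one_lt_crit hK1
        (extendZero_zero K) hC.le hC') w
    rwa [Measure.restrict_univ] at this
  refine le_trans (mul_le_mul_of_nonneg_left (Real.rpow_le_rpow (H.K_nonneg w)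
    (setIntegral_le_integral hi (Eventually.of_forall fun x => H.hK.extendZero_nonneg _))
    (div_nonneg two_pos.le (by linarith [H.two_lt_crit]))) (SK_nonneg K s))
    (w.SK_mul_rpow_le H.s_pos H.two_s_lt H.hK)

lemma exists_integral_K_le (H : PenalizedProblem P s p Q K h ε δ) :
    ∃ C > 0, ∀ z : X P s ε, (∫ x in scaledLam P ε, extendZero K (z.pair x)) ≤
      C * embConst P s * ‖z‖ ^ critExp N s := by
  obtain ⟨C, hC, hC'⟩ := H.hK.norm_fderiv_extendZero_le H.one_lt_crit
  have hK0 := abs_le_of_norm_fderiv_le H.one_lt_crit (H.hK.contDiff_extendZero H.one_lt_crit)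
    (extendZero_zero K) hC.le hC'
  refine ⟨C, hC, fun z => ?_⟩
  calc ∫ x in scaledLam P ε, extendZero K (z.pair x)
      ≤ ∫ x in scaledLam P ε, C * ‖z.pair x‖ ^ critExp N s :=
        integral_mono (H.integrable_K z) ((H.repK.integrable z).const_mul C)
          fun x => (le_abs_self _).trans (hK0 _)
    _ ≤ _ := by
        rw [integral_const_mul, mul_assoc]
        exact mul_le_mul_of_nonneg_left (H.repK.bound z) hC.le

lemma exists_integral_Q_le (H : PenalizedProblem P s p Q K h ε δ) :
    ∃ C > 0, ∀ z : X P s ε, (∫ x in scaledLam P ε, extendZero Q (z.pair x)) ≤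
      C * embConst P s * ‖z‖ ^ p := by
  obtain ⟨C, hC, hC'⟩ := H.hQ.norm_fderiv_extendZero_le H.one_lt_p
  have hQ0 := abs_le_of_norm_fderiv_le H.one_lt_p (H.hQ.contDiff_extendZero H.one_lt_p)
    (extendZero_zero Q) hC.le hC'
  refine ⟨C, hC, fun z => ?_⟩
  calc ∫ x in scaledLam P ε, extendZero Q (z.pair x)
      ≤ ∫ x in scaledLam P ε, C * ‖z.pair x‖ ^ p :=
        integral_mono (H.integrable_Q z) ((H.repQ.integrable z).const_mul C)
          fun x => (le_abs_self _).trans (hQ0 _)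
    _ ≤ _ := by
        rw [integral_const_mul, mul_assoc]
        exact mul_le_mul_of_nonneg_left (H.repQ.bound z) hC.le

/-- The alternative for the limit mass of the critical term. -/
lemma rpow_SK_le_of_mul_rpow_le (H : PenalizedProblem P s p Q K h ε δ) {κ : ℝ} (hκ : 0 < κ)
    (h1 : SK N s K * κ ^ (2 / critExp N s) ≤ κ) :
    SK N s K ^ ((N : ℝ) / (2 * s)) ≤ κ := by
  have hs := H.s_pos
  have hN : (0 : ℝ) < N := by linarith [H.two_s_lt]
  have hr : critExp N s ≠ 0 := by linarith [H.one_lt_crit]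
  have h2 : SK N s K ≤ κ ^ (2 * s / N) := by
    have h3 : κ = κ ^ (2 * s / N) * κ ^ (2 / critExp N s) := by
      rw [← Real.rpow_add hκ, ← critExp_sub_two_div H.s_pos H.two_s_lt, sub_div, div_self hr,
        sub_add_cancel, Real.rpow_one]
    refine le_of_mul_le_mul_right (h1.trans h3.le) (by positivity)
  have h4 := Real.rpow_le_rpow (SK_nonneg K s) h2 (z := (N : ℝ) / (2 * s)) (by positivity)
  rwa [← Real.rpow_mul hκ.le, show 2 * s / N * (N / (2 * s)) = (1 : ℝ) by field_simp,
    Real.rpow_one] at h4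

/-- The Palais-Smale condition below the critical level. -/
theorem palaisSmale (H : PenalizedProblem P s p Q K h ε δ) {c : ℝ}
    (hc : c < s / N * SK N s K ^ ((N : ℝ) / (2 * s))) :
    PalaisSmale (penalizedFun P s Q K h ε) c := by
  intro y hyc hy'
  have hN : (0 : ℝ) < N := by linarith [H.two_s_lt, H.s_pos]
  have hsN : 0 < s / N := div_pos H.s_pos hN
  have hr := H.one_lt_crit
  obtain ⟨B₁, hB₁⟩ := (Metric.isBounded_range_of_tendsto _ hyc).exists_norm_le
  obtain ⟨B₂, hB₂⟩ := (Metric.isBounded_range_of_tendsto _ hy').exists_norm_le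
  have hB₂' : ∀ n, ‖fderiv ℝ (penalizedFun P s Q K h ε) (y n)‖ ≤ B₂ := fun n => by
    simpa using hB₂ _ (Set.mem_range_self n)
  obtain ⟨M, hM⟩ := H.exists_norm_le (z := y) (B := max B₁ B₂)
    (fun n => (hB₁ _ (Set.mem_range_self n)).trans (le_max_left _ _))
    (fun n => (ContinuousLinearMap.le_opNorm _ _).trans (mul_le_mul_of_nonneg_right
      ((hB₂' n).trans (le_max_right _ _)) (norm_nonneg _)))
  obtain ⟨z₀, k, hk, hz⟩ := X.exists_seq_tendsto_ae H.s_pos H.s_lt_one hM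
  set z : ℕ → X P s ε := fun n => y (k n) with hzdef
  have hzM : ∀ n, ‖z n‖ ≤ M := fun n => hM _
  have hzc : Tendsto (fun n => penalizedFun P s Q K h ε (z n)) atTop (𝓝 c) :=
    hyc.comp hk.tendsto_atTop
  have hz' : Tendsto (fun n => ‖fderiv ℝ (penalizedFun P s Q K h ε) (z n)‖) atTop (𝓝 0) :=
    hy'.comp hk.tendsto_atTop
  obtain ⟨e, he, he'⟩ := H.exists_tendsto_frac_add_pot_le hzM hz hz'
  set m : ℕ → ℝ := fun n => ∫ x in scaledLam P ε, extendZero K ((z n - z₀).pair x) with hm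
  obtain ⟨C, hC, hCm⟩ := H.exists_integral_K_le
  have hm0 : ∀ n, m n ∈ Set.Icc 0 (C * embConst P s * (M + ‖z₀‖) ^ critExp N s) := fun n =>
    ⟨H.K_nonneg _, (hCm _).trans (mul_le_mul_of_nonneg_left (Real.rpow_le_rpow (norm_nonneg _)
      (norm_sub_le_of_bounded hzM n) (by linarith)) (mul_nonneg hC.le (embConst_nonneg P s)))⟩
  -- `κ` is the critical mass lost in the limit; the rest of the proof shows that it is zero.
  obtain ⟨κ, hκ, l, hl, hlκ⟩ := isCompact_Icc.tendsto_subseq hm0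
  have hl' := hl.tendsto_atTop
  have hzz : Tendsto (fun n => fderiv ℝ (penalizedFun P s Q K h ε) (z n) (z n)) atTop (𝓝 0) := by
    refine squeeze_zero_norm (fun n => (ContinuousLinearMap.le_opNorm _ _).trans
      (mul_le_mul_of_nonneg_left (hzM n) (norm_nonneg _))) ?_
    simpa using hz'.mul_const M
  -- By the Brezis-Lieb splitting the critical mass of `z n` tends to `κ` plus that of `z₀`; the
  -- latter is nonnegative and is dropped.
  have hκc : s / N * κ ≤ c := by
    have h1 : Tendsto (fun n => penalizedFun P s Q K h ε (z n) -
        1 / 2 * fderiv ℝ (penalizedFun P s Q K h ε) (z n) (z n) -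
        s / N * ((∫ x in scaledLam P ε, extendZero K ((z n).pair x)) - m n)) atTop
        (𝓝 (c - 1 / 2 * 0 - s / N * ∫ x in scaledLam P ε, extendZero K (z₀.pair x))) :=
      (hzc.sub (hzz.const_mul (1 / 2))).sub ((H.tendsto_integral_K hzM hz).const_mul _)
    have h2 := le_of_tendsto_of_tendsto' (hlκ.const_mul (s / N)) (h1.comp hl') fun n => by
      have h3 := H.integral_K_le_sub (z (l n))
      simp only [Function.comp_apply]
      linarith
    have h4 := mul_nonneg hsN.le (H.K_nonneg z₀)
    linarith
  have hκ0 : κ = 0 := by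
    by_contra hne
    have hpos : 0 < κ := lt_of_le_of_ne hκ.1 (Ne.symm hne)
    have h1 : Tendsto (fun n => SK N s K * (m (l n)) ^ (2 / critExp N s)) atTop
        (𝓝 (SK N s K * κ ^ (2 / critExp N s))) :=
      (hlκ.rpow_const (Or.inl hne)).const_mul _
    have h2 : Tendsto (fun n => m (l n) + e (l n)) atTop (𝓝 (κ + 0)) :=
      hlκ.add (he.comp hl')
    have h3 := le_of_tendsto_of_tendsto' h1 h2 fun n => by
      have h4 := H.SK_mul_setIntegral_le (z (l n) - z₀)
      have h5 := he' (l n)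
      have h6 := (z (l n) - z₀).pot_nonneg
      linarith
    rw [add_zero] at h3
    have h4 := mul_le_mul_of_nonneg_left (H.rpow_SK_le_of_mul_rpow_le hpos h3) hsN.le
    linarith
  -- Half of the potential energy is available, so twice the testing inequality dominates the
  -- squared norm.
  have hnorm : Tendsto (fun n => ‖z (l n) - z₀‖ ^ 2) atTop (𝓝 0) := by
    have h2 : Tendsto (fun n => 2 * (m (l n) + e (l n))) atTop (𝓝 (2 * (κ + 0))) :=
      (hlκ.add (he.comp hl')).const_mul 2
    rw [hκ0, add_zero, mul_zero] at h2
    refine squeeze_zero (fun n => sq_nonneg _) (fun n => ?_) h2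
    rw [X.norm_sq]
    have h5 := he' (l n)
    have h6 := (z (l n) - z₀).frac_nonneg
    linarith
  refine ⟨z₀, k ∘ l, hk.comp hl, tendsto_iff_norm_sub_tendsto_zero.2 ?_⟩
  have h7 := hnorm.sqrt
  simpa using h7

end PenalizedProblem


/-! ### From the free to the constrained Palais-Smale condition -/

section Nehari

variable {Y : Type*} [NormedAddCommGroup Y] [NormedSpace ℝ Y]

/-- The Lagrange multiplier rule for a pair of functionals, with the norm of the remainder. -/
lemma exists_norm_sub_smul_eq (f g : Y →L[ℝ] ℝ) :
    ∃ t : ℝ, ‖f - t • g‖ = ‖f.comp (LinearMap.ker g.toLinearMap).subtypeL‖ := by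
  -- Hahn-Banach: a norm-preserving extension of `f` from `ker g` differs from `f` by a functional
  -- vanishing on `ker g`, that is, by a multiple of `g`.
  obtain ⟨F, hF, hF'⟩ := exists_extension_norm_eq (LinearMap.ker g.toLinearMap)
    (f.comp (LinearMap.ker g.toLinearMap).subtypeL)
  have hker : ∀ x, g x = 0 → F x = f x := fun x hx => hF ⟨x, hx⟩
  by_cases hg : g = 0
  · refine ⟨0, ?_⟩
    rw [zero_smul, sub_zero, ← hF']
    congr 1
    ext x
    exact (hker x (by simp [hg])).symm
  obtain ⟨v, hv⟩ : ∃ v, g v ≠ 0 := by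
    by_contra! h
    exact hg (ContinuousLinearMap.ext h)
  refine ⟨(f v - F v) / g v, ?_⟩
  rw [← hF']
  congr 1
  ext x
  have h1 := hker (x - (g x / g v) • v) (by
    rw [map_sub, map_smul, smul_eq_mul, div_mul_cancel₀ _ hv, sub_self])
  simp only [map_sub, map_smul, smul_eq_mul] at h1
  change f x - (f v - F v) / g v * g x = F x
  have h2 : (f v - F v) / g v * g x = g x / g v * f v - g x / g v * F v := by ring
  rw [h2]
  linarith

/-- On a transversal Nehari manifold the full derivative is controlled by the tangential one. -/
lemma norm_fderiv_le_nehariDeriv {I : Y → ℝ} {α D : ℝ} (hα : 0 < α) (hD0 : 0 ≤ D) {z : Y}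
    (hz : z ∈ nehari I) (htr : fderiv ℝ (nehariFun I) z z ≤ -α * ‖z‖ ^ 2)
    (hD : ‖fderiv ℝ (nehariFun I) z‖ ≤ D * ‖z‖) :
    ‖fderiv ℝ I z‖ ≤ ‖nehariDeriv I z‖ * (1 + D / α) := by
  set f := fderiv ℝ I z with hf
  set g := fderiv ℝ (nehariFun I) z with hg
  obtain ⟨t, ht⟩ := exists_norm_sub_smul_eq f g
  change _ = ‖nehariDeriv I z‖ at ht
  rw [← ht]
  have hz0 : 0 < ‖z‖ := norm_pos_iff.2 hz.1
  have h1 : f z = 0 := hz.2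
  -- Evaluating at `z` itself, where `f` vanishes, isolates `t * g z`, and transversality bounds
  -- `|t| ‖z‖`.
  have h3 := (f - t • g).le_opNorm z
  have h3' : (f - t • g) z = -(t * g z) := by
    change f z - t * g z = _
    rw [h1, zero_sub]
  rw [h3', norm_neg, norm_mul, Real.norm_eq_abs, Real.norm_eq_abs] at h3
  have h4 : α * ‖z‖ ^ 2 ≤ |g z| := by
    have := neg_le_abs (g z)
    linarith
  have h5 := (mul_le_mul_of_nonneg_left h4 (abs_nonneg t)).trans h3
  have h6 : |t| * ‖z‖ ≤ ‖f - t • g‖ / α := by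
    rw [le_div_iff₀ hα]
    refine le_of_mul_le_mul_right ?_ hz0
    linarith
  have h7 : ‖t • g‖ ≤ ‖f - t • g‖ / α * D := by
    rw [norm_smul, Real.norm_eq_abs]
    calc |t| * ‖g‖ ≤ |t| * (D * ‖z‖) := mul_le_mul_of_nonneg_left hD (abs_nonneg _)
      _ = |t| * ‖z‖ * D := by ring
      _ ≤ _ := mul_le_mul_of_nonneg_right h6 hD0
  calc ‖f‖ = ‖(f - t • g) + t • g‖ := by rw [sub_add_cancel]
    _ ≤ ‖f - t • g‖ + ‖t • g‖ := norm_add_le _ _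
    _ ≤ ‖f - t • g‖ + ‖f - t • g‖ / α * D := by linarith
    _ = _ := by ring

/-- The Palais-Smale condition passes to a closed, transversal Nehari manifold. -/
theorem nehariPalaisSmale_of_palaisSmale {I : Y → ℝ} {c α : ℝ} (hI : PalaisSmale I c)
    (hφ : Continuous (nehariFun I)) (hα : 0 < α)
    (hbdd : ∀ z : ℕ → Y, (∀ n, z n ∈ nehari I) → Tendsto (fun n => I (z n)) atTop (𝓝 c) →
      ∃ M, ∀ n, ‖z n‖ ≤ M)
    (htr : ∀ z ∈ nehari I, fderiv ℝ (nehariFun I) z z ≤ -α * ‖z‖ ^ 2)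
    (hD : ∀ M : ℝ, ∃ D : ℝ, ∀ z : Y, ‖z‖ ≤ M → ‖fderiv ℝ (nehariFun I) z‖ ≤ D * ‖z‖)
    (h0 : (0 : Y) ∉ closure (nehari I)) : NehariPalaisSmale I c := by
  intro z hz hzc hz'
  obtain ⟨M, hM⟩ := hbdd z hz hzc
  obtain ⟨D, hD⟩ := hD M
  have hf0 : Tendsto (fun n => ‖fderiv ℝ I (z n)‖) atTop (𝓝 0) := by
    refine squeeze_zero (fun n => norm_nonneg _) (fun n => norm_fderiv_le_nehariDeriv hα
      (abs_nonneg D) (hz n) (htr _ (hz n)) ((hD _ (hM n)).trans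
        (mul_le_mul_of_nonneg_right (le_abs_self D) (norm_nonneg _)))) ?_
    simpa using hz'.mul_const (1 + |D| / α)
  obtain ⟨z', k, hk, hk'⟩ := hI z hzc hf0
  refine ⟨z', ⟨fun h => ?_, ?_⟩, k, hk, hk'⟩
  -- Continuity of `φ` alone would allow the limit `0`, which does not belong to the manifold.
  · exact h0 (h ▸ mem_closure_of_tendsto hk' (Eventually.of_forall fun n => hz (k n)))
  · exact tendsto_nhds_unique ((hφ.tendsto z').comp hk')
      (tendsto_const_nhds.congr fun n => (hz (k n)).2.symm)

end Nehari

/-! ### The Nehari manifold of the penalised functional -/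

lemma rpow_sub_one_le_mul {t M q : ℝ} (ht : 0 ≤ t) (htM : t ≤ M) (hq : 2 < q) :
    t ^ (q - 1) ≤ M ^ (q - 2) * t := by
  rcases ht.eq_or_lt with rfl | ht
  · rw [Real.zero_rpow (by linarith), mul_zero]
  · rw [show q - 1 = q - 2 + 1 by ring, Real.rpow_add_one ht.ne']
    exact mul_le_mul_of_nonneg_right (Real.rpow_le_rpow ht.le htM (by linarith)) ht.le

namespace PenalizedProblem

variable {N : ℕ} [NeZero N] {P : Potentials N} {s p : ℝ} {Q K h : ℝ × ℝ → ℝ} {ε δ : ℝ}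

/-- The Nehari manifold is transversal to rays. -/
lemma fderiv_nehariFun_self_le (H : PenalizedProblem P s p Q K h ε δ) {z : X P s ε}
    (hz : nehariFun (penalizedFun P s Q K h ε) z = 0) :
    fderiv ℝ (nehariFun (penalizedFun P s Q K h ε)) z z ≤ -((p - 2) / 2) * ‖z‖ ^ 2 := by
  have hp := H.two_lt_p
  have h1 := H.contDiff_nehariFun.2 z z
  simp only [H.hQ.euler H.one_lt_p, H.hK.euler H.one_lt_crit] at h1
  rw [integral_const_mul, integral_const_mul, real_inner_self_eq_norm_sq] at h1
  rw [H.nehariFun_eq] at hz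
  have hi := H.repH.integrable_fderiv one_lt_two H.contDiff_radial H.δ_pos.le
    H.norm_fderiv_radial_le' z z
  -- Subtracting `p` times the constraint cancels `Q`, leaves `(2-p)‖z‖²` and a nonpositive multiple
  -- of the `K` integral; this bounds the remaining outer integral.
  have h2 := H.abs_integral_compl_le
    (f := fun y => fderiv ℝ (fun y => fderiv ℝ h y y) y y - p * fderiv ℝ h y y) (c := p + 1)
    (by linarith) (fun y => by
      have h3 : |fderiv ℝ (fun y => fderiv ℝ h y y) y y| ≤ δ * ‖y‖ ^ 2 := by
        rw [← Real.norm_eq_abs]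
        refine (ContinuousLinearMap.le_opNorm _ _).trans ((mul_le_mul_of_nonneg_right
          (H.norm_fderiv_radial_le y) (norm_nonneg _)).trans_eq (by ring))
      have h4 := mul_le_mul_of_nonneg_left (H.abs_radial_le y) (by linarith : 0 ≤ p)
      refine (abs_sub _ _).trans ?_
      rw [abs_mul, abs_of_pos (by linarith : 0 < p)]
      linarith) z
  rw [integral_sub hi ((H.integrable_radial z).const_mul p), integral_const_mul] at h2
  have h3 := neg_le_of_abs_le h2
  have h4 := mul_le_mul_of_nonneg_right H.δ_div_le (sq_nonneg ‖z‖)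
  have h5 := mul_nonneg (sub_nonneg.2 H.p_lt.le) (H.K_nonneg z)
  have h6 : 0 ≤ (p - 2) * ‖z‖ ^ 2 := mul_nonneg (by linarith) (sq_nonneg _)
  nlinarith

/-- The bound must be linear in `‖z‖`, matching the control of `|t| ‖z‖` in the multiplier estimate.
-/
lemma exists_norm_fderiv_nehariFun_le (H : PenalizedProblem P s p Q K h ε δ) (M : ℝ) :
    ∃ D, ∀ z : X P s ε, ‖z‖ ≤ M →
      ‖fderiv ℝ (nehariFun (penalizedFun P s Q K h ε)) z‖ ≤ D * ‖z‖ := by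
  obtain ⟨C₁, hC₁, hQ⟩ := H.hQ.norm_fderiv_extendZero_le H.one_lt_p
  obtain ⟨C₂, hC₂, hK⟩ := H.hK.norm_fderiv_extendZero_le H.one_lt_crit
  have hp := H.two_lt_p
  have hδ := H.δ_pos
  have hemb := embConst_nonneg P s
  refine ⟨2 + p * (C₁ * embConst P s * M ^ (p - 2)) +
    C₂ * embConst P s * M ^ (critExp N s - 2) + δ * embConst P s, fun z hz => ?_⟩
  have hM : 0 ≤ M := (norm_nonneg z).trans hz
  refine ContinuousLinearMap.opNorm_le_bound _ (by positivity) fun w => ?_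
  have h1 := H.repQ.abs_integral_fderiv_le H.one_lt_p hC₁.le hQ z w
  have h2 := H.repK.abs_integral_fderiv_le H.one_lt_crit hC₂.le hK z w
  have h3 := H.repH.abs_integral_fderiv_le one_lt_two hδ.le H.norm_fderiv_radial_le' z w
  rw [show (2 : ℝ) - 1 = 1 by norm_num, Real.rpow_one] at h3
  have h4 : C₁ * embConst P s * ‖z‖ ^ (p - 1) * ‖w‖ ≤
      C₁ * embConst P s * (M ^ (p - 2) * ‖z‖) * ‖w‖ := by
    gcongr
    exact rpow_sub_one_le_mul (norm_nonneg _) hz hp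
  have h5 : C₂ * embConst P s * ‖z‖ ^ (critExp N s - 1) * ‖w‖ ≤
      C₂ * embConst P s * (M ^ (critExp N s - 2) * ‖z‖) * ‖w‖ := by
    gcongr
    exact rpow_sub_one_le_mul (norm_nonneg _) hz H.two_lt_crit
  have h6 : |2 * inner ℝ z w| ≤ 2 * (‖z‖ * ‖w‖) := by
    rw [abs_mul, abs_two]
    exact mul_le_mul_of_nonneg_left (abs_real_inner_le_norm z w) two_pos.le
  have h7 : |p * ∫ x in scaledLam P ε, fderiv ℝ (extendZero Q) (z.pair x) (w.pair x)| ≤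
      p * (C₁ * embConst P s * (M ^ (p - 2) * ‖z‖) * ‖w‖) := by
    rw [abs_mul, abs_of_pos (by linarith : 0 < p)]
    exact mul_le_mul_of_nonneg_left (h1.trans h4) (by linarith)
  rw [Real.norm_eq_abs, H.contDiff_nehariFun.2 z w]
  refine (abs_sub _ _).trans ((add_le_add ((abs_sub _ _).trans (add_le_add ((abs_sub _ _).trans
    (add_le_add h6 h7)) (h2.trans h5))) h3).trans_eq ?_)
  ring

/-- The constraint divided by `‖z‖²`, with the outer part absorbed into half of the norm. Both
exponents are positive, which excludes small `‖z‖`. -/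
lemma exists_half_le_of_mem_nehari (H : PenalizedProblem P s p Q K h ε δ) :
    ∃ A B : ℝ, ∀ z ∈ nehari (penalizedFun P s Q K h ε),
      1 / 2 ≤ A * ‖z‖ ^ (p - 2) + B * ‖z‖ ^ (critExp N s - 2) := by
  obtain ⟨C₁, hC₁, hQ⟩ := H.exists_integral_Q_le
  obtain ⟨C₂, hC₂, hK⟩ := H.exists_integral_K_le
  have hp := H.two_lt_p
  refine ⟨p * (C₁ * embConst P s), C₂ * embConst P s, fun z hz => ?_⟩
  have hz0 : 0 < ‖z‖ := norm_pos_iff.2 hz.1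
  have h1 := hz.2
  rw [H.nehariFun_eq] at h1
  have h2 := mul_le_mul_of_nonneg_left (hQ z) (by linarith : 0 ≤ p)
  have h3 := hK z
  have h4 := H.abs_integral_compl_le (f := fun y => fderiv ℝ h y y) (c := 1) zero_le_one
    (fun y => by rw [one_mul]; exact H.abs_radial_le y) z
  have h5 : δ / P.inf ≤ 1 / 2 := by
    have h6 := H.δ_div_le
    have h7 : 0 ≤ δ / P.inf := div_nonneg H.δ_pos.le P.inf_pos.le
    nlinarith
  have h6 := mul_le_mul_of_nonneg_right h5 (sq_nonneg ‖z‖)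
  have h7 := le_of_abs_le h4
  have key : ∀ q : ℝ, ‖z‖ ^ q = ‖z‖ ^ (q - 2) * ‖z‖ ^ 2 := fun q => by
    rw [← Real.rpow_two, ← Real.rpow_add hz0, sub_add_cancel]
  rw [key] at h2 h3
  refine le_of_mul_le_mul_right ?_ (by positivity : 0 < ‖z‖ ^ 2)
  linarith

/-- The Nehari manifold stays away from the origin. -/
lemma zero_notMem_closure_nehari (H : PenalizedProblem P s p Q K h ε δ) :
    (0 : X P s ε) ∉ closure (nehari (penalizedFun P s Q K h ε)) := by
  intro h0
  obtain ⟨z, hz, hz'⟩ := mem_closure_iff_seq_limit.1 h0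
  obtain ⟨A, B, hAB⟩ := H.exists_half_le_of_mem_nehari
  have hp := H.two_lt_p
  have hr := H.two_lt_crit
  have h1 := hz'.norm
  rw [norm_zero] at h1
  have h2 := ((h1.rpow_const (Or.inr (by linarith : 0 ≤ p - 2))).const_mul A).add
    ((h1.rpow_const (Or.inr (by linarith : 0 ≤ critExp N s - 2))).const_mul B)
  rw [Real.zero_rpow (by linarith), Real.zero_rpow (by linarith)] at h2
  have h3 := ge_of_tendsto' h2 fun n => hAB _ (hz n)
  norm_num at h3

/-- The Palais-Smale condition on the Nehari manifold. -/
theorem nehariPalaisSmale (H : PenalizedProblem P s p Q K h ε δ) {c : ℝ}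
    (hc : c < s / N * SK N s K ^ ((N : ℝ) / (2 * s))) :
    NehariPalaisSmale (penalizedFun P s Q K h ε) c := by
  refine nehariPalaisSmale_of_palaisSmale (H.palaisSmale hc) H.contDiff_nehariFun.1.continuous
    (α := (p - 2) / 2) (by linarith [H.two_lt_p]) (fun z hz hzc => ?_)
    (fun z hz => H.fderiv_nehariFun_self_le hz.2) H.exists_norm_fderiv_nehariFun_le
    H.zero_notMem_closure_nehari
  obtain ⟨B, hB⟩ := (Metric.isBounded_range_of_tendsto _ hzc).exists_norm_le
  have hB' : ∀ n, |penalizedFun P s Q K h ε (z n)| ≤ B := fun n => hB _ (Set.mem_range_self n)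
  refine H.exists_norm_le hB' fun n => ?_
  have h1 : fderiv ℝ (penalizedFun P s Q K h ε) (z n) (z n) = 0 := (hz n).2
  rw [h1, abs_zero]
  exact mul_nonneg ((abs_nonneg _).trans (hB' n)) (norm_nonneg _)

end PenalizedProblem

end FracSystem
end

theorem proposition4p1 {N : ℕ} [NeZero N] {s p : ℝ} (hs₀ : 0 < s) (hs₁ : s < 1)
    (hN : 2 * s < N) (P : FracSystem.Potentials N) {Q K : ℝ × ℝ → ℝ}
    (hp₂ : 2 < p) (hp : p < FracSystem.critExp N s)
    (hQ : FracSystem.HomogeneousNonlinearity p Q)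
    (hK : FracSystem.HomogeneousNonlinearity (FracSystem.critExp N s) K)
    (hKconc : ConcaveOn ℝ FracSystem.quadrant
      (FracSystem.powerTransform (FracSystem.critExp N s) K))
    (C : ℝ) :
    ∃ a₀ > 0, ∀ a : ℝ, 0 < a → a < a₀ → ∀ η : ℝ → ℝ, FracSystem.IsCutoff C a η →
      ∀ ε : ℝ, 0 < ε →
        ContDiff ℝ 1 (FracSystem.J P s Q K a η ε) ∧
        ContDiff ℝ 1 (FracSystem.nehariFun (FracSystem.J P s Q K a η ε)) ∧
        ∀ c : ℝ, c < s / N * FracSystem.SK N s K ^ ((N : ℝ) / (2 * s)) →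
          FracSystem.PalaisSmale (FracSystem.J P s Q K a η ε) c ∧
          FracSystem.NehariPalaisSmale (FracSystem.J P s Q K a η ε) c := by

  have hinf := P.inf_pos
  -- The largest `δ` allowed by `δ_small`. It depends on the potentials and on `p` only, so `a₀`
  -- does not depend on `ε`.
  have hδ : 0 < P.inf * (p - 2) / (8 * (p + 1)) :=
    div_pos (mul_pos hinf (by linarith)) (by linarith)
  obtain ⟨a₀, ha₀, h⟩ := FracSystem.exists_penalization hp₂ hp hQ hK C hδ
  refine ⟨a₀, ha₀, fun a ha ha' η hη ε hε => ?_⟩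
  obtain ⟨h1, h2, h3, h4, h5, h6⟩ := h a ha ha' η hη
  have H : FracSystem.PenalizedProblem P s p Q K
      (FracSystem.Qhat (FracSystem.critExp N s) Q K a η) ε (P.inf * (p - 2) / (8 * (p + 1))) :=
    { s_pos := hs₀, s_lt_one := hs₁, two_s_lt := hN, two_lt_p := hp₂, p_lt := hp, hQ := hQ
      hK := hK, ε_pos := hε, δ_pos := hδ
      δ_small := (div_mul_cancel₀ _ (by linarith)).le
      contDiff := h1, contDiff_radial := h2, norm_fderiv_le := h3, norm_fderiv_radial_le := h4
      le_half := h5, zero := h6 }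
  rw [FracSystem.J_eq_penalizedFun H]
  exact ⟨H.contDiff_penalizedFun.1, H.contDiff_nehariFun.1,
    fun c hc => ⟨H.palaisSmale hc, H.nehariPalaisSmale hc⟩⟩
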